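/- For a finite multigraph $G=(V,E)$ (loops and parallel edges allowed) let $r(A)=|V|-k(A)$ for $A\subseteq E$, where $k(A)$ is the number of connected components of $(V,A)$, and let $$T_G(x,y)=\sum_{A\subseteq E}(x-1)^{r(E)-r(A)}(y-1)^{|A|-r(A)}$$ be its Tutte polynomial. Then $$\max\{T_G(2a,0),\,T_G(0,2a)\}\ \ge\ T_G(a,a)\qquad\text{for all real } a\ge 2$$ whenever $G$ is one of the following: - a 4-edge-connected multigraph (it stays connected after the deletion of any at most three edges); - a 2-connected threshold graph (simple, more than two vertices, connected after the deletion of at most one vertex, and for some real vertex weights $w$ and some real $t$, distinct $u,v$ are adjacent iff $w(u)+w(v)>t$); - a complete bipartite graph $K_{m,n}$; - a simple series-parallel graph, i.e. a simple graph that can be built, through multigraphs, from an edgeless graph by repeatedly attaching a pendant edge, doubling an edge, or subdividing an edge (equivalently, each block that contains an edge is obtained from a single edge by doubling and subdividing edges); - a simple 3-regular graph (not necessarily connected); - a simple bipartite planar graph; - a Laman graph (a simple graph with $n\ge 2$ vertices and exactly $2n-3$ edges in which any $k\ge 2$ vertices span at most $2k-3$ edges); - a triangulation (a simple graph that can be drawn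 in the plane so that every face, including the outer one, is bounded by a triangle of the graph); - the wheel $W_n$, $n\ge 2$ ($n+1$ vertices and $2n$ edges: an $n$-cycle together with one more vertex joined to each of its vertices by one edge); - the $n\times n$ square lattice $L_n$, $n\ge 2$ (vertices $(i,j)$, $1\le i,j\le n$; two vertices are adjacent iff they differ by one in exactly one coordinate); - the $n$-cycle, $n\ge 2$; - a tree with $n$ edges, $n\ge 1$. Here the 2-cycle consists of two parallel edges, and so does the rim of $W_2$. Planar drawings are without crossings, with edges drawn as polygonal arcs. -/

import Mathlib

open scoped Graph

namespace MerinoWelsh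

/-! ### The Tutte polynomial of a multigraph -/

section Tutte

variable {α β : Type*}

/-- The rank of a set `A` of edges of the (finite) multigraph `G`, i.e. its rank in the cycle
matroid of `G`: the number of vertices minus the number of connected components of the spanning
subgraph with edge set `A`. The subtraction never truncates for finite `G`. -/
noncomputable def rank (G : Graph α β) (A : Set β) : ℕ :=
  V(G).ncard - Nat.card (G.restrict A).toSimpleGraph.ConnectedComponent

/-- The Tutte polynomial `T_G(x, y) = ∑_{A ⊆ E} (x - 1)^(r(E) - r(A)) (y - 1)^(|A| - r(A))` of the
finite multigraph `G`, evaluated at a real point. Since `r(A) ≤ r(E)` and `r(A) ≤ |A|`, the natural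
number subtractions in the exponents never truncate. -/
noncomputable def tutte (G : Graph α β) (x y : ℝ) : ℝ :=
  ∑ᶠ (A : Set β) (_ : A ⊆ E(G)),
    (x - 1) ^ (rank G E(G) - rank G A) * (y - 1) ^ (A.ncard - rank G A)

end Tutte

/-! ### Classes of graphs

All predicates are about finite multigraphs `G`. -/

section Classes

variable {α β : Type*}

/-- `G` is `k`-edge-connected: it stays connected whenever fewer than `k` edges are deleted. -/
def IsEdgeConnected (G : Graph α β) (k : ℕ) : Prop :=
  ∀ F : Set β, F ⊆ E(G) → F.ncard < k → (G.deleteEdges F).toSimpleGraph.Connected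

/-- `G` is `k`-connected: it has more than `k` vertices and stays connected whenever fewer than `k`
vertices are deleted. -/
def IsVertexConnected (G : Graph α β) (k : ℕ) : Prop :=
  k < V(G).ncard ∧
    ∀ X : Set α, X ⊆ V(G) → X.ncard < k → (G.induce (V(G) \ X)).toSimpleGraph.Connected

/-- `G` is a threshold graph: it is simple, and there are real vertex weights `w` and a threshold
`t` such that distinct vertices `u`, `v` are adjacent exactly when `w u + w v > t`. -/
def IsThreshold (G : Graph α β) : Prop :=
  G.Simple ∧ ∃ (w : α → ℝ) (t : ℝ), ∀ u ∈ V(G), ∀ v ∈ V(G), u ≠ v → (G.Adj u v ↔ t < w u + w v)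

/-- `G` is a complete bipartite graph `K_{m,n}`. -/
def IsCompleteBipartite (G : Graph α β) : Prop :=
  G.Simple ∧ ∃ m n : ℕ, Nonempty (G.toSimpleGraph ≃g completeBipartiteGraph (Fin m) (Fin n))

/-- `G` with the edge `e` placed so that its ends are `x` and `y`. If `e` is not an edge of `G`, it
is added; if it is one, its ends are changed. The vertices `x` and `y` are added if necessary. -/
def setLink (G : Graph α β) (e : β) (x y : α) : Graph α β where
  vertexSet := insert x (insert y V(G))
  IsLink f u v := (f ≠ e ∧ G.IsLink f u v) ∨ (f = e ∧ ((u = x ∧ v = y) ∨ (u = y ∧ v = x)))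
  edgeSet := insert e E(G)
  isLink_symm f _ := ⟨fun u v h ↦ by
    rcases h with ⟨h, h'⟩ | ⟨h, h'⟩
    · exact Or.inl ⟨h, h'.symm⟩
    · exact Or.inr ⟨h, by tauto⟩⟩
  eq_or_eq_of_isLink_of_isLink f u v w z h h' := by
    rcases h with ⟨h, h1⟩ | ⟨h, h1⟩ <;> rcases h' with ⟨h', h2⟩ | ⟨h', h2⟩
    · exact h1.left_eq_or_eq h2
    · exact absurd h' h
    · exact absurd h h'
    · rcases h1 with ⟨rfl, rfl⟩ | ⟨rfl, rfl⟩ <;> rcases h2 with ⟨rfl, rfl⟩ | ⟨rfl, rfl⟩ <;> simp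
  edge_mem_iff_exists_isLink f := by
    by_cases hf : f = e
    · subst hf
      exact ⟨fun _ ↦ ⟨x, y, Or.inr ⟨rfl, Or.inl ⟨rfl, rfl⟩⟩⟩, fun _ ↦ Set.mem_insert _ _⟩
    · simp [hf, G.edge_mem_iff_exists_isLink]
  left_mem_of_isLink f u v h := by
    rcases h with ⟨_, h⟩ | ⟨_, ⟨rfl, _⟩ | ⟨rfl, _⟩⟩
    · simp [h.left_mem]
    · simp
    · simp

/-- Series-parallel multigraphs, in the broad sense in which every block is obtained from a single
edge by doubling and subdividing edges: the multigraphs obtained from an edgeless graph by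
repeatedly attaching a pendant edge at a vertex, doubling an edge (adding an edge parallel to it),
and subdividing an edge by a new vertex. -/
inductive SeriesParallel : Graph α β → Prop
  /-- An edgeless graph. -/
  | edgeless (X : Set α) : SeriesParallel (Graph.noEdge X β)
  /-- Attach a new vertex `v` to the vertex `x` by a new edge `e`. -/
  | pendant (G : Graph α β) (e : β) (x v : α) (hG : SeriesParallel G)
      (hx : x ∈ V(G)) (hv : v ∉ V(G)) (he : e ∉ E(G)) : SeriesParallel (setLink G e x v)
  /-- Add a new edge `f` parallel to the edge `e = xy`. -/
  | double (G : Graph α β) (e f : β) (x y : α) (hG : SeriesParallel G)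
      (he : G.IsLink e x y) (hf : f ∉ E(G)) : SeriesParallel (setLink G f x y)
  /-- Replace the edge `e = xy` by the path `x, v, y` with edges `e`, `f`; `v` and `f` are new. -/
  | subdivide (G : Graph α β) (e f : β) (x y v : α) (hG : SeriesParallel G)
      (he : G.IsLink e x y) (hf : f ∉ E(G)) (hv : v ∉ V(G)) :
      SeriesParallel (setLink (setLink G e x v) f v y)

/-- `G` is a simple graph all of whose vertices have degree `3`. -/
def IsCubic (G : Graph α β) : Prop :=
  G.Simple ∧ ∀ v ∈ V(G), (G.incidenceSet v).ncard = 3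

/-- `S` is a polygonal arc with ends `a` and `b`: the union of the `k ≥ 1` segments of a simple
polygonal chain `p 0 = a, p 1, …, p k = b`. -/
def IsPolygonalArc (a b : ℝ × ℝ) (S : Set (ℝ × ℝ)) : Prop :=
  ∃ (k : ℕ) (p : ℕ → ℝ × ℝ), 1 ≤ k ∧ p 0 = a ∧ p k = b ∧
    (S = ⋃ i ∈ Set.Iio k, segment ℝ (p i) (p (i + 1))) ∧
    (∀ i < k, p i ≠ p (i + 1)) ∧
    (∀ i, i + 1 < k →
      segment ℝ (p i) (p (i + 1)) ∩ segment ℝ (p (i + 1)) (p (i + 2)) = {p (i + 1)}) ∧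
    (∀ i j, i + 1 < j → j < k →
      Disjoint (segment ℝ (p i) (p (i + 1))) (segment ℝ (p j) (p (j + 1))))

/-- A drawing of the (loopless) graph `G` in the plane without crossings: vertices are distinct
points, every edge is a polygonal arc between its ends, an edge contains no vertex other than its
ends, and two different edges meet only in vertices. -/
structure PlaneDrawing (G : Graph α β) where
  /-- The point representing a vertex. -/
  pos : α → ℝ × ℝ
  /-- The arc representing an edge. -/
  arc : β → Set (ℝ × ℝ)
  pos_injOn : Set.InjOn pos V(G)
  isArc : ∀ e x y, G.IsLink e x y → IsPolygonalArc (pos x) (pos y) (arc e)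
  eq_end : ∀ e x y z, G.IsLink e x y → z ∈ V(G) → pos z ∈ arc e → z = x ∨ z = y
  inter_subset : ∀ e ∈ E(G), ∀ f ∈ E(G), e ≠ f → arc e ∩ arc f ⊆ pos '' V(G)

/-- The point set of a drawing. -/
def PlaneDrawing.support {G : Graph α β} (D : PlaneDrawing G) : Set (ℝ × ℝ) :=
  (D.pos '' V(G)) ∪ ⋃ e ∈ E(G), D.arc e

/-- The faces of a drawing: the connected components of the complement of its point set. -/
def PlaneDrawing.IsFace {G : Graph α β} (D : PlaneDrawing G) (F : Set (ℝ × ℝ)) : Prop :=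
  ∃ p ∈ D.supportᶜ, F = connectedComponentIn D.supportᶜ p

/-- `G` is a simple bipartite planar graph. -/
def IsBipartitePlanar (G : Graph α β) : Prop :=
  G.Simple ∧ G.toSimpleGraph.IsBipartite ∧ Nonempty (PlaneDrawing G)

/-- `G` is a triangulation: a simple graph that can be drawn in the plane so that every face,
including the outer one, is bounded by a triangle of `G`. -/
def IsTriangulation (G : Graph α β) : Prop :=
  G.Simple ∧ ∃ D : PlaneDrawing G, ∀ F, D.IsFace F →
    ∃ (x y z : α) (e f g : β), G.IsLink e x y ∧ G.IsLink f y z ∧ G.IsLink g z x ∧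
      frontier F = D.arc e ∪ D.arc f ∪ D.arc g

/-- `G` is a Laman graph: a simple graph with `n ≥ 2` vertices and `2 n - 3` edges in which any
`k ≥ 2` vertices span at most `2 k - 3` edges. -/
def IsLaman (G : Graph α β) : Prop :=
  G.Simple ∧ 2 ≤ V(G).ncard ∧ E(G).ncard + 3 = 2 * V(G).ncard ∧
    ∀ X : Set α, X ⊆ V(G) → 2 ≤ X.ncard → E(G.induce X).ncard + 3 ≤ 2 * X.ncard

/-- `G` is the wheel `W_n` (`n ≥ 2`): the `n` rim vertices, indexed by `ZMod n`, form an `n`-cycle,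
and the hub (`none`) is joined to each of them by one edge. For `n = 2` the rim consists of two
parallel edges. -/
def IsWheel (G : Graph α β) (n : ℕ) : Prop :=
  ∃ (v : Option (ZMod n) ≃ V(G)) (e : ZMod n ⊕ ZMod n ≃ E(G)), ∀ i : ZMod n,
    G.IsLink (e (Sum.inl i)) (v (some i)) (v (some (i + 1))) ∧
    G.IsLink (e (Sum.inr i)) (v none) (v (some i))

/-- `G` is the `n × n` square lattice `L_n`: its vertices are the pairs `(i, j)` with
`0 ≤ i, j < n`, and two of them are adjacent when they differ by one in exactly one coordinate. -/
def IsSquareLattice (G : Graph α β) (n : ℕ) : Prop :=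
  G.Simple ∧
    Nonempty (G.toSimpleGraph ≃g (SimpleGraph.pathGraph n).boxProd (SimpleGraph.pathGraph n))

/-- `G` is the `n`-cycle (`n ≥ 2`). For `n = 2` it consists of two parallel edges. -/
def IsCycle (G : Graph α β) (n : ℕ) : Prop :=
  ∃ (v : ZMod n ≃ V(G)) (e : ZMod n ≃ E(G)), ∀ i : ZMod n, G.IsLink (e i) (v i) (v (i + 1))

/-- `G` is a tree with `n` edges. -/
def IsTree (G : Graph α β) (n : ℕ) : Prop :=
  G.Simple ∧ G.toSimpleGraph.IsTree ∧ E(G).ncard = n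

end Classes

end MerinoWelsh

/-! By deletion and contraction the Tutte polynomial has nonnegative coefficients in `x` and `y`,
and its value at `(2, 2)` is `2 ^ |E|`. If all its monomials have total degree at most `d`, then
`T(a, a) ≤ (a / 2) ^ d * 2 ^ |E|` for `a ≥ 2`. The expansion in `x - 1` and `y - 1` shows that any
`d` with `(r(E) - r(A)) + (|A| - r(A)) ≤ d` for all `A` will do.

Call `G` sparse if `|A| ≤ 2 r(A)` for every set `A` of edges. Then `d = r(E)` is allowed and `|E| ≤
2 r(E)`, so `T(a, a) ≤ (2a) ^ r(E)`. A sparse graph has no loops, and then `x ^ r(E) ≤ T(x, 0)` for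
`x ≥ 0`; at `x = 2a` this gives `T(a, a) ≤ T(2a, 0)`. Matroid duality turns this into `T(a, a) ≤
T(0, 2a)` for dense graphs, those with `2 r(E) ≤ 2 r(A) + |E \ A|` for all `A` (`tutteSum_diag_le`,
`tutteSum_diag_le_of_card_le`, `tutteSum_diag_le_of_le_card`).

It remains to show that every listed graph is sparse or dense. Sparsity follows if any `k ≥ 1`
vertices span at most `2k - 2` edges, or by induction for series-parallel graphs. Density follows
from two disjoint connected spanning subgraphs, or from counting the edges that leave the components
of `(V, A)` when `G` is 4-edge-connected.

The two planar classes rest on a mod 2 form of planar duality: the cycles of a drawn graph are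
exactly the jump sets of locally constant functions on the complement of the drawing
(`PlaneDrawing.exists_isSides`). Hence face boundaries span the cycle space. In a simple bipartite
graph a nonempty boundary has at least four edges, which gives `|E| ≤ 2 r(E)`, also for all
subgraphs. In a triangulation either every edge lies in two triangles, and a growing tower of
triangles proves density, or there are at most three edges. -/

namespace MerinoWelsh

/-! ### Rank functions and their Tutte polynomials -/

section RankFunction

variable {β : Type*} [DecidableEq β]

/-- The rank functions of finitary matroids, restricted to finite sets. -/
structure IsRankFunction (r : Finset β → ℕ) : Prop where
  empty : r ∅ = 0
  le_insert : ∀ e A, r A ≤ r (insert e A)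
  insert_le : ∀ e A, r (insert e A) ≤ r A + 1
  insert_add_le : ∀ e A B, A ⊆ B → r (insert e B) + r A ≤ r (insert e A) + r B

namespace IsRankFunction

variable {r : Finset β → ℕ}

lemma mono (hr : IsRankFunction r) {A B : Finset β} (h : A ⊆ B) : r A ≤ r B := by
  have h' : ∀ C : Finset β, r A ≤ r (A ∪ C) := by
    intro C
    induction C using Finset.induction_on with
    | empty => simp
    | insert e C he ih =>
      rw [Finset.union_insert]
      exact ih.trans (hr.le_insert e _)
  simpa [Finset.union_sdiff_of_subset h] using h' (B \ A)

lemma le_card (hr : IsRankFunction r) (A : Finset β) : r A ≤ A.card := by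
  induction A using Finset.induction_on with
  | empty => simp [hr.empty]
  | insert e A he ih =>
    rw [Finset.card_insert_of_notMem he]
    have := hr.insert_le e A
    omega

lemma singleton_le (hr : IsRankFunction r) (e : β) : r {e} ≤ 1 := by
  have := hr.le_card {e}
  simpa using this

lemma le_add_card_sdiff (hr : IsRankFunction r) (A B : Finset β) : r B ≤ r A + (B \ A).card := by
  have h : ∀ C : Finset β, r (A ∪ C) ≤ r A + C.card := by
    intro C
    induction C using Finset.induction_on with
    | empty => simp
    | insert e C he ih =>
      rw [Finset.card_insert_of_notMem he, Finset.union_insert]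
      have := hr.insert_le e (A ∪ C)
      omega
  exact (hr.mono (by grind)).trans (h (B \ A))

/-- Contraction of an element. -/
lemma contract (hr : IsRankFunction r) (e : β) :
    IsRankFunction fun A ↦ r (insert e A) - r {e} := by
  have h1 : ∀ A, r {e} ≤ r (insert e A) := fun A ↦ hr.mono (by simp)
  refine ⟨by simp, fun f A ↦ ?_, fun f A ↦ ?_, fun f A B h ↦ ?_⟩
  · have := hr.le_insert f (insert e A)
    simp only [Finset.insert_comm e f]
    omega
  · have := hr.insert_le f (insert e A)
    have := h1 A
    simp only [Finset.insert_comm e f]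
    omega
  · have h2 := hr.insert_add_le f _ _ (Finset.insert_subset_insert e h)
    have := h1 A
    have := h1 B
    have h3 := h1 (insert f A)
    have h4 := h1 (insert f B)
    simp only [Finset.insert_comm e f] at h3 h4 ⊢
    omega

/-- Duality on the ground set `E`. -/
lemma dual (hr : IsRankFunction r) (E : Finset β) :
    IsRankFunction fun A ↦ (A ∩ E).card + r (E \ A) - r E := by
  -- Hence the subtraction in the dual rank never truncates.
  have h0 : ∀ A, r E ≤ (A ∩ E).card + r (E \ A) := fun A ↦ by
    have := hr.le_add_card_sdiff (E \ A) E
    rwa [sdiff_sdiff_right_self, Finset.inf_eq_inter, Finset.inter_comm, add_comm] at this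
  have key : ∀ e A, e ∈ E → e ∉ A → (insert e A ∩ E).card = (A ∩ E).card + 1 ∧
      E \ A = insert e (E \ insert e A) := by
    intro e A he heA
    constructor
    · rw [Finset.insert_inter_of_mem he, Finset.card_insert_of_notMem (by simp [heA])]
    · grind
  have key' : ∀ e A, ¬ (e ∈ E ∧ e ∉ A) → insert e A ∩ E = A ∩ E ∧ E \ insert e A = E \ A := by
    intro e A h
    constructor <;> grind
  refine ⟨by simp, fun e A ↦ ?_, fun e A ↦ ?_, fun e A B hAB ↦ ?_⟩
  · by_cases h : e ∈ E ∧ e ∉ A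
    · obtain ⟨h1, h2⟩ := key e A h.1 h.2
      have := hr.insert_le e (E \ insert e A)
      rw [h1, h2]
      omega
    · rw [(key' e A h).1, (key' e A h).2]
  · by_cases h : e ∈ E ∧ e ∉ A
    · obtain ⟨h1, h2⟩ := key e A h.1 h.2
      have := hr.le_insert e (E \ insert e A)
      rw [h1, h2]
      omega
    · rw [(key' e A h).1, (key' e A h).2]
      omega
  · have b1 := h0 (insert e B)
    have b2 := h0 (insert e A)
    have b3 := h0 A
    have b4 := h0 B
    by_cases h : e ∈ E ∧ e ∉ B
    · obtain ⟨h1, h2⟩ := key e B h.1 h.2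
      obtain ⟨h3, h4⟩ := key e A h.1 (fun h' ↦ h.2 (hAB h'))
      have := hr.insert_add_le e (E \ insert e B) (E \ insert e A) (by grind)
      rw [h4] at b3 ⊢
      rw [h2] at b4 ⊢
      omega
    · rw [(key' e B h).1, (key' e B h).2] at *
      by_cases h : e ∈ E ∧ e ∉ A
      · obtain ⟨h1, h2⟩ := key e A h.1 h.2
        have := hr.insert_le e (E \ insert e A)
        rw [h1] at b2 ⊢
        rw [h2] at b3 ⊢
        omega
      · rw [(key' e A h).1, (key' e A h).2] at *
        omega

end IsRankFunction

/-- The Tutte polynomial of a rank function on the ground set `E`. -/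
noncomputable def tutteSum (r : Finset β → ℕ) (E : Finset β) (x y : ℝ) : ℝ :=
  ∑ A ∈ E.powerset, (x - 1) ^ (r E - r A) * (y - 1) ^ (A.card - r A)

variable {r : Finset β → ℕ}

/-- A loop changes no rank, so `A` and `insert e A` together contribute the term of `A` times `1 +
(y - 1)`. -/
lemma tutteSum_loop (hr : IsRankFunction r) {e : β} {E : Finset β} (he : e ∉ E) (h : r {e} = 0)
    (x y : ℝ) : tutteSum r (insert e E) x y = y * tutteSum r E x y := by
  have h1 : ∀ A, r (insert e A) = r A := fun A ↦ by
    have := hr.insert_add_le e ∅ A (by simp)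
    have := hr.le_insert e A
    have := hr.empty
    simp only [insert_empty_eq] at *
    omega
  unfold tutteSum
  rw [Finset.sum_powerset_insert he, Finset.mul_sum, ← Finset.sum_add_distrib]
  refine Finset.sum_congr rfl fun A hA ↦ ?_
  have heA : e ∉ A := fun h ↦ he (Finset.mem_powerset.1 hA h)
  have h2 := hr.le_card A
  rw [h1, h1, Finset.card_insert_of_notMem heA,
    show A.card + 1 - r A = (A.card - r A) + 1 by omega, pow_succ]
  ring

/-- By submodularity a coloop raises the rank of every `A ⊆ E`, so `A` and `insert e A` together
contribute the term of `A` times `(x - 1) + 1`. -/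
lemma tutteSum_coloop (hr : IsRankFunction r) {e : β} {E : Finset β} (he : e ∉ E)
    (h : r (insert e E) = r E + 1) (x y : ℝ) :
    tutteSum r (insert e E) x y = x * tutteSum r E x y := by
  unfold tutteSum
  rw [Finset.sum_powerset_insert he, Finset.mul_sum, ← Finset.sum_add_distrib]
  refine Finset.sum_congr rfl fun A hA ↦ ?_
  have hAE := Finset.mem_powerset.1 hA
  have heA : e ∉ A := fun h ↦ he (hAE h)
  have h1 := hr.insert_add_le e A E hAE
  have h2 := hr.insert_le e A
  have h3 := hr.mono hAE
  rw [Finset.card_insert_of_notMem heA, h, show r E + 1 - r A = (r E - r A) + 1 by omega,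
    show r (insert e A) = r A + 1 by omega, show r E + 1 - (r A + 1) = r E - r A by omega,
    show A.card + 1 - (r A + 1) = A.card - r A by omega, pow_succ]
  ring

/-- The subsets without `e` give the deletion, those with `e` the contraction. -/
lemma tutteSum_deletion_contraction (hr : IsRankFunction r) {e : β} {E : Finset β} (he : e ∉ E)
    (h : r {e} ≠ 0) (h' : r (insert e E) = r E) (x y : ℝ) :
    tutteSum r (insert e E) x y =
      tutteSum r E x y + tutteSum (fun A ↦ r (insert e A) - r {e}) E x y := by
  unfold tutteSum
  rw [Finset.sum_powerset_insert he, h']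
  congr 1
  refine Finset.sum_congr rfl fun A hA ↦ ?_
  have hAE := Finset.mem_powerset.1 hA
  have heA : e ∉ A := fun h ↦ he (hAE h)
  have h1 := hr.singleton_le e
  have h2 : r {e} ≤ r (insert e A) := hr.mono (by simp)
  have h3 : r (insert e A) ≤ r (insert e E) := hr.mono (Finset.insert_subset_insert e hAE)
  simp only
  rw [Finset.card_insert_of_notMem heA, h']
  congr 2 <;> omega

/-- Every case of the deletion-contraction recursion preserves nonnegativity; a loop contributes the
factor `y = 0`. -/
lemma tutteSum_zero_nonneg (hr : IsRankFunction r) (E : Finset β) {x : ℝ} (hx : 0 ≤ x) :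
    0 ≤ tutteSum r E x 0 := by
  induction E using Finset.induction_on generalizing r with
  | empty => simp [tutteSum]
  | insert e E he ih =>
    by_cases h : r {e} = 0
    · simp [tutteSum_loop hr he h]
    by_cases h' : r (insert e E) = r E
    · rw [tutteSum_deletion_contraction hr he h h']
      exact add_nonneg (ih hr) (ih (hr.contract e))
    · have h1 := hr.insert_le e E
      have h2 := hr.le_insert e E
      rw [tutteSum_coloop hr he (by omega)]
      exact mul_nonneg hx (ih hr)

/-- Deleting non-coloops, with the nonnegative contraction terms dropped, leads to a set of coloops,
each contributing a factor `x`. Loops have to be excluded because they make the value vanish at `y =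
0`. -/
lemma pow_rank_le_tutteSum (hr : IsRankFunction r) (E : Finset β) (hE : ∀ e ∈ E, r {e} ≠ 0) {x : ℝ}
    (hx : 0 ≤ x) : x ^ r E ≤ tutteSum r E x 0 := by
  induction E using Finset.induction_on with
  | empty => simp [tutteSum, hr.empty]
  | insert e E he ih =>
    have ih := ih fun f hf ↦ hE f (Finset.mem_insert_of_mem hf)
    by_cases h' : r (insert e E) = r E
    · rw [tutteSum_deletion_contraction hr he (hE e (by simp)) h', h']
      linarith [tutteSum_zero_nonneg (hr.contract e) E hx]
    · have h1 := hr.insert_le e E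
      have h2 := hr.le_insert e E
      rw [tutteSum_coloop hr he (by omega), show r (insert e E) = r E + 1 by omega, pow_succ']
      exact mul_le_mul_of_nonneg_left ih hx

/-- If all monomials of the Tutte polynomial have total degree at most `d`, its diagonal values
grow at most like `a ^ d` beyond the value `2 ^ |E|` at `(2, 2)`. -/
lemma tutteSum_diag_le (hr : IsRankFunction r) (E : Finset β) (d : ℕ)
    (hd : ∀ A ⊆ E, r E + A.card ≤ d + 2 * r A) {a : ℝ} (ha : 2 ≤ a) :
    tutteSum r E a a ≤ (a / 2) ^ d * 2 ^ E.card := by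
  induction E using Finset.induction_on generalizing r d with
  | empty =>
    simpa [tutteSum] using one_le_pow₀ (by linarith : 1 ≤ a / 2)
  | insert e E he ih =>
    rw [Finset.card_insert_of_notMem he]
    by_cases h : r {e} = 0
    · have h1 : ∀ A, r (insert e A) = r A := fun A ↦ by
        have := hr.insert_add_le e ∅ A (by simp)
        have := hr.le_insert e A
        have := hr.empty
        simp only [insert_empty_eq] at *
        omega
      -- The bound for `insert e A` shows that splitting off the factor `y` of a loop lowers the
      -- admissible degree by one; `A = ∅` shows that `d` is positive.
      have h2 : ∀ A ⊆ E, r E + A.card + 1 ≤ d + 2 * r A := fun A hA ↦ by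
        have := hd _ (Finset.insert_subset_insert e hA)
        rw [Finset.card_insert_of_notMem fun h ↦ he (hA h), h1, h1] at this
        omega
      obtain ⟨d, rfl⟩ : ∃ d', d = d' + 1 := by
        have h3 := h2 ∅ (by simp)
        rw [hr.empty] at h3
        exact ⟨d - 1, by omega⟩
      rw [tutteSum_loop hr he h]
      have := ih hr d fun A hA ↦ by have := h2 A hA; omega
      calc a * tutteSum r E a a ≤ a * ((a / 2) ^ d * 2 ^ E.card) := by gcongr
        _ = _ := by rw [pow_succ, pow_succ]; ring
    by_cases h' : r (insert e E) = r E
    · have ih1 := ih hr d fun A hA ↦ by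
        have := hd A (hA.trans (Finset.subset_insert _ _))
        omega
      -- The contraction lowers both ranks by one, so its degree condition at `A` is the given one
      -- at `insert e A`. Deletion and contraction thus keep `d`, and the sum of their two bounds
      -- doubles `2 ^ |E|`.
      have ih2 := ih (hr.contract e) d fun A hA ↦ by
        have h1 := hd _ (Finset.insert_subset_insert e hA)
        rw [Finset.card_insert_of_notMem fun h ↦ he (hA h)] at h1
        have h2 := hr.singleton_le e
        have h3 : r {e} ≤ r (insert e A) := hr.mono (by simp)
        have h4 : r {e} ≤ r (insert e E) := hr.mono (by simp)
        omega
      rw [tutteSum_deletion_contraction hr he h h', pow_succ]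
      linarith
    · have h1 := hr.insert_le e E
      have h2 := hr.le_insert e E
      have h2 : ∀ A ⊆ E, r E + A.card + 1 ≤ d + 2 * r A := fun A hA ↦ by
        have := hd _ (hA.trans (Finset.subset_insert e E))
        omega
      obtain ⟨d, rfl⟩ : ∃ d', d = d' + 1 := by
        have h3 := h2 ∅ (by simp)
        rw [hr.empty] at h3
        exact ⟨d - 1, by omega⟩
      rw [tutteSum_coloop hr he (by omega)]
      have := ih hr d fun A hA ↦ by have := h2 A hA; omega
      calc a * tutteSum r E a a ≤ a * ((a / 2) ^ d * 2 ^ E.card) := by gcongr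
        _ = _ := by rw [pow_succ, pow_succ]; ring

/-- The assumption makes `d = r E` an admissible degree. It also excludes loops, which the lower
bound for the value at `(2 * a, 0)` needs. -/
lemma tutteSum_diag_le_of_card_le (hr : IsRankFunction r) (E : Finset β)
    (h : ∀ A ⊆ E, A.card ≤ 2 * r A) {a : ℝ} (ha : 2 ≤ a) :
    tutteSum r E a a ≤ tutteSum r E (2 * a) 0 := by
  have h1 := tutteSum_diag_le hr E (r E) (fun A hA ↦ by have := h A hA; omega) ha
  have h2 := pow_rank_le_tutteSum hr E (fun e he ↦ by
    have := h {e} (by simpa using he)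
    rw [Finset.card_singleton] at this
    omega) (by linarith : 0 ≤ 2 * a)
  calc tutteSum r E a a ≤ (a / 2) ^ r E * 2 ^ E.card := h1
    _ ≤ (a / 2) ^ r E * 2 ^ (2 * r E) := by
      have := h E subset_rfl
      gcongr
      norm_num
    _ = (2 * a) ^ r E := by rw [pow_mul, ← mul_pow]; congr 1; ring
    _ ≤ _ := h2

/-- Complementation in `E` interchanges the exponents `r E - r A` and `|A| - r A`. -/
lemma tutteSum_dual (hr : IsRankFunction r) (E : Finset β) (x y : ℝ) :
    tutteSum (fun A ↦ (A ∩ E).card + r (E \ A) - r E) E x y = tutteSum r E y x := by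
  unfold tutteSum
  refine Finset.sum_bij' (fun A _ ↦ E \ A) (fun A _ ↦ E \ A) (by simp) (by simp) (fun A hA ↦ ?_)
    (fun A hA ↦ ?_) (fun A hA ↦ ?_)
  · simpa using Finset.mem_powerset.1 hA
  · simpa using Finset.mem_powerset.1 hA
  · have hA := Finset.mem_powerset.1 hA
    have h1 := hr.le_card (E \ A)
    have h2 : r (E \ A) ≤ r E := hr.mono Finset.sdiff_subset
    have h3 := hr.le_add_card_sdiff (E \ A) E
    rw [Finset.sdiff_sdiff_eq_self hA] at h3
    have h4 := Finset.card_sdiff_add_card_eq_card hA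
    have h5 := hr.le_card E
    have h6 := hr.empty
    beta_reduce
    rw [Finset.inter_eq_left.2 hA, Finset.inter_self, Finset.sdiff_self, mul_comm]
    congr 2 <;> omega

lemma tutteSum_diag_le_of_le_card (hr : IsRankFunction r) (E : Finset β)
    (h : ∀ A ⊆ E, 2 * r E ≤ 2 * r A + (E \ A).card) {a : ℝ} (ha : 2 ≤ a) :
    tutteSum r E a a ≤ tutteSum r E 0 (2 * a) := by
  rw [← tutteSum_dual hr E, ← tutteSum_dual hr E]
  refine tutteSum_diag_le_of_card_le (hr.dual E) E (fun A hA ↦ ?_) ha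
  have h1 := h (E \ A) Finset.sdiff_subset
  rw [Finset.sdiff_sdiff_eq_self hA] at h1
  have h2 := hr.le_add_card_sdiff (E \ A) E
  rw [Finset.sdiff_sdiff_eq_self hA] at h2
  simp only [Finset.inter_eq_left.2 hA]
  omega

end RankFunction

/-! ### The binary representation of the cycle matroid -/

section Binary

variable {α β : Type*}

open Classical in
/-- The column of the edge `e` in the binary incidence matrix of `G`. -/
noncomputable def edgeVec (G : Graph α β) (e : β) : α →₀ ZMod 2 :=
  if h : ∃ x y, G.IsLink e x y then .single h.choose 1 + .single h.choose_spec.choose 1 else 0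

/-- The sum is symmetric in the two ends, so the chosen pair does not matter. For a loop the two
terms cancel mod 2. -/
lemma edgeVec_eq {G : Graph α β} {e : β} {x y : α} (h : G.IsLink e x y) :
    edgeVec G e = .single x 1 + .single y 1 := by
  have h' : ∃ x y, G.IsLink e x y := ⟨x, y, h⟩
  rw [edgeVec, dif_pos h']
  rcases h'.choose_spec.choose_spec.eq_and_eq_or_eq_and_eq h with ⟨h1, h2⟩ | ⟨h1, h2⟩
  · exact congr_arg₂ (fun u v ↦ Finsupp.single u 1 + Finsupp.single v 1) h1 h2
  · rw [add_comm]
    exact congr_arg₂ (fun u v ↦ Finsupp.single u 1 + Finsupp.single v 1) h2 h1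

lemma edgeVec_of_notMem {G : Graph α β} {e : β} (h : e ∉ E(G)) : edgeVec G e = 0 := by
  rw [edgeVec, dif_neg]
  rintro ⟨x, y, h'⟩
  exact h h'.edge_mem

lemma finrank_sup_span_of_notMem {K M : Type*} [Field K] [AddCommGroup M] [Module K M]
    {p : Submodule K M} [FiniteDimensional K p] {x : M} (h : x ∉ p) :
    Module.finrank K (p ⊔ Submodule.span K {x} : Submodule K M) = Module.finrank K p + 1 := by
  have h0 : x ≠ 0 := fun h' ↦ h (by rw [h']; exact zero_mem _)
  have h1 := Submodule.finrank_sup_add_finrank_inf_eq p (Submodule.span K {x})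
  rwa [disjoint_iff.1 (Submodule.disjoint_span_singleton_of_notMem h), finrank_bot, add_zero,
    finrank_span_singleton h0] at h1

/-- The span of the columns of the edges in `A`. -/
noncomputable def edgeSpan (G : Graph α β) (A : Set β) : Submodule (ZMod 2) (α →₀ ZMod 2) :=
  Submodule.span (ZMod 2) (edgeVec G '' A)

/-- `u` and `v` are connected by edges of `A`. -/
def Joined (G : Graph α β) (A : Set β) (u v : α) : Prop :=
  (.single u 1 + .single v 1 : α →₀ ZMod 2) ∈ edgeSpan G A

lemma edgeSpan_mono (G : Graph α β) {A B : Set β} (h : A ⊆ B) : edgeSpan G A ≤ edgeSpan G B :=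
  Submodule.span_mono (Set.image_mono h)

lemma edgeVec_mem_edgeSpan (G : Graph α β) {A : Set β} {e : β} (h : e ∈ A) :
    edgeVec G e ∈ edgeSpan G A :=
  Submodule.subset_span ⟨e, h, rfl⟩

lemma zmod_two_add_self {M : Type*} [AddCommGroup M] [Module (ZMod 2) M] (x : M) : x + x = 0 := by
  rw [← two_smul (ZMod 2), show (2 : ZMod 2) = 0 from rfl, zero_smul]

variable {G : Graph α β} {A B : Set β} {u v w : α} {e : β}

lemma Joined.refl (G : Graph α β) (A : Set β) (u : α) : Joined G A u u := by
  rw [Joined, zmod_two_add_self]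
  exact zero_mem _

lemma Joined.symm (h : Joined G A u v) : Joined G A v u := by
  rwa [Joined, add_comm]

lemma Joined.trans (h : Joined G A u v) (h' : Joined G A v w) : Joined G A u w := by
  have h1 := add_mem h h'
  have h2 : (.single u 1 + .single v 1 + (.single v 1 + .single w 1) : α →₀ ZMod 2) =
      .single u 1 + .single w 1 + (.single v 1 + .single v 1) := by abel
  rwa [h2, zmod_two_add_self, add_zero] at h1

lemma Joined.mono (h : Joined G A u v) (hAB : A ⊆ B) : Joined G B u v :=
  edgeSpan_mono G hAB h

lemma Joined.of_isLink (h : G.IsLink e u v) (he : e ∈ A) : Joined G A u v := by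
  rw [Joined, ← edgeVec_eq h]
  exact edgeVec_mem_edgeSpan G he

lemma joined_iff_edgeVec (h : G.IsLink e u v) : edgeVec G e ∈ edgeSpan G A ↔ Joined G A u v := by
  rw [Joined, edgeVec_eq h]

lemma joined_of_reachable {u v : V(G.restrict A)}
    (h : (G.restrict A).toSimpleGraph.Reachable u v) : Joined G A u v := by
  rw [SimpleGraph.reachable_iff_reflTransGen] at h
  induction h with
  | refl => exact .refl _ _ _
  | tail _ h ih =>
    obtain ⟨e, he, h⟩ := h.2
    exact ih.trans (.of_isLink h he)

/-- The incidence map of components. -/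
noncomputable def toComponents (G : Graph α β) (A : Set β) :
    (V(G.restrict A) →₀ ZMod 2) →ₗ[ZMod 2]
      ((G.restrict A).toSimpleGraph.ConnectedComponent →₀ ZMod 2) :=
  Finsupp.lmapDomain _ _ (G.restrict A).toSimpleGraph.connectedComponentMk

/-- The columns of `A` span the vectors on `V(G)` whose coordinates sum to zero on every component
of `(V, A)`. -/
lemma map_ker_toComponents (G : Graph α β) (A : Set β) :
    (LinearMap.ker (toComponents G A)).map (Finsupp.lmapDomain (ZMod 2) (ZMod 2) Subtype.val) =
      edgeSpan G A := by
  apply le_antisymm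
  · rintro _ ⟨f, hf, rfl⟩
    let rep : V(G.restrict A) → V(G.restrict A) := fun u ↦
      ((G.restrict A).toSimpleGraph.connectedComponentMk u).out
    -- Each coordinate is moved along a walk to the representative of its component, at the cost of
    -- an element of the span. For `f` in the kernel the moved vector is zero.
    have key : ∀ f : V(G.restrict A) →₀ ZMod 2,
        Finsupp.lmapDomain (ZMod 2) (ZMod 2) Subtype.val f +
        Finsupp.lmapDomain (ZMod 2) (ZMod 2) (fun c ↦ (Quot.out c).val) (toComponents G A f) ∈
          edgeSpan G A := by
      intro f
      induction f using Finsupp.induction_linear with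
      | zero => simp
      | add f g hf hg =>
        rw [map_add, map_add, map_add, add_add_add_comm]
        exact add_mem hf hg
      | single u c =>
        have h1 : (G.restrict A).toSimpleGraph.Reachable u (rep u) := by
          rw [← SimpleGraph.ConnectedComponent.eq]
          exact (Quot.out_eq _).symm
        have h2 := (edgeSpan G A).smul_mem c (joined_of_reachable h1)
        simpa [toComponents, rep] using h2
    have := key f
    rw [LinearMap.mem_ker.1 hf, map_zero, add_zero] at this
    exact this
  · rw [edgeSpan, Submodule.span_le]
    rintro _ ⟨e, he, rfl⟩
    by_cases heG : e ∈ E(G)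
    · obtain ⟨x, y, h⟩ := G.exists_isLink_of_mem_edgeSet heG
      rw [edgeVec_eq h]
      refine ⟨.single ⟨x, h.left_mem⟩ 1 + .single ⟨y, h.right_mem⟩ 1, ?_, by
        simp [Finsupp.mapDomain_add]⟩
      have : (G.restrict A).toSimpleGraph.connectedComponentMk ⟨x, h.left_mem⟩ =
          (G.restrict A).toSimpleGraph.connectedComponentMk ⟨y, h.right_mem⟩ := by
        by_cases hxy : x = y
        · simp [hxy]
        · exact SimpleGraph.ConnectedComponent.eq.2 (SimpleGraph.Adj.reachable
            ⟨fun h ↦ hxy (congr_arg Subtype.val h), e, he, h⟩)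
      simp [toComponents, Finsupp.mapDomain_add, this, zmod_two_add_self]
    · rw [edgeVec_of_notMem heG]
      exact zero_mem _

/-- If `u` and `v` lay in different components, the coordinate sum over the component of `u` would
be `1`. -/
lemma reachable_of_joined {u v : V(G.restrict A)} (h : Joined G A u v) :
    (G.restrict A).toSimpleGraph.Reachable u v := by
  rw [Joined, ← map_ker_toComponents] at h
  obtain ⟨f, hf, h⟩ := h
  have h1 : f = .single u 1 + .single v 1 := by
    apply Finsupp.mapDomain_injective Subtype.val_injective
    simpa [Finsupp.mapDomain_add] using h
  subst h1
  rw [SetLike.mem_coe, LinearMap.mem_ker] at hf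
  by_contra hne
  rw [← SimpleGraph.ConnectedComponent.eq] at hne
  have := DFunLike.congr_fun hf ((G.restrict A).toSimpleGraph.connectedComponentMk u)
  simp [toComponents, Finsupp.mapDomain_add, Ne.symm hne] at this

/-- Rank-nullity for `toComponents`, which is surjective with kernel isomorphic to the span.
Consequently the graph rank is a dimension and its matroid properties are linear algebra. -/
lemma finrank_edgeSpan_add (hV : V(G).Finite) (A : Set β) :
    Module.finrank (ZMod 2) (edgeSpan G A) +
      Nat.card (G.restrict A).toSimpleGraph.ConnectedComponent = V(G).ncard := by
  have : Finite V(G.restrict A) := hV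
  have : Fintype V(G.restrict A) := Fintype.ofFinite _
  have : Fintype (G.restrict A).toSimpleGraph.ConnectedComponent := Fintype.ofFinite _
  have h1 := LinearMap.finrank_range_add_finrank_ker (toComponents G A)
  have h2 : LinearMap.range (toComponents G A) = ⊤ := by
    rw [LinearMap.range_eq_top]
    exact Finsupp.mapDomain_surjective (Quot.mk_surjective)
  rw [h2, finrank_top, Module.finrank_finsupp_self, Module.finrank_finsupp_self] at h1
  rw [← map_ker_toComponents, ← (Submodule.equivMapOfInjective _
    (Finsupp.mapDomain_injective Subtype.val_injective) _).finrank_eq, Nat.card_eq_fintype_card,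
    add_comm, h1, ← Nat.card_eq_fintype_card]
  rfl

lemma rank_eq_finrank (hV : V(G).Finite) (A : Set β) :
    rank G A = Module.finrank (ZMod 2) (edgeSpan G A) := by
  have := finrank_edgeSpan_add hV A
  rw [rank]
  omega

lemma rank_add_card_components (hV : V(G).Finite) (A : Set β) :
    rank G A + Nat.card (G.restrict A).toSimpleGraph.ConnectedComponent = V(G).ncard := by
  rw [rank_eq_finrank hV, finrank_edgeSpan_add hV]

lemma finiteDimensional_edgeSpan (hV : V(G).Finite) (A : Set β) :
    FiniteDimensional (ZMod 2) (edgeSpan G A) := by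
  have : Finite V(G.restrict A) := hV
  rw [← map_ker_toComponents]
  infer_instance

lemma edgeSpan_insert (G : Graph α β) (e : β) (A : Set β) :
    edgeSpan G (insert e A) = edgeSpan G A ⊔ Submodule.span (ZMod 2) {edgeVec G e} := by
  rw [edgeSpan, Set.image_insert_eq, Submodule.span_insert, sup_comm, edgeSpan]

lemma rank_insert_of_mem (hV : V(G).Finite) (h : edgeVec G e ∈ edgeSpan G A) :
    rank G (insert e A) = rank G A := by
  rw [rank_eq_finrank hV, rank_eq_finrank hV, edgeSpan_insert, sup_eq_left.2]
  simpa using h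

lemma rank_insert_of_notMem (hV : V(G).Finite) (h : edgeVec G e ∉ edgeSpan G A) :
    rank G (insert e A) = rank G A + 1 := by
  have := finiteDimensional_edgeSpan hV A
  rw [rank_eq_finrank hV, rank_eq_finrank hV, edgeSpan_insert, finrank_sup_span_of_notMem h]

lemma rank_insert_of_joined (hV : V(G).Finite) (he : G.IsLink e u v) (h : Joined G A u v) :
    rank G (insert e A) = rank G A :=
  rank_insert_of_mem hV ((joined_iff_edgeVec he).2 h)

lemma rank_empty (hV : V(G).Finite) : rank G ∅ = 0 := by
  rw [rank_eq_finrank hV, edgeSpan, Set.image_empty, Submodule.span_empty, finrank_bot]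

/-- The rank grows by one exactly when the new column lies outside the span; submodularity holds
because spans grow with the set. -/
lemma isRankFunction_rank [DecidableEq β] (hV : V(G).Finite) :
    IsRankFunction fun A : Finset β ↦ rank G (A : Set β) := by
  refine ⟨by simpa using rank_empty hV, fun e A ↦ ?_, fun e A ↦ ?_, fun e A B h ↦ ?_⟩
  · rw [Finset.coe_insert]
    by_cases h : edgeVec G e ∈ edgeSpan G A
    · rw [rank_insert_of_mem hV h]
    · rw [rank_insert_of_notMem hV h]
      omega
  · rw [Finset.coe_insert]
    by_cases h : edgeVec G e ∈ edgeSpan G A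
    · rw [rank_insert_of_mem hV h]
      omega
    · rw [rank_insert_of_notMem hV h]
  · rw [Finset.coe_insert, Finset.coe_insert]
    by_cases hA : edgeVec G e ∈ edgeSpan G A
    · rw [rank_insert_of_mem hV hA,
        rank_insert_of_mem hV (edgeSpan_mono G (Finset.coe_subset.2 h) hA), add_comm]
    · rw [rank_insert_of_notMem hV hA]
      by_cases hB : edgeVec G e ∈ edgeSpan G B
      · rw [rank_insert_of_mem hV hB]
        omega
      · rw [rank_insert_of_notMem hV hB]
        omega

lemma rank_le_add_ncard_sdiff (hV : V(G).Finite) (hB : B.Finite) (hA : A.Finite) :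
    rank G B ≤ rank G A + (B \ A).ncard := by
  classical
  have := (isRankFunction_rank hV).le_add_card_sdiff hA.toFinset hB.toFinset
  rwa [hA.coe_toFinset, hB.coe_toFinset, ← Set.ncard_coe_finset, Finset.coe_sdiff, hA.coe_toFinset,
    hB.coe_toFinset] at this

/-! ### Sparse and dense graphs -/

/-- Every set of edges has at most twice as many elements as its rank. -/
def IsSparse (G : Graph α β) : Prop := ∀ A ⊆ E(G), A.ncard ≤ 2 * rank G A

/-- Every set of edges whose deletion decreases the rank by `k` has at least `2 * k` elements. -/
def IsDense (G : Graph α β) : Prop :=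
  ∀ A ⊆ E(G), 2 * rank G E(G) ≤ 2 * rank G A + (E(G) \ A).ncard

lemma tutte_eq_tutteSum [DecidableEq β] (G : Graph α β) (hE : E(G).Finite) (x y : ℝ) :
    tutte G x y = tutteSum (fun A : Finset β ↦ rank G (A : Set β)) hE.toFinset x y := by
  have h : {A : Set β | A ⊆ E(G)} = (fun B : Finset β ↦ (B : Set β)) '' ↑hE.toFinset.powerset := by
    ext A
    constructor
    · intro hA
      exact ⟨(hE.subset hA).toFinset, by simpa using hA, by simp⟩
    · rintro ⟨B, hB, rfl⟩
      simpa using hB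
  have h' := finsum_mem_image (f := fun A : Set β ↦
    (x - 1) ^ (rank G E(G) - rank G A) * (y - 1) ^ (A.ncard - rank G A))
    (Finset.coe_injective.injOn (s := (hE.toFinset.powerset : Set (Finset β))))
  rw [← h, finsum_mem_coe_finset] at h'
  rw [tutte, tutteSum]
  simpa using h'

lemma IsSparse.tutte_le (h : IsSparse G) (hV : V(G).Finite) (hE : E(G).Finite) {a : ℝ}
    (ha : 2 ≤ a) : tutte G a a ≤ tutte G (2 * a) 0 := by
  classical
  rw [tutte_eq_tutteSum G hE, tutte_eq_tutteSum G hE]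
  refine tutteSum_diag_le_of_card_le (isRankFunction_rank hV) _ (fun A hA ↦ ?_) ha
  simpa using h A (by simpa [← Finset.coe_subset] using hA)

lemma IsDense.tutte_le (h : IsDense G) (hV : V(G).Finite) (hE : E(G).Finite) {a : ℝ}
    (ha : 2 ≤ a) : tutte G a a ≤ tutte G 0 (2 * a) := by
  classical
  rw [tutte_eq_tutteSum G hE, tutte_eq_tutteSum G hE]
  refine tutteSum_diag_le_of_le_card (isRankFunction_rank hV) _ (fun A hA ↦ ?_) ha
  have := h A (by simpa [← Finset.coe_subset] using hA)
  simpa [← Set.ncard_coe_finset] using this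

lemma card_components_of_joined (h : ∀ u ∈ V(G), ∀ v ∈ V(G), Joined G A u v) (hne : V(G).Nonempty) :
    Nat.card (G.restrict A).toSimpleGraph.ConnectedComponent = 1 := by
  obtain ⟨u, hu⟩ := hne
  rw [Nat.card_eq_one_iff_unique]
  refine ⟨⟨fun c d ↦ ?_⟩, ⟨(G.restrict A).toSimpleGraph.connectedComponentMk ⟨u, hu⟩⟩⟩
  induction c using SimpleGraph.ConnectedComponent.ind with | _ x
  induction d using SimpleGraph.ConnectedComponent.ind with | _ y
  exact SimpleGraph.ConnectedComponent.eq.2 (reachable_of_joined (h x x.2 y y.2))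

/-- A graph with two disjoint connected spanning subgraphs is dense. -/
lemma isDense_of_two_connected (hV : V(G).Finite) (hE : E(G).Finite) (B₁ B₂ : Set β)
    (h₁ : B₁ ⊆ E(G)) (h₂ : B₂ ⊆ E(G)) (hd : Disjoint B₁ B₂)
    (hc₁ : ∀ u ∈ V(G), ∀ v ∈ V(G), Joined G B₁ u v)
    (hc₂ : ∀ u ∈ V(G), ∀ v ∈ V(G), Joined G B₂ u v) : IsDense G := by
  intro A hA
  -- Without vertices all ranks are zero. Otherwise each `Bᵢ` has full rank, so it has at least
  -- `rank G E(G) - rank G A` edges outside `A`, and the `Bᵢ` are disjoint.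
  rcases V(G).eq_empty_or_nonempty with h0 | hne
  · have := rank_add_card_components hV E(G)
    simp only [h0, Set.ncard_empty] at this
    omega
  have h3 : ∀ B ⊆ E(G), (∀ u ∈ V(G), ∀ v ∈ V(G), Joined G B u v) →
      rank G E(G) ≤ rank G A + (B \ A).ncard := by
    intro B hB hc
    have e1 := rank_add_card_components hV B
    have e2 := rank_add_card_components hV E(G)
    rw [card_components_of_joined hc hne] at e1
    rw [card_components_of_joined (fun u hu v hv ↦ (hc u hu v hv).mono hB) hne] at e2
    have := rank_le_add_ncard_sdiff hV (hE.subset hB) (hE.subset hA)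
    omega
  have h4 := h3 B₁ h₁ hc₁
  have h5 := h3 B₂ h₂ hc₂
  have h6 : (B₁ \ A).ncard + (B₂ \ A).ncard ≤ (E(G) \ A).ncard := by
    rw [← Set.ncard_union_eq (hd.mono Set.sdiff_subset Set.sdiff_subset)
      (hE.subset (Set.sdiff_subset.trans h₁)) (hE.subset (Set.sdiff_subset.trans h₂))]
    refine Set.ncard_le_ncard (fun e he ↦ ?_) (hE.subset Set.sdiff_subset)
    rcases he with ⟨he, h⟩ | ⟨he, h⟩
    · exact ⟨h₁ he, h⟩
    · exact ⟨h₂ he, h⟩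
  omega

end Binary

/-! ### Sparsity by counting edges inside vertex sets -/

section Counting

variable {α β : Type*} {G : Graph α β} {A : Set β}

/-- The vertex set of a component of the spanning subgraph with edge set `A`. -/
def componentSet (G : Graph α β) (A : Set β)
    (c : (G.restrict A).toSimpleGraph.ConnectedComponent) : Set α :=
  Subtype.val '' {v | (G.restrict A).toSimpleGraph.connectedComponentMk v = c}

lemma componentSet_subset (c : (G.restrict A).toSimpleGraph.ConnectedComponent) :
    componentSet G A c ⊆ V(G) := by
  rintro _ ⟨v, _, rfl⟩
  exact v.2

lemma componentSet_nonempty (c : (G.restrict A).toSimpleGraph.ConnectedComponent) :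
    (componentSet G A c).Nonempty := by
  induction c using SimpleGraph.ConnectedComponent.ind with | _ x
  exact ⟨x, x, rfl, rfl⟩

lemma mem_componentSet_iff {c : (G.restrict A).toSimpleGraph.ConnectedComponent} {v : α}
    (hv : v ∈ V(G)) : v ∈ componentSet G A c ↔
      (G.restrict A).toSimpleGraph.connectedComponentMk ⟨v, hv⟩ = c := by
  constructor
  · rintro ⟨w, hw, rfl⟩
    exact hw
  · intro h
    exact ⟨⟨v, hv⟩, h, rfl⟩

lemma connectedComponentMk_eq_of_isLink {e : β} {x y : α} (h : G.IsLink e x y) (he : e ∈ A) :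
    (G.restrict A).toSimpleGraph.connectedComponentMk ⟨x, h.left_mem⟩ =
      (G.restrict A).toSimpleGraph.connectedComponentMk ⟨y, h.right_mem⟩ :=
  SimpleGraph.ConnectedComponent.eq.2
    (reachable_of_joined (u := ⟨x, h.left_mem⟩) (v := ⟨y, h.right_mem⟩) (.of_isLink h he))

lemma sum_ncard_componentSet (hV : V(G).Finite) (A : Set β)
    [Fintype (G.restrict A).toSimpleGraph.ConnectedComponent] :
    ∑ c, (componentSet G A c).ncard = V(G).ncard := by
  rw [← finsum_eq_sum_of_fintype,
    ← Set.ncard_iUnion_of_finite (fun c ↦ hV.subset (componentSet_subset c))]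
  · congr 1
    ext v
    simp only [Set.mem_iUnion]
    constructor
    · rintro ⟨c, hc⟩
      exact componentSet_subset c hc
    · intro hv
      exact ⟨_, (mem_componentSet_iff hv).2 rfl⟩
  · intro c d hcd
    rw [Function.onFun, Set.disjoint_left]
    intro v h1 h2
    have hv := componentSet_subset c h1
    exact hcd (((mem_componentSet_iff hv).1 h1).symm.trans ((mem_componentSet_iff hv).1 h2))

/-- If any `k ≥ 1` vertices span at most `2 k - 2` edges, the graph is sparse. -/
lemma isSparse_of_induce (hV : V(G).Finite) (hE : E(G).Finite)
    (h : ∀ X ⊆ V(G), X.Nonempty → E(G.induce X).ncard + 2 ≤ 2 * X.ncard) : IsSparse G := by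
  intro A hA
  have : Finite V(G.restrict A) := hV
  have : Fintype V(G.restrict A) := Fintype.ofFinite _
  have : Fintype (G.restrict A).toSimpleGraph.ConnectedComponent := Fintype.ofFinite _
  have h1 := sum_ncard_componentSet hV A
  have h2 := rank_add_card_components hV A
  -- Both ends of an edge of `A` lie in the same component of `(V, A)`.
  have h3 : A.ncard ≤ ∑ c, E(G.induce (componentSet G A c)).ncard := by
    have h4 : A ⊆ ⋃ c ∈ (Finset.univ : Finset (G.restrict A).toSimpleGraph.ConnectedComponent),
        E(G.induce (componentSet G A c)) := by
      intro e he
      obtain ⟨x, y, hxy⟩ := G.exists_isLink_of_mem_edgeSet (hA he)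
      simp only [Set.mem_iUnion]
      exact ⟨_, Finset.mem_univ _, x, y, hxy, (mem_componentSet_iff hxy.left_mem).2 rfl,
        (mem_componentSet_iff hxy.right_mem).2 (connectedComponentMk_eq_of_isLink hxy he).symm⟩
    refine (Set.ncard_le_ncard h4 (hE.subset ?_)).trans (Finset.set_ncard_biUnion_le _ _)
    simp only [Set.iUnion_subset_iff]
    rintro c - e ⟨x, y, hxy, -⟩
    exact hxy.edge_mem
  -- With `c` components the sum reads `|A| + 2c ≤ 2|V|`, and the rank of `A` is `|V| - c`.
  have h4 : ∑ c, (E(G.induce (componentSet G A c)).ncard + 2) ≤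
      ∑ c, 2 * (componentSet G A c).ncard :=
    Finset.sum_le_sum fun c _ ↦ h _ (componentSet_subset c) (componentSet_nonempty c)
  rw [Finset.sum_add_distrib, ← Finset.mul_sum, h1, Finset.sum_const, Finset.card_univ,
    ← Nat.card_eq_fintype_card, smul_eq_mul] at h4
  omega

/-- Every edge is charged to one of two slots at a vertex of `X` other than `x₀`. -/
lemma ncard_edgeSet_le_of_injOn {X : Set α} (hX : X.Finite) {x₀ : α} (hx₀ : x₀ ∈ X) {S : Set β}
    (t : β → α × Bool) (ht : ∀ e ∈ S, (t e).1 ∈ X ∧ (t e).1 ≠ x₀) (hi : Set.InjOn t S) :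
    S.ncard + 2 ≤ 2 * X.ncard := by
  have h1 := Set.ncard_le_ncard_of_injOn (t := (X \ {x₀}) ×ˢ (Set.univ : Set Bool)) t
    (fun e he ↦ ⟨ht e he, trivial⟩) hi ((hX.subset Set.sdiff_subset).prod Set.finite_univ)
  rw [Set.ncard_prod, Set.ncard_univ, Set.ncard_sdiff_singleton_of_mem hx₀, Nat.card_eq_fintype_card,
    Fintype.card_bool] at h1
  have := (Set.ncard_pos hX).2 ⟨x₀, hx₀⟩
  omega

/-- A graph is sparse if its vertices can be ordered so that each of them is the smaller end of at
most two edges. -/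
lemma isSparse_of_tail (hV : V(G).Finite) (hE : E(G).Finite) (R : β → α → Bool → Prop) (ρ : α → ℕ)
    (h₁ : ∀ e x y, G.IsLink e x y → ∃ b, (ρ x < ρ y ∧ R e x b) ∨ (ρ y < ρ x ∧ R e y b))
    (h₂ : ∀ e f x b, R e x b → R f x b → e = f) : IsSparse G := by
  refine isSparse_of_induce hV hE fun X hX hne ↦ ?_
  -- A vertex of `X` with maximal `ρ` is the smaller end of no edge inside `X`, so its two slots
  -- stay empty. `R e x b` says that `e` may take slot `b` at `x`.
  obtain ⟨x₀, hx₀, hmax⟩ := Set.exists_max_image X ρ (hV.subset hX) hne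
  have h3 : ∀ e ∈ E(G.induce X), ∃ p : α × Bool, p.1 ∈ X ∧ p.1 ≠ x₀ ∧ R e p.1 p.2 := by
    rintro e ⟨x, y, hxy, hx, hy⟩
    obtain ⟨b, ⟨hlt, hR⟩ | ⟨hlt, hR⟩⟩ := h₁ e x y hxy
    · exact ⟨(x, b), hx, fun h ↦ absurd (hmax y hy) (by simp only at h; rw [← h]; omega), hR⟩
    · exact ⟨(y, b), hy, fun h ↦ absurd (hmax x hx) (by simp only at h; rw [← h]; omega), hR⟩
  have : Nonempty α := ⟨x₀⟩
  choose! t ht using h3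
  refine ncard_edgeSet_le_of_injOn (hV.subset hX) hx₀ t (fun e he ↦ ⟨(ht e he).1, (ht e he).2.1⟩) ?_
  intro e he f hf hef
  have := (ht f hf).2.2
  rw [← hef] at this
  exact h₂ e f _ _ (ht e he).2.2 this

lemma two_mul_ncard_eq_sum [G.Loopless] {X : Finset α} {S : Finset β}
    (hS : ∀ e ∈ S, ∃ x y, G.IsLink e x y ∧ x ∈ X ∧ y ∈ X) :
    2 * S.card = ∑ v ∈ X, {e | e ∈ S ∧ G.Inc e v}.ncard := by
  classical
  have h := Finset.sum_card_bipartiteAbove_eq_sum_card_bipartiteBelow (s := S) (t := X)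
    (r := fun e v ↦ G.Inc e v)
  have h1 : ∀ e ∈ S, (Finset.bipartiteAbove (fun e v ↦ G.Inc e v) X e).card = 2 := by
    intro e he
    obtain ⟨x, y, hxy, hx, hy⟩ := hS e he
    have : Finset.bipartiteAbove (fun e v ↦ G.Inc e v) X e = {x, y} := by
      ext v
      simp only [Finset.bipartiteAbove, Finset.mem_filter, Finset.mem_insert, Finset.mem_singleton]
      constructor
      · rintro ⟨_, hv⟩
        exact hv.eq_or_eq_of_isLink hxy
      · rintro (rfl | rfl)
        · exact ⟨hx, hxy.inc_left⟩
        · exact ⟨hy, hxy.inc_right⟩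
    rw [this, Finset.card_pair hxy.ne]
  rw [Finset.sum_congr rfl h1, Finset.sum_const, smul_eq_mul, mul_comm] at h
  rw [h]
  refine Finset.sum_congr rfl fun v _ ↦ ?_
  rw [← Set.ncard_coe_finset]
  congr 1
  ext e
  simp [Finset.bipartiteBelow]

/-- Simple graphs with maximum degree at most `3` are sparse. -/
lemma isSparse_of_degree_le (hV : V(G).Finite) (hE : E(G).Finite) (hG : G.Simple)
    (h : ∀ v ∈ V(G), (G.incidenceSet v).ncard ≤ 3) : IsSparse G := by
  refine isSparse_of_induce hV hE fun X hX hne ↦ ?_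
  have hXf := hV.subset hX
  have hSf : E(G.induce X).Finite := hE.subset (by rintro e ⟨x, y, hxy, -⟩; exact hxy.edge_mem)
  have h1 := two_mul_ncard_eq_sum (G := G) (X := hXf.toFinset) (S := hSf.toFinset) (by
    intro e he
    rw [Set.Finite.mem_toFinset] at he
    obtain ⟨x, y, h⟩ := he
    exact ⟨x, y, by simpa using h⟩)
  rw [← Set.ncard_eq_toFinset_card _ hSf] at h1
  have hpos := (Set.ncard_pos hXf).2 hne
  -- For `k = |X|` the handshake count needs `k * min 3 (k - 1) ≤ 4 * k - 4`: the bound `k - 1`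
  -- settles `k < 4`, the bound `3` settles `k ≥ 4`.
  have h2 : ∀ v ∈ hXf.toFinset, {e | e ∈ hSf.toFinset ∧ G.Inc e v}.ncard ≤ min 3 (X.ncard - 1) := by
    intro v hv
    rw [Set.Finite.mem_toFinset] at hv
    apply le_min
    · exact (Set.ncard_le_ncard (fun e he ↦ he.2) (hE.subset (G.incidenceSet_subset_edgeSet v))).trans
        (h v (hX hv))
    · rw [← Set.ncard_sdiff_singleton_of_mem hv]
      have h3 : ∀ e ∈ {e | e ∈ hSf.toFinset ∧ G.Inc e v}, ∃ u ∈ X \ {v}, G.IsLink e v u := by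
        rintro e ⟨he, hev⟩
        rw [Set.Finite.mem_toFinset] at he
        obtain ⟨x, y, hxy, hx, hy⟩ := he
        rcases hev.eq_or_eq_of_isLink hxy with rfl | rfl
        · exact ⟨y, ⟨hy, hxy.ne.symm⟩, hxy⟩
        · exact ⟨x, ⟨hx, hxy.ne⟩, hxy.symm⟩
      have : Nonempty α := ⟨v⟩
      choose! t ht using h3
      refine Set.ncard_le_ncard_of_injOn t (fun e he ↦ (ht e he).1) ?_ (hXf.subset Set.sdiff_subset)
      intro e he f hf hef
      have := (ht f hf).2
      rw [← hef] at this
      exact (ht e he).2.eq this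
  have h3 := Finset.sum_le_card_nsmul _ _ _ h2
  rw [← h1, ← Set.ncard_eq_toFinset_card _ hXf, smul_eq_mul] at h3
  generalize X.ncard = k at *
  rcases Nat.lt_or_ge k 4 with hk | hk
  · interval_cases k <;> omega
  · have := Nat.mul_le_mul_left k (min_le_left 3 (k - 1))
    omega

lemma IsCubic.isSparse (h : IsCubic G) (hV : V(G).Finite) (hE : E(G).Finite) : IsSparse G :=
  isSparse_of_degree_le hV hE h.1 fun v hv ↦ (h.2 v hv).le

lemma ncard_edgeSet_induce_of_ncard_le_one [G.Loopless] {X : Set α} (hX : X.Finite)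
    (h : X.ncard ≤ 1) : E(G.induce X) = ∅ := by
  rw [Set.eq_empty_iff_forall_notMem]
  rintro e ⟨x, y, hxy, hx, hy⟩
  exact hxy.ne ((Set.ncard_le_one hX).1 h x hx y hy)

lemma IsLaman.isSparse (h : IsLaman G) (hV : V(G).Finite) (hE : E(G).Finite) : IsSparse G := by
  refine isSparse_of_induce hV hE fun X hX hne ↦ ?_
  have : G.Simple := h.1
  have hpos := (Set.ncard_pos (hV.subset hX)).2 hne
  rcases Nat.lt_or_ge X.ncard 2 with h1 | h1
  · rw [ncard_edgeSet_induce_of_ncard_le_one (hV.subset hX) (by omega), Set.ncard_empty]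
    omega
  · have := h.2.2.2 X hX h1
    omega

/-- Here even `|A| ≤ rank G A` holds: the rank of `E(G)` is `|V| - 1 = |E|`, and removing edges
lowers the rank by at most their number. -/
lemma IsTree.isSparse {n : ℕ} (h : IsTree G n) (hV : V(G).Finite) (hE : E(G).Finite) :
    IsSparse G := by
  obtain ⟨hs, ht, -⟩ := h
  have : Finite V(G) := hV
  have : Fintype V(G) := Fintype.ofFinite _
  have : Fintype G.toSimpleGraph.edgeSet := Fintype.ofFinite _
  have h1 := ht.card_edgeFinset
  have h2 : E(G).ncard ≤ G.toSimpleGraph.edgeFinset.card := by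
    have h3 : ∀ e ∈ E(G), ∃ s ∈ G.toSimpleGraph.edgeSet,
        ∃ x y : V(G), s = s(x, y) ∧ G.IsLink e x y := by
      intro e he
      obtain ⟨x, y, hxy⟩ := G.exists_isLink_of_mem_edgeSet he
      exact ⟨s(⟨x, hxy.left_mem⟩, ⟨y, hxy.right_mem⟩),
        ⟨fun h ↦ hxy.ne (congr_arg Subtype.val h), e, hxy⟩, _, _, rfl, hxy⟩
    have : Nonempty (Sym2 V(G)) := by
      obtain ⟨v⟩ := ht.connected.nonempty
      exact ⟨s(v, v)⟩
    choose! t ht using h3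
    rw [← Set.ncard_coe_finset, SimpleGraph.coe_edgeFinset]
    refine Set.ncard_le_ncard_of_injOn t (fun e he ↦ (ht e he).1) ?_ (Set.toFinite _)
    intro e he f hf hef
    obtain ⟨-, x, y, h3, hxy⟩ := ht e he
    obtain ⟨-, z, w, h4, hzw⟩ := ht f hf
    rw [hef, h4, Sym2.eq_iff] at h3
    rcases h3 with ⟨rfl, rfl⟩ | ⟨rfl, rfl⟩
    · exact hxy.eq hzw
    · exact hxy.eq hzw.symm
  have h3 := rank_add_card_components hV E(G)
  have h4 : Nat.card (G.restrict E(G)).toSimpleGraph.ConnectedComponent = 1 := by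
    rw [G.restrict_self, Nat.card_eq_one_iff_unique]
    exact ⟨ht.connected.preconnected.subsingleton_connectedComponent, by
      obtain ⟨v⟩ := ht.connected.nonempty
      exact ⟨G.toSimpleGraph.connectedComponentMk v⟩⟩
  have h5 : V(G).ncard = Fintype.card V(G) := by
    rw [← Nat.card_eq_fintype_card]; rfl
  intro A hA
  have h6 := rank_le_add_ncard_sdiff hV hE (hE.subset hA)
  have h7 := Set.ncard_sdiff_add_ncard_of_subset hA hE
  omega

/-- Charging each edge to its first vertex gives at most `|X|` edges inside `X`, enough once `|X| ≥
2`. For single vertices there must be no loops, and `n ≥ 2` ensures `i ≠ i + 1`. -/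
lemma IsCycle.isSparse {n : ℕ} (hn : 2 ≤ n) (h : IsCycle G n) (hV : V(G).Finite)
    (hE : E(G).Finite) : IsSparse G := by
  obtain ⟨v, e, h⟩ := h
  have : Fact (1 < n) := ⟨hn⟩
  have hll : G.Loopless := ⟨fun f x hf ↦ by
    obtain ⟨i, hi⟩ := e.surjective ⟨f, hf.edge_mem⟩
    have hi := congr_arg Subtype.val hi
    simp only at hi
    have := h i
    rw [hi] at this
    have h1 := hf.eq_of_inc this.inc_left
    have h2 := hf.eq_of_inc this.inc_right
    have := v.injective (Subtype.ext (h1.symm.trans h2))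
    simp at this⟩
  refine isSparse_of_induce hV hE fun X hX hne ↦ ?_
  have hXf := hV.subset hX
  have hpos := (Set.ncard_pos hXf).2 hne
  rcases Nat.lt_or_ge X.ncard 2 with h1 | h1
  · rw [ncard_edgeSet_induce_of_ncard_le_one hXf (by omega), Set.ncard_empty]
    omega
  have h2 : ∀ f ∈ E(G.induce X), ∃ x ∈ X, ∃ i, (v i : α) = x ∧ (e i : β) = f := by
    rintro f ⟨x, y, hxy, hx, hy⟩
    obtain ⟨i, hi⟩ := e.surjective ⟨f, hxy.edge_mem⟩
    have hi := congr_arg Subtype.val hi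
    simp only at hi
    have := h i
    rw [hi] at this
    rcases this.left_eq_or_eq hxy with h3 | h3
    · exact ⟨x, hx, i, h3, hi⟩
    · exact ⟨y, hy, i, h3, hi⟩
  have : Nonempty α := ⟨hne.some⟩
  choose! t ht ht' using h2
  have h3 := Set.ncard_le_ncard_of_injOn t ht (fun f hf g hg hfg ↦ by
    obtain ⟨i, h3, h4⟩ := ht' f hf
    obtain ⟨j, h5, h6⟩ := ht' g hg
    rw [hfg, ← h5] at h3
    rw [← h4, ← h6, v.injective (Subtype.ext h3)]) hXf
  omega

/-- Rim edges take slot `true` at their first vertex and spokes take slot `false` at their rim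
vertex, so the hub has no charge. -/
lemma IsWheel.isSparse {n : ℕ} (hn : 2 ≤ n) (h : IsWheel G n) (hV : V(G).Finite)
    (hE : E(G).Finite) : IsSparse G := by
  obtain ⟨v, e, h⟩ := h
  have : Fact (1 < n) := ⟨hn⟩
  have hcases : ∀ f x y, G.IsLink f x y → ∃ i,
      (f = e (.inl i) ∧ ((x = v (some i) ∧ y = v (some (i + 1))) ∨
        (y = v (some i) ∧ x = v (some (i + 1))))) ∨
      (f = e (.inr i) ∧ ((x = v (some i) ∧ y = v none) ∨ (y = v (some i) ∧ x = v none))) := by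
    intro f x y hf
    obtain ⟨i | i, hi⟩ := e.surjective ⟨f, hf.edge_mem⟩
    · have hi := congr_arg Subtype.val hi
      simp only at hi
      have := (h i).1
      rw [hi] at this
      refine ⟨i, Or.inl ⟨hi.symm, ?_⟩⟩
      rcases this.eq_and_eq_or_eq_and_eq hf with h1 | h1
      · exact Or.inl ⟨h1.1.symm, h1.2.symm⟩
      · exact Or.inr ⟨h1.1.symm, h1.2.symm⟩
    · have hi := congr_arg Subtype.val hi
      simp only at hi
      have := (h i).2
      rw [hi] at this
      refine ⟨i, Or.inr ⟨hi.symm, ?_⟩⟩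
      rcases this.eq_and_eq_or_eq_and_eq hf with h1 | h1
      · exact Or.inr ⟨h1.2.symm, h1.1.symm⟩
      · exact Or.inl ⟨h1.2.symm, h1.1.symm⟩
  have hll : G.Loopless := ⟨fun f x hf ↦ by
    obtain ⟨i, ⟨-, ⟨h1, h2⟩ | ⟨h1, h2⟩⟩ | ⟨-, ⟨h1, h2⟩ | ⟨h1, h2⟩⟩⟩ := hcases f x x hf <;>
    · have := v.injective (Subtype.ext (h1.symm.trans h2))
      simp at this⟩
  have htail : ∀ X : Set α, ∀ f ∈ E(G.induce X), ∃ p : α × Bool, p.1 ∈ X ∧ p.1 ≠ v none ∧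
      ∃ i, p.1 = v (some i) ∧
        ((p.2 = true ∧ f = e (.inl i)) ∨ (p.2 = false ∧ f = e (.inr i) ∧ (v none : α) ∈ X)) := by
    rintro X f ⟨x, y, hxy, hx, hy⟩
    have hne : ∀ i, (v (some i) : α) ≠ v none := fun i hi ↦ by
      have := v.injective (Subtype.ext hi)
      simp at this
    obtain ⟨i, ⟨h0, ⟨h1, h2⟩ | ⟨h1, h2⟩⟩ | ⟨h0, ⟨h1, h2⟩ | ⟨h1, h2⟩⟩⟩ := hcases f x y hxy
    · exact ⟨(x, true), hx, h1 ▸ hne i, i, h1, Or.inl ⟨rfl, h0⟩⟩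
    · exact ⟨(y, true), hy, h1 ▸ hne i, i, h1, Or.inl ⟨rfl, h0⟩⟩
    · exact ⟨(x, false), hx, h1 ▸ hne i, i, h1, Or.inr ⟨rfl, h0, h2 ▸ hy⟩⟩
    · exact ⟨(y, false), hy, h1 ▸ hne i, i, h1, Or.inr ⟨rfl, h0, h2 ▸ hx⟩⟩
  refine isSparse_of_induce hV hE fun X hX hne ↦ ?_
  have hXf := hV.subset hX
  have hpos := (Set.ncard_pos hXf).2 hne
  rcases Nat.lt_or_ge X.ncard 2 with h1 | h1
  · rw [ncard_edgeSet_induce_of_ncard_le_one hXf (by omega), Set.ncard_empty]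
    omega
  have : Nonempty α := ⟨hne.some⟩
  choose! t ht using htail X
  have hinj : Set.InjOn t E(G.induce X) := fun f hf g hg hfg ↦ by
    obtain ⟨-, -, i, h2, h3⟩ := ht f hf
    obtain ⟨-, -, j, h4, h5⟩ := ht g hg
    rw [hfg] at h2 h3
    have hij : i = j := by simpa using v.injective (Subtype.ext (h2.symm.trans h4))
    subst hij
    rcases h3 with ⟨h3, h6⟩ | ⟨h3, h6, -⟩ <;> rcases h5 with ⟨h5, h7⟩ | ⟨h5, h7, -⟩
    · rw [h6, h7]
    · simp [h3] at h5
    · simp [h3] at h5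
    · rw [h6, h7]
  -- If the hub is in `X`, its empty slots give the bound. Otherwise `X` spans no spokes, hence at
  -- most `|X|` edges.
  by_cases hhub : (v none : α) ∈ X
  · exact ncard_edgeSet_le_of_injOn hXf hhub t (fun f hf ↦ ⟨(ht f hf).1, (ht f hf).2.1⟩) hinj
  · have h2 := Set.ncard_le_ncard_of_injOn (fun f ↦ (t f).1) (fun f hf ↦ (ht f hf).1)
      (fun f hf g hg hfg ↦ by
        refine hinj hf hg (Prod.ext hfg ?_)
        obtain ⟨-, -, i, -, ⟨h2, -⟩ | ⟨-, -, h2⟩⟩ := ht f hf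
        · obtain ⟨-, -, j, -, ⟨h3, -⟩ | ⟨-, -, h3⟩⟩ := ht g hg
          · rw [h2, h3]
          · exact absurd h3 hhub
        · exact absurd h2 hhub) hXf
    omega

end Counting

/-! ### Lattices, complete bipartite, threshold and 4-edge-connected graphs -/

section Classes

variable {α β : Type*} {G : Graph α β} {A : Set β}

/-- In the order by coordinate sum each vertex is the smaller end of at most two edges, one for each
coordinate that can increase. -/
lemma IsSquareLattice.isSparse {n : ℕ} (h : IsSquareLattice G n) (hV : V(G).Finite)
    (hE : E(G).Finite) : IsSparse G := by
  classical
  obtain ⟨hs, ⟨φ⟩⟩ := h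
  let ρ : α → ℕ := fun x ↦ if h : x ∈ V(G) then ((φ ⟨x, h⟩).1 : ℕ) + (φ ⟨x, h⟩).2 else 0
  refine isSparse_of_tail hV hE (fun e x b ↦ ∃ (hx : x ∈ V(G)) (y : V(G)), G.IsLink e x y ∧
    if b then (φ ⟨x, hx⟩).1.val + 1 = (φ y).1 ∧ (φ ⟨x, hx⟩).2 = (φ y).2
    else (φ ⟨x, hx⟩).2.val + 1 = (φ y).2 ∧ (φ ⟨x, hx⟩).1 = (φ y).1) ρ ?_ ?_
  · intro e x y hxy
    have hadj : G.toSimpleGraph.Adj ⟨x, hxy.left_mem⟩ ⟨y, hxy.right_mem⟩ :=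
      ⟨fun h ↦ hxy.ne (congr_arg Subtype.val h), e, hxy⟩
    rw [← φ.map_adj_iff, SimpleGraph.boxProd_adj, SimpleGraph.pathGraph_adj,
      SimpleGraph.pathGraph_adj] at hadj
    have hx : ρ x = ((φ ⟨x, hxy.left_mem⟩).1 : ℕ) + (φ ⟨x, hxy.left_mem⟩).2 :=
      dif_pos hxy.left_mem
    have hy : ρ y = ((φ ⟨y, hxy.right_mem⟩).1 : ℕ) + (φ ⟨y, hxy.right_mem⟩).2 :=
      dif_pos hxy.right_mem
    rw [hx, hy]
    rcases hadj with ⟨h1 | h1, h2⟩ | ⟨h1 | h1, h2⟩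
    · exact ⟨true, Or.inl ⟨by rw [h2]; omega, hxy.left_mem, ⟨y, hxy.right_mem⟩, hxy,
        by simpa using ⟨h1, h2⟩⟩⟩
    · exact ⟨true, Or.inr ⟨by rw [h2]; omega, hxy.right_mem, ⟨x, hxy.left_mem⟩, hxy.symm,
        by simpa using ⟨h1, h2.symm⟩⟩⟩
    · exact ⟨false, Or.inl ⟨by rw [h2]; omega, hxy.left_mem, ⟨y, hxy.right_mem⟩, hxy,
        by simpa using ⟨h1, h2⟩⟩⟩
    · exact ⟨false, Or.inr ⟨by rw [h2]; omega, hxy.right_mem, ⟨x, hxy.left_mem⟩, hxy.symm,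
        by simpa using ⟨h1, h2.symm⟩⟩⟩
  · rintro e f x b ⟨hx, y, hxy, h1⟩ ⟨_, z, hxz, h2⟩
    have : φ y = φ z := by
      cases b
      · simp only [Bool.false_eq_true, if_false] at h1 h2
        exact Prod.ext (h1.2.symm.trans h2.2) (Fin.ext (h1.1.symm.trans h2.1))
      · simp only [if_true] at h1 h2
        exact Prod.ext (Fin.ext (h1.1.symm.trans h2.1)) (h1.2.symm.trans h2.2)
    rw [φ.injective this] at hxy
    exact hxy.eq hxz

/-- Vertices on the right come first in the order. The slot of an edge records its left end, and `m
≤ 2` leaves room for it in a `Bool`. -/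
lemma isSparse_of_iso_completeBipartite {m n : ℕ} (hm : m ≤ 2) (hs : G.Simple)
    (φ : G.toSimpleGraph ≃g completeBipartiteGraph (Fin m) (Fin n)) (hV : V(G).Finite)
    (hE : E(G).Finite) : IsSparse G := by
  classical
  let ρ : α → ℕ := fun x ↦ if h : x ∈ V(G) then (if (φ ⟨x, h⟩).isLeft then 1 else 0) else 0
  refine isSparse_of_tail hV hE (fun e x b ↦ ∃ (y : V(G)) (i : Fin m), G.IsLink e x y ∧
    φ y = Sum.inl i ∧ (i.val = 0 ↔ b = true)) ρ ?_ ?_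
  · intro e x y hxy
    have hadj : G.toSimpleGraph.Adj ⟨x, hxy.left_mem⟩ ⟨y, hxy.right_mem⟩ :=
      ⟨fun h ↦ hxy.ne (congr_arg Subtype.val h), e, hxy⟩
    rw [← φ.map_adj_iff, completeBipartiteGraph_adj] at hadj
    have hx : ρ x = if (φ ⟨x, hxy.left_mem⟩).isLeft then 1 else 0 := dif_pos hxy.left_mem
    have hy : ρ y = if (φ ⟨y, hxy.right_mem⟩).isLeft then 1 else 0 := dif_pos hxy.right_mem
    rw [hx, hy]
    rcases hadj with ⟨h1, h2⟩ | ⟨h1, h2⟩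
    · obtain ⟨i, hi⟩ := Sum.isLeft_iff.1 h1
      refine ⟨decide (i.val = 0), Or.inr ⟨?_, ⟨x, hxy.left_mem⟩, i, hxy.symm, hi, by simp⟩⟩
      obtain ⟨j, hj⟩ := Sum.isRight_iff.1 h2
      simp [hi, hj]
    · obtain ⟨i, hi⟩ := Sum.isLeft_iff.1 h2
      refine ⟨decide (i.val = 0), Or.inl ⟨?_, ⟨y, hxy.right_mem⟩, i, hxy, hi, by simp⟩⟩
      obtain ⟨j, hj⟩ := Sum.isRight_iff.1 h1
      simp [hi, hj]
  · rintro e f x b ⟨y, i, hxy, h1, h2⟩ ⟨z, j, hxz, h3, h4⟩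
    have : i = j := by
      have := h2.trans h4.symm
      ext
      omega
    rw [this, ← h3] at h1
    rw [φ.injective h1] at hxy
    exact hxy.eq hxz

/-- Two disjoint spanning trees extend the paths `y₀ x₀ y₁ x₁ y₂ x₂ y₃` and `y₂ x₀ y₃ x₁ y₀ x₂ y₁`,
which partition the edges of `K_{3,4}`. The vertices `yⱼ` with `j ≥ 4` are leaves at `x₀` and at
`x₁`; the `xᵢ` with `i ≥ 3` are leaves at `y₀` and at `y₁`. -/
lemma isDense_of_iso_completeBipartite {m n : ℕ} (hm : 3 ≤ m) (hn : 4 ≤ n)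
    (φ : G.toSimpleGraph ≃g completeBipartiteGraph (Fin m) (Fin n)) (hV : V(G).Finite)
    (hE : E(G).Finite) : IsDense G := by
  let S₁ : ℕ → ℕ → Prop := fun i j ↦ (i = 0 ∧ (j = 0 ∨ j = 1 ∨ 4 ≤ j)) ∨
    (i = 1 ∧ (j = 1 ∨ j = 2)) ∨ (i = 2 ∧ (j = 2 ∨ j = 3)) ∨ (3 ≤ i ∧ j = 0)
  let S₂ : ℕ → ℕ → Prop := fun i j ↦ (i = 0 ∧ (j = 2 ∨ j = 3)) ∨
    (i = 1 ∧ (j = 0 ∨ j = 3 ∨ 4 ≤ j)) ∨ (i = 2 ∧ (j = 0 ∨ j = 1)) ∨ (3 ≤ i ∧ j = 1)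
  let B : (ℕ → ℕ → Prop) → Set β := fun S ↦ {e | ∃ (i : Fin m) (j : Fin n), S i j ∧
    G.IsLink e (φ.symm (.inl i)) (φ.symm (.inr j))}
  have hlink : ∀ (i : Fin m) (j : Fin n), ∃ e, G.IsLink e (φ.symm (.inl i)) (φ.symm (.inr j)) := by
    intro i j
    have : (completeBipartiteGraph (Fin m) (Fin n)).Adj (.inl i) (.inr j) := by simp
    rw [← φ.symm.map_adj_iff] at this
    exact this.2
  let x : ∀ i, i < m → α := fun i hi ↦ φ.symm (.inl ⟨i, hi⟩)
  let y : ∀ j, j < n → α := fun j hj ↦ φ.symm (.inr ⟨j, hj⟩)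
  have hj : ∀ S i j (hi : i < m) (hj : j < n), S i j → Joined G (B S) (x i hi) (y j hj) := by
    intro S i j hi hj h
    obtain ⟨e, he⟩ := hlink ⟨i, hi⟩ ⟨j, hj⟩
    exact .of_isLink he ⟨_, _, h, he⟩
  have hsub : ∀ S, B S ⊆ E(G) := by
    rintro S e ⟨i, j, -, he⟩
    exact he.edge_mem
  have hall : ∀ S, (∀ i hi, Joined G (B S) (x 0 (by omega)) (x i hi)) →
      (∀ j hj, Joined G (B S) (x 0 (by omega)) (y j hj)) →
      ∀ u ∈ V(G), ∀ v ∈ V(G), Joined G (B S) u v := by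
    intro S h1 h2
    have h3 : ∀ u ∈ V(G), Joined G (B S) (x 0 (by omega)) u := by
      intro u hu
      rcases h : φ ⟨u, hu⟩ with i | j
      · have := h1 i i.2
        simp only [x, Fin.eta, ← h, φ.symm_apply_apply] at this
        exact this
      · have := h2 j j.2
        simp only [y, Fin.eta, ← h, φ.symm_apply_apply] at this
        exact this
    exact fun u hu v hv ↦ (h3 u hu).symm.trans (h3 v hv)
  refine isDense_of_two_connected hV hE (B S₁) (B S₂) (hsub _) (hsub _) ?_ ?_ ?_
  · rw [Set.disjoint_left]
    rintro e ⟨i, j, h1, h2⟩ ⟨i', j', h3, h4⟩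
    rcases h2.eq_and_eq_or_eq_and_eq h4 with ⟨h5, h6⟩ | ⟨h5, h6⟩
    · have h5 := φ.symm.injective (Subtype.ext h5)
      have h6 := φ.symm.injective (Subtype.ext h6)
      simp only [Sum.inl.injEq, Sum.inr.injEq] at h5 h6
      subst h5 h6
      simp only [S₁, S₂] at h1 h3
      omega
    · have h5 := φ.symm.injective (Subtype.ext h5)
      simp at h5
  · have k1 := fun i j hi hj' ↦ hj S₁ i j hi hj'
    have a0 := k1 0 0 (by omega) (by omega) (by simp [S₁])
    have a1 := k1 0 1 (by omega) (by omega) (by simp [S₁])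
    have a2 := a1.trans (k1 1 1 (by omega) (by omega) (by simp [S₁])).symm
    have a3 := a2.trans (k1 1 2 (by omega) (by omega) (by simp [S₁]))
    have a4 := a3.trans (k1 2 2 (by omega) (by omega) (by simp [S₁])).symm
    have a5 := a4.trans (k1 2 3 (by omega) (by omega) (by simp [S₁]))
    refine hall _ (fun i hi ↦ ?_) (fun j hj' ↦ ?_)
    · rcases (by omega : i = 0 ∨ i = 1 ∨ i = 2 ∨ 3 ≤ i) with rfl | rfl | rfl | h
      · exact .refl _ _ _
      · exact a2
      · exact a4
      · exact a0.trans (k1 i 0 hi (by omega) (by simp [S₁, h])).symm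
    · rcases (by omega : j = 0 ∨ j = 1 ∨ j = 2 ∨ j = 3 ∨ 4 ≤ j) with rfl | rfl | rfl | rfl | h
      · exact a0
      · exact a1
      · exact a3
      · exact a5
      · exact k1 0 j (by omega) hj' (by simp [S₁, h])
  · have k1 := fun i j hi hj' ↦ hj S₂ i j hi hj'
    have a0 := k1 0 2 (by omega) (by omega) (by simp [S₂])
    have a1 := k1 0 3 (by omega) (by omega) (by simp [S₂])
    have a2 := a1.trans (k1 1 3 (by omega) (by omega) (by simp [S₂])).symm
    have a3 := a2.trans (k1 1 0 (by omega) (by omega) (by simp [S₂]))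
    have a4 := a3.trans (k1 2 0 (by omega) (by omega) (by simp [S₂])).symm
    have a5 := a4.trans (k1 2 1 (by omega) (by omega) (by simp [S₂]))
    refine hall _ (fun i hi ↦ ?_) (fun j hj' ↦ ?_)
    · rcases (by omega : i = 0 ∨ i = 1 ∨ i = 2 ∨ 3 ≤ i) with rfl | rfl | rfl | h
      · exact .refl _ _ _
      · exact a2
      · exact a4
      · exact a5.trans (k1 i 1 hi (by omega) (by simp [S₂, h])).symm
    · rcases (by omega : j = 0 ∨ j = 1 ∨ j = 2 ∨ j = 3 ∨ 4 ≤ j) with rfl | rfl | rfl | rfl | h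
      · exact a3
      · exact a5
      · exact a0
      · exact a1
      · exact a2.trans (k1 1 j (by omega) hj' (by simp [S₂, h]))

/-- All degrees are at most three. The map `s` forgets the side of a vertex, which loses nothing
among the neighbours of `v`. -/
lemma isSparse_of_iso_completeBipartite_three (hs : G.Simple)
    (φ : G.toSimpleGraph ≃g completeBipartiteGraph (Fin 3) (Fin 3)) (hV : V(G).Finite)
    (hE : E(G).Finite) : IsSparse G := by
  refine isSparse_of_degree_le hV hE hs fun v hv ↦ ?_
  let s : Fin 3 ⊕ Fin 3 → Fin 3 := Sum.elim id id
  have h1 : ∀ e ∈ G.incidenceSet v, ∃ i : Fin 3, ∃ u : V(G), G.IsLink e v u ∧ s (φ u) = i ∧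
      (φ u).isLeft = (φ ⟨v, hv⟩).isRight := by
    rintro e ⟨u, hu⟩
    refine ⟨_, ⟨u, hu.right_mem⟩, hu, rfl, ?_⟩
    have hadj : G.toSimpleGraph.Adj ⟨v, hv⟩ ⟨u, hu.right_mem⟩ :=
      ⟨fun h ↦ hu.ne (congr_arg Subtype.val h), e, hu⟩
    rw [← φ.map_adj_iff, completeBipartiteGraph_adj] at hadj
    rcases hadj with ⟨h1, h2⟩ | ⟨h1, h2⟩
    · obtain ⟨i, hi⟩ := Sum.isLeft_iff.1 h1
      obtain ⟨j, hj⟩ := Sum.isRight_iff.1 h2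
      rw [hi, hj]
      rfl
    · rw [h1, h2]
  choose! t ht using h1
  have := Set.ncard_le_ncard_of_injOn (t := Set.univ) t (fun _ _ ↦ trivial) (fun e he f hf hef ↦ by
    obtain ⟨u, h1, h2, h3⟩ := ht e he
    obtain ⟨w, h4, h5, h6⟩ := ht f hf
    have : φ u = φ w := by
      rw [← hef, ← h2] at h5
      rw [← h3] at h6
      rcases hu : φ u with i | i <;> rcases hw : φ w with j | j <;> simp_all [s]
    rw [φ.injective this] at h1
    exact h1.eq h4) Set.finite_univ
  simpa [Set.ncard_univ] using this

lemma IsCompleteBipartite.isSparse_or_isDense (h : IsCompleteBipartite G) (hV : V(G).Finite)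
    (hE : E(G).Finite) : IsSparse G ∨ IsDense G := by
  obtain ⟨hs, m, n, ⟨φ⟩⟩ := h
  let σ : completeBipartiteGraph (Fin m) (Fin n) ≃g completeBipartiteGraph (Fin n) (Fin m) :=
    ⟨Equiv.sumComm _ _, by rintro (a | a) (b | b) <;> simp⟩
  by_cases h1 : m ≤ 2
  · exact Or.inl (isSparse_of_iso_completeBipartite h1 hs φ hV hE)
  by_cases h2 : n ≤ 2
  · exact Or.inl (isSparse_of_iso_completeBipartite h2 hs (φ.trans σ) hV hE)
  by_cases h3 : 4 ≤ n
  · exact Or.inr (isDense_of_iso_completeBipartite (by omega) h3 φ hV hE)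
  by_cases h4 : 4 ≤ m
  · exact Or.inr (isDense_of_iso_completeBipartite (by omega) h4 (φ.trans σ) hV hE)
  obtain rfl : m = 3 := by omega
  obtain rfl : n = 3 := by omega
  exact Or.inl (isSparse_of_iso_completeBipartite_three hs φ hV hE)

/-- Removing `x` leaves a connected graph with at least two vertices, in which `u` cannot be
isolated. -/
lemma IsVertexConnected.exists_adj (h : IsVertexConnected G 2) {u x : α}
    (hu : u ∈ V(G)) (hux : u ≠ x) : ∃ y, y ≠ x ∧ y ≠ u ∧ G.Adj u y := by
  obtain ⟨h1, h2⟩ := h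
  -- The intersection covers the case that `x` is not a vertex of `G`.
  have h3 := h2 (V(G) ∩ {x}) Set.inter_subset_left (by
    have := Set.ncard_le_ncard (Set.inter_subset_right : V(G) ∩ {x} ⊆ {x}) (Set.finite_singleton x)
    rw [Set.ncard_singleton] at this
    omega)
  rw [Set.sdiff_self_inter] at h3
  obtain ⟨z, hz, hzu⟩ : ∃ z ∈ V(G) \ {x}, z ≠ u := by
    have h4 := Set.ncard_le_ncard_sdiff_add_ncard V(G) {x} (Set.finite_singleton x)
    rw [Set.ncard_singleton] at h4
    have h5 : 1 < (V(G) \ {x}).ncard := by omega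
    exact Set.exists_ne_of_one_lt_ncard h5 u
  have hu' : u ∈ V(G) \ {x} := ⟨hu, hux⟩
  have h6 := h3.preconnected ⟨u, hu'⟩ ⟨z, hz⟩
  obtain ⟨w, hw⟩ := h6.nonempty_neighborSet_left (fun h ↦ hzu (congr_arg Subtype.val h).symm)
  obtain ⟨hne, e, he, -, hwx⟩ := hw
  exact ⟨w, hwx.2, fun h ↦ hne (Subtype.ext h.symm), e, he⟩

/-- The edges of `K₄` on `a, b, c, d` split into the paths `a b c d` and `c a d b`. Every further
vertex is attached to `a` in one subgraph and to `b` in the other. -/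
lemma isDense_of_dominating_pair (hV : V(G).Finite) (hE : E(G).Finite) [G.Loopless] {a b c d : α}
    (hab : G.Adj a b) (hac : G.Adj a c) (had : G.Adj a d) (hbc : G.Adj b c) (hbd : G.Adj b d)
    (hcd : G.Adj c d) (h : ∀ u ∈ V(G), u ≠ a → u ≠ b → G.Adj u a ∧ G.Adj u b) : IsDense G := by
  let B₁ : Set β := {e | G.IsLink e a b ∨ G.IsLink e b c ∨ G.IsLink e c d ∨
    ∃ u, u ≠ a ∧ u ≠ b ∧ u ≠ c ∧ u ≠ d ∧ G.IsLink e u a}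
  let B₂ : Set β := {e | G.IsLink e a c ∨ G.IsLink e a d ∨ G.IsLink e b d ∨
    ∃ u, u ≠ a ∧ u ≠ b ∧ u ≠ c ∧ u ≠ d ∧ G.IsLink e u b}
  have hB : ∀ B : Set β, (∀ u ∈ V(G), Joined G B u a) →
      ∀ u ∈ V(G), ∀ v ∈ V(G), Joined G B u v := fun B h u hu v hv ↦ (h u hu).trans (h v hv).symm
  refine isDense_of_two_connected hV hE B₁ B₂ ?_ ?_ ?_ (hB _ ?_) (hB _ ?_)
  · rintro e (he | he | he | ⟨u, -, -, -, -, he⟩) <;> exact he.edge_mem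
  · rintro e (he | he | he | ⟨u, -, -, -, -, he⟩) <;> exact he.edge_mem
  · have := hab.ne
    have := hac.ne
    have := had.ne
    have := hbc.ne
    have := hbd.ne
    have := hcd.ne
    rw [Set.disjoint_left]
    rintro e (he | he | he | ⟨u, h1, h2, h3, h4, he⟩) (hf | hf | hf | ⟨v, h5, h6, h7, h8, hf⟩) <;>
      · have := he.eq_and_eq_or_eq_and_eq hf
        grind
  · intro u hu
    obtain ⟨e, he⟩ := hab
    obtain ⟨f, hf⟩ := hbc
    obtain ⟨g, hg⟩ := hcd
    have k1 : Joined G B₁ b a := (Joined.of_isLink he (Or.inl he)).symm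
    have k2 : Joined G B₁ c a := (Joined.of_isLink hf (Or.inr (Or.inl hf))).symm.trans k1
    have k3 : Joined G B₁ d a := (Joined.of_isLink hg (Or.inr (Or.inr (Or.inl hg)))).symm.trans k2
    by_cases h1 : u = a
    · rw [h1]; exact .refl _ _ _
    by_cases h2 : u = b
    · rwa [h2]
    by_cases h3 : u = c
    · rwa [h3]
    by_cases h4 : u = d
    · rwa [h4]
    obtain ⟨k, hk⟩ := (h u hu h1 h2).1
    exact Joined.of_isLink hk (Or.inr (Or.inr (Or.inr ⟨u, h1, h2, h3, h4, hk⟩)))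
  · intro u hu
    obtain ⟨e, he⟩ := hac
    obtain ⟨f, hf⟩ := had
    obtain ⟨g, hg⟩ := hbd
    have k1 : Joined G B₂ c a := (Joined.of_isLink he (Or.inl he)).symm
    have k2 : Joined G B₂ d a := (Joined.of_isLink hf (Or.inr (Or.inl hf))).symm
    have k3 : Joined G B₂ b a := (Joined.of_isLink hg (Or.inr (Or.inr (Or.inl hg)))).trans k2
    by_cases h1 : u = a
    · rw [h1]; exact .refl _ _ _
    by_cases h2 : u = b
    · rwa [h2]
    by_cases h3 : u = c
    · rwa [h3]
    by_cases h4 : u = d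
    · rwa [h4]
    obtain ⟨k, hk⟩ := (h u hu h1 h2).2
    exact (Joined.of_isLink hk (Or.inr (Or.inr (Or.inr ⟨u, h1, h2, h3, h4, hk⟩)))).trans k3

/-- The two heaviest vertices `a` and `b` are adjacent to each other and to all other vertices. An
edge avoiding both completes a `K₄` and gives density; if there is none, all edges meet `{a, b}`. -/
lemma IsThreshold.isSparse_or_isDense (h : IsThreshold G) (hc : IsVertexConnected G 2)
    (hV : V(G).Finite) (hE : E(G).Finite) : IsSparse G ∨ IsDense G := by
  classical
  obtain ⟨hs, w, t, hw⟩ := h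
  have hcard := hc.1
  have hmax : ∀ X : Set α, X.Finite → X.ncard ≤ 2 →
      ∃ a ∈ V(G) \ X, ∀ b ∈ V(G) \ X, w b ≤ w a := by
    intro X hXf hX
    refine Set.exists_max_image _ _ (hV.subset Set.sdiff_subset) ?_
    rw [← Set.ncard_pos (hV.subset Set.sdiff_subset)]
    have := Set.ncard_le_ncard_sdiff_add_ncard V(G) X hXf
    omega
  obtain ⟨a, ⟨ha, -⟩, ha'⟩ := hmax ∅ Set.finite_empty (by simp)
  obtain ⟨b, ⟨hb, hba⟩, hb'⟩ := hmax {a} (Set.finite_singleton a) (by simp)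
  obtain ⟨c, ⟨hcV, hcn⟩, hc'⟩ := hmax {a, b} (Set.toFinite _) ((Set.ncard_insert_le a {b}).trans (by simp))
  simp only [Set.mem_singleton_iff, Set.mem_insert_iff, not_or, Set.mem_sdiff, and_imp,
    Set.mem_empty_iff_false, not_false_eq_true, true_implies] at hba hcn ha' hb' hc'
  -- By 2-connectedness `u` has a neighbour `y ≠ a`; since `a` and `b` are at least as heavy as `y`,
  -- they are neighbours of `u` too.
  have hdom : ∀ u ∈ V(G), u ≠ a → u ≠ b → G.Adj u a ∧ G.Adj u b := by
    intro u hu hua hub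
    obtain ⟨y, hya, hyu, hy⟩ := hc.exists_adj hu hua
    have h1 := (hw u hu y hy.right_mem hyu.symm).1 hy
    have h2 := hb' y hy.right_mem hya
    have h3 := ha' b hb
    exact ⟨(hw u hu a ha hua).2 (by linarith), (hw u hu b hb hub).2 (by linarith)⟩
  have hca := hdom c hcV hcn.1 hcn.2
  have hab : G.Adj a b := by
    have h1 := (hw c hcV a ha hcn.1).1 hca.1
    have h2 := hb' c hcV hcn.1
    exact (hw a ha b hb (Ne.symm hba)).2 (by linarith)
  by_cases hex : ∃ x ∈ V(G), ∃ y ∈ V(G), x ≠ a ∧ x ≠ b ∧ y ≠ a ∧ y ≠ b ∧ G.Adj x y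
  · right
    obtain ⟨x, hx, y, hy, hxa, hxb, hya, hyb, hxy⟩ := hex
    have hxa' := hdom x hx hxa hxb
    have hya' := hdom y hy hya hyb
    exact isDense_of_dominating_pair hV hE hab hxa'.1.symm hya'.1.symm hxa'.2.symm hya'.2.symm hxy
      hdom
  · left
    push Not at hex
    -- Every edge has its larger end in `{a, b}`, and the slot tells which of the two it is.
    let ρ : α → ℕ := fun x ↦ if x = a then 2 else if x = b then 1 else 0
    refine isSparse_of_tail hV hE (fun e x i ↦ G.IsLink e x (if i then a else b)) ρ ?_
      (fun e f x i he hf ↦ he.eq hf)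
    intro e x y hxy
    have hne := hxy.ne
    by_cases h1 : x = a
    · subst h1
      refine ⟨true, Or.inr ⟨?_, by simpa using hxy.symm⟩⟩
      simp only [ρ]
      grind
    by_cases h2 : y = a
    · subst h2
      refine ⟨true, Or.inl ⟨?_, by simpa using hxy⟩⟩
      simp only [ρ]
      grind
    by_cases h3 : x = b
    · subst h3
      refine ⟨false, Or.inr ⟨?_, by simpa using hxy.symm⟩⟩
      simp only [ρ]
      grind
    by_cases h4 : y = b
    · subst h4
      refine ⟨false, Or.inl ⟨?_, by simpa using hxy⟩⟩
      simp only [ρ]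
      grind
    exact absurd ⟨e, hxy⟩ (hex x hxy.left_mem y hxy.right_mem h1 h3 h2 h4)

/-- A `4`-edge-connected graph is dense. -/
lemma IsEdgeConnected.isDense (h : IsEdgeConnected G 4) (hV : V(G).Finite) (hE : E(G).Finite) :
    IsDense G := by
  classical
  intro A hA
  have : Finite V(G.restrict A) := hV
  have : Fintype V(G.restrict A) := Fintype.ofFinite _
  have : Fintype (G.restrict A).toSimpleGraph.ConnectedComponent := Fintype.ofFinite _
  have h1 := rank_add_card_components hV A
  have h2 := rank_add_card_components hV E(G)
  have h0 := (h ∅ (by simp) (by simp)).nonempty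
  have h3 : 0 < Nat.card (G.restrict E(G)).toSimpleGraph.ConnectedComponent := by
    have : Finite V(G.restrict E(G)) := hV
    obtain ⟨v⟩ := h0
    have : Nonempty (G.restrict E(G)).toSimpleGraph.ConnectedComponent :=
      ⟨SimpleGraph.connectedComponentMk _ ⟨v.1, v.2⟩⟩
    exact Nat.card_pos
  rw [Nat.card_eq_fintype_card] at h1
  rcases Nat.lt_or_ge 1 (Fintype.card (G.restrict A).toSimpleGraph.ConnectedComponent) with h4 | h4
  swap
  · omega
  have hDf : (E(G) \ A).Finite := hE.subset Set.sdiff_subset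
  -- `δ c e`: the edge `e` leaves the component `c`. If there are at least two components, each is
  -- left by at least four edges outside `A`.
  let δ : (G.restrict A).toSimpleGraph.ConnectedComponent → β → Prop := fun c e ↦
    ∃ x y, G.IsLink e x y ∧ x ∈ componentSet G A c ∧ y ∉ componentSet G A c
  have h5 : ∀ c, 4 ≤ (Finset.bipartiteAbove δ hDf.toFinset c).card := by
    intro c
    by_contra hlt
    have h6 := h (Finset.bipartiteAbove δ hDf.toFinset c) (fun e he ↦ by
      simp only [Finset.bipartiteAbove, Finset.coe_filter, Set.Finite.mem_toFinset,
        Set.mem_ofPred_eq] at he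
      exact he.1.1) (by rw [Set.ncard_coe_finset]; omega)
    obtain ⟨d, hd⟩ := Fintype.exists_ne_of_one_lt_card h4 c
    obtain ⟨x, hx⟩ := componentSet_nonempty c
    obtain ⟨y, hy⟩ := componentSet_nonempty d
    have hxV := componentSet_subset _ hx
    have hyV := componentSet_subset _ hy
    have h7 := h6.preconnected ⟨x, hxV⟩ ⟨y, hyV⟩
    rw [SimpleGraph.reachable_iff_reflTransGen] at h7
    -- A walk that uses no edge leaving `c` stays in `c`.
    have h8 : ∀ z : V(G.deleteEdges (Finset.bipartiteAbove δ hDf.toFinset c : Set β)),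
        Relation.ReflTransGen (G.deleteEdges
          (Finset.bipartiteAbove δ hDf.toFinset c : Set β)).toSimpleGraph.Adj ⟨x, hxV⟩ z →
        z.1 ∈ componentSet G A c := by
      intro z hz
      induction hz with
      | refl => exact hx
      | @tail u v _ huv ih =>
        obtain ⟨-, e, he⟩ := huv
        simp only [Graph.deleteEdges_isLink] at he
        by_contra hv
        refine he.2 ?_
        simp only [Finset.bipartiteAbove, Finset.coe_filter, Set.Finite.mem_toFinset,
          Set.mem_ofPred_eq]
        refine ⟨⟨he.1.edge_mem, fun heA ↦ hv ?_⟩, u, v, he.1, ih, hv⟩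
        rw [mem_componentSet_iff he.1.right_mem, ← connectedComponentMk_eq_of_isLink he.1 heA]
        exact (mem_componentSet_iff he.1.left_mem).1 ih
    have h9 := h8 _ h7
    rw [mem_componentSet_iff hyV] at h9 hy
    exact hd (hy.symm.trans h9)
  have h6 := Finset.sum_card_bipartiteAbove_eq_sum_card_bipartiteBelow (s := Finset.univ)
    (t := hDf.toFinset) (r := δ)
  have h7 : ∀ e ∈ hDf.toFinset, (Finset.bipartiteBelow δ Finset.univ e).card ≤ 2 := by
    intro e he
    rw [Set.Finite.mem_toFinset] at he
    obtain ⟨x, y, hxy⟩ := G.exists_isLink_of_mem_edgeSet he.1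
    refine (Finset.card_le_card (t := {SimpleGraph.connectedComponentMk _ ⟨x, hxy.left_mem⟩,
      SimpleGraph.connectedComponentMk _ ⟨y, hxy.right_mem⟩}) ?_).trans Finset.card_le_two
    intro c hc
    simp only [Finset.bipartiteBelow, Finset.mem_filter, Finset.mem_univ, true_and] at hc
    obtain ⟨u, v, huv, hu, -⟩ := hc
    rw [Finset.mem_insert, Finset.mem_singleton]
    rcases huv.left_eq_or_eq hxy with rfl | rfl
    · exact Or.inl ((mem_componentSet_iff _).1 hu).symm
    · exact Or.inr ((mem_componentSet_iff _).1 hu).symm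
  -- An edge leaves at most two components, so `c` components give `4 * c ≤ 2 * |E \ A|`, more than
  -- the required `2 * (c - 1) ≤ |E \ A|`.
  have h8 := Finset.sum_le_card_nsmul _ _ _ h7
  have h9 := Finset.card_nsmul_le_sum _ _ _ (fun c (_ : c ∈ Finset.univ) ↦ h5 c)
  rw [h6] at h9
  have h10 := h9.trans h8
  rw [← Set.ncard_eq_toFinset_card _ hDf, Finset.card_univ, smul_eq_mul, smul_eq_mul] at h10
  omega

end Classes

/-! ### Series-parallel graphs -/

section SeriesParallel

variable {α β : Type*} {G : Graph α β} {A : Set β}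

lemma apply_eq_zero_of_mem_edgeSpan {v : α} (hv : v ∉ V(G)) {f : α →₀ ZMod 2}
    (hf : f ∈ edgeSpan G A) : f v = 0 := by
  induction hf using Submodule.span_induction with
  | mem f hf =>
    obtain ⟨e, -, rfl⟩ := hf
    by_cases he : e ∈ E(G)
    · obtain ⟨x, y, h⟩ := G.exists_isLink_of_mem_edgeSet he
      have hx : x ≠ v := fun h' ↦ hv (h' ▸ h.left_mem)
      have hy : y ≠ v := fun h' ↦ hv (h' ▸ h.right_mem)
      simp [edgeVec_eq h, hx, hy]
    · simp [edgeVec_of_notMem he]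
  | zero => rfl
  | add f g _ _ hf hg => simp [hf, hg]
  | smul c f _ hf => simp [hf]

lemma edgeSpan_congr {H : Graph α β} (h : ∀ e ∈ A, edgeVec G e = edgeVec H e) :
    edgeSpan G A = edgeSpan H A := by
  rw [edgeSpan, edgeSpan, Set.image_congr h]

lemma edgeVec_congr {H : Graph α β} {e : β} (h : ∀ x y, G.IsLink e x y → H.IsLink e x y)
    (he : e ∈ E(G)) : edgeVec G e = edgeVec H e := by
  obtain ⟨x, y, hxy⟩ := G.exists_isLink_of_mem_edgeSet he
  rw [edgeVec_eq hxy, edgeVec_eq (h _ _ hxy)]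

/-- No two edges of `A` are parallel. -/
def IsSimpleOn (G : Graph α β) (A : Set β) : Prop :=
  ∀ e ∈ A, ∀ f ∈ A, ∀ x y, G.IsLink e x y → G.IsLink f x y → e = f

lemma setLink_isLink_self (G : Graph α β) (e : β) (x y : α) : (setLink G e x y).IsLink e x y :=
  Or.inr ⟨rfl, Or.inl ⟨rfl, rfl⟩⟩

lemma setLink_isLink_of_ne {e f : β} (x y : α) (hf : f ≠ e) {u v : α} (h : G.IsLink f u v) :
    (setLink G e x y).IsLink f u v :=
  Or.inl ⟨hf, h⟩

lemma IsSimpleOn.of_isLink {H : Graph α β} {B : Set β} (hA : IsSimpleOn G A) (h : B ⊆ A)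
    (h' : ∀ e ∈ B, ∀ x y, H.IsLink e x y → G.IsLink e x y) : IsSimpleOn H B :=
  fun e he f hf x y h1 h2 ↦ hA e (h he) f (h hf) x y (h' e he x y h1) (h' f hf x y h2)

lemma finrank_edgeSpan_mono (hV : V(G).Finite) {B : Set β} (h : A ⊆ B) :
    Module.finrank (ZMod 2) (edgeSpan G A) ≤ Module.finrank (ZMod 2) (edgeSpan G B) := by
  have := finiteDimensional_edgeSpan hV B
  exact Submodule.finrank_mono (edgeSpan_mono G h)

/-- All vectors in the span vanish at `v`, so `g` is independent of them. -/
lemma finrank_edgeSpan_sup (hV : V(G).Finite) {v : α} (hv : v ∉ V(G)) {g : α →₀ ZMod 2}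
    (hg : g v ≠ 0) : Module.finrank (ZMod 2)
      (edgeSpan G A ⊔ Submodule.span (ZMod 2) {g} : Submodule (ZMod 2) (α →₀ ZMod 2)) =
      Module.finrank (ZMod 2) (edgeSpan G A) + 1 := by
  have := finiteDimensional_edgeSpan hV A
  exact finrank_sup_span_of_notMem fun h ↦ hg (apply_eq_zero_of_mem_edgeSpan hv h)

/-- In a series-parallel graph, simple sets of edges satisfy the sparsity condition. -/
lemma SeriesParallel.ncard_le (h : SeriesParallel G) (hV : V(G).Finite) (hA : A ⊆ E(G))
    (hAf : A.Finite) (hs : IsSimpleOn G A) :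
    A.ncard ≤ 2 * Module.finrank (ZMod 2) (edgeSpan G A) := by
  classical
  induction h generalizing A with
  | edgeless X =>
    have : A = ∅ := Set.subset_empty_iff.1 hA
    simp [this]
  | pendant G e x v _ hx hv he ih =>
    have hV' : V(G).Finite := hV.subset (by intro u hu; simp [setLink, hu])
    have h0 : A \ {e} ⊆ E(G) := by
      rintro f ⟨hf, hfe⟩
      exact (hA hf).resolve_left hfe
    have h1 := ih hV' h0 (hAf.subset Set.sdiff_subset)
      (hs.of_isLink Set.sdiff_subset fun f hf a b ↦ setLink_isLink_of_ne x v hf.2)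
    have h2 : edgeSpan (setLink G e x v) (A \ {e}) = edgeSpan G (A \ {e}) :=
      (edgeSpan_congr fun f hf ↦ edgeVec_congr (fun a b ↦ setLink_isLink_of_ne x v hf.2)
        (h0 hf)).symm
    by_cases heA : e ∈ A
    · have h3 := edgeSpan_insert (setLink G e x v) e (A \ {e})
      rw [Set.insert_sdiff_singleton, Set.insert_eq_of_mem heA, h2] at h3
      have hxv : x ≠ v := fun h ↦ hv (h ▸ hx)
      rw [h3, finrank_edgeSpan_sup hV' hv (by
        simp [edgeVec_eq (setLink_isLink_self G e x v), hxv])]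
      have := Set.ncard_sdiff_singleton_add_one heA hAf
      omega
    · rw [Set.sdiff_singleton_eq_self heA] at h1 h2
      rwa [h2]
  | double G e f x y _ he hf ih =>
    have hV' : V(G).Finite := hV.subset (by intro u hu; simp [setLink, hu])
    have hef : e ≠ f := fun h ↦ hf (h ▸ he.edge_mem)
    have h0 : A \ {f} ⊆ E(G) := by
      rintro g ⟨hg, hgf⟩
      exact (hA hg).resolve_left hgf
    have h2 : edgeSpan (setLink G f x y) (A \ {f}) = edgeSpan G (A \ {f}) :=
      (edgeSpan_congr fun g hg ↦ edgeVec_congr (fun a b ↦ setLink_isLink_of_ne x y hg.2)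
        (h0 hg)).symm
    have hs' : IsSimpleOn G (A \ {f}) :=
      hs.of_isLink Set.sdiff_subset fun f hf a b ↦ setLink_isLink_of_ne x y hf.2
    -- If `f ∈ A`, then no other edge of `A` is parallel to it. Exchanging `f` for `e`, which has
    -- the same column, gives a simple set of edges of `G`.
    by_cases hfA : f ∈ A
    · have hpar : ∀ g ∈ A \ {f}, ¬ G.IsLink g x y := fun g hg h ↦
        hg.2 (hs g hg.1 f hfA x y (setLink_isLink_of_ne x y hg.2 h) (setLink_isLink_self G f x y))
      have heA : e ∉ A \ {f} := fun h ↦ hpar e h he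
      have h3 := edgeSpan_insert (setLink G f x y) f (A \ {f})
      rw [Set.insert_sdiff_singleton, Set.insert_eq_of_mem hfA, h2,
        edgeVec_eq (setLink_isLink_self G f x y), ← edgeVec_eq he, ← edgeSpan_insert] at h3
      rw [h3]
      have h4 := ih (A := insert e (A \ {f})) hV' (Set.insert_subset he.edge_mem h0)
        ((hAf.subset Set.sdiff_subset).insert e) (by
          rintro g (rfl | hg) k (rfl | hk) a b hga hka
          · rfl
          · exfalso
            refine hpar k hk ?_
            rcases hga.eq_and_eq_or_eq_and_eq he with ⟨rfl, rfl⟩ | ⟨rfl, rfl⟩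
            · exact hka
            · exact hka.symm
          · exfalso
            refine hpar g hg ?_
            rcases hka.eq_and_eq_or_eq_and_eq he with ⟨rfl, rfl⟩ | ⟨rfl, rfl⟩
            · exact hga
            · exact hga.symm
          · exact hs' g hg k hk a b hga hka)
      rwa [Set.ncard_insert_of_notMem heA (hAf.subset Set.sdiff_subset),
        Set.ncard_sdiff_singleton_add_one hfA hAf] at h4
    · rw [Set.sdiff_singleton_eq_self hfA] at h2 h0 hs'
      rw [h2]
      exact ih hV' h0 hAf hs'
  | subdivide G e f x y v _ he hf hv ih =>
    set H := setLink (setLink G e x v) f v y with hH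
    have hV' : V(G).Finite := hV.subset (by intro u hu; simp [hH, setLink, hu])
    have hef : e ≠ f := fun h ↦ hf (h ▸ he.edge_mem)
    have hxv : x ≠ v := fun h ↦ hv (h ▸ he.left_mem)
    have hyv : y ≠ v := fun h ↦ hv (h ▸ he.right_mem)
    set A₀ := (A \ {e}) \ {f} with hA₀
    have hA₀f : A₀.Finite := hAf.subset (Set.sdiff_subset.trans Set.sdiff_subset)
    have heA₀ : e ∉ A₀ := fun h ↦ h.1.2 rfl
    have hfA₀ : f ∉ A₀ := fun h ↦ h.2 rfl
    have h0 : A₀ ⊆ E(G) := by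
      rintro g ⟨⟨hg, hge⟩, hgf⟩
      exact ((hA hg).resolve_left hgf).resolve_left hge
    have hlink : ∀ g ∈ A₀, ∀ a b, G.IsLink g a b → H.IsLink g a b := fun g hg a b h ↦
      setLink_isLink_of_ne _ _ hg.2 (setLink_isLink_of_ne _ _ hg.1.2 h)
    have hspan : edgeSpan H A₀ = edgeSpan G A₀ :=
      (edgeSpan_congr fun g hg ↦ edgeVec_congr (hlink g hg) (h0 hg)).symm
    have hs' : IsSimpleOn G A₀ :=
      hs.of_isLink (Set.sdiff_subset.trans Set.sdiff_subset) hlink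
    have h1 := ih hV' h0 hA₀f hs'
    have hve : edgeVec H e = .single x 1 + .single v 1 :=
      edgeVec_eq (setLink_isLink_of_ne _ _ hef (setLink_isLink_self _ _ _ _))
    have hvf : edgeVec H f = .single v 1 + .single y 1 :=
      edgeVec_eq (setLink_isLink_self _ _ _ _)
    have hve' : edgeVec H e v ≠ 0 := by simp [hve, hxv]
    have hvf' : edgeVec H f v ≠ 0 := by simp [hvf, hyv]
    -- One half of the subdivided edge, without the other, adds one edge and one dimension.
    have hone : ∀ g, edgeVec H g v ≠ 0 → g ∉ A₀ → A = insert g A₀ →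
        A.ncard ≤ 2 * Module.finrank (ZMod 2) (edgeSpan H A) := by
      intro g hg hgA hAg
      rw [hAg, edgeSpan_insert, hspan, finrank_edgeSpan_sup hV' hv hg,
        Set.ncard_insert_of_notMem hgA hA₀f]
      omega
    by_cases heA : e ∈ A <;> by_cases hfA : f ∈ A
    · have hA' : A = insert f (insert e A₀) := by
        ext g
        simp only [hA₀, Set.mem_insert_iff, Set.mem_sdiff, Set.mem_singleton_iff]
        grind
      have hcard : A.ncard = A₀.ncard + 2 := by
        rw [hA', Set.ncard_insert_of_notMem (by simp [hef.symm, hfA₀]) (hA₀f.insert e),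
          Set.ncard_insert_of_notMem heA₀ hA₀f]
      -- Mod 2 the column of the old edge is the sum of the columns of its two halves.
      have hsum : edgeVec H e = edgeVec G e + edgeVec H f := by
        rw [hve, hvf, edgeVec_eq he,
          show (.single x 1 + .single y 1 + (.single v 1 + .single y 1) : α →₀ ZMod 2) =
            .single x 1 + .single v 1 + (.single y 1 + .single y 1) by abel,
          zmod_two_add_self, add_zero]
      have hspan' : edgeSpan H A =
          edgeSpan G (insert e A₀) ⊔ Submodule.span (ZMod 2) {edgeVec H f} := by
        rw [hA', edgeSpan_insert, edgeSpan_insert, edgeSpan_insert, hspan, sup_assoc, sup_assoc]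
        congr 1
        rw [← Submodule.span_union, ← Submodule.span_union, Set.singleton_union,
          Set.singleton_union]
        apply le_antisymm
        · rw [Submodule.span_le, Set.insert_subset_iff, Set.singleton_subset_iff]
          have k1 := Submodule.subset_span (R := ZMod 2)
            (show edgeVec G e ∈ {edgeVec G e, edgeVec H f} by simp)
          have k2 := Submodule.subset_span (R := ZMod 2)
            (show edgeVec H f ∈ {edgeVec G e, edgeVec H f} by simp)
          exact ⟨hsum ▸ add_mem k1 k2, k2⟩
        · rw [Submodule.span_le, Set.insert_subset_iff, Set.singleton_subset_iff]
          have k1 := Submodule.subset_span (R := ZMod 2)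
            (show edgeVec H e ∈ {edgeVec H e, edgeVec H f} by simp)
          have k2 := Submodule.subset_span (R := ZMod 2)
            (show edgeVec H f ∈ {edgeVec H e, edgeVec H f} by simp)
          have k3 := add_mem k1 k2
          rw [hsum, add_assoc, zmod_two_add_self, add_zero, ← hsum] at k3
          exact ⟨k3, k2⟩
      rw [hspan', finrank_edgeSpan_sup hV' hv hvf', hcard]
      -- The coordinate at `v` contributes one dimension, which pays for two edges. The rest is
      -- bounded in `G` through `A₀`, or through `insert e A₀` when that set is simple.
      by_cases hpar : ∃ g ∈ A₀, G.IsLink g x y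
      · have := finrank_edgeSpan_mono hV' (Set.subset_insert e A₀)
        omega
      · push Not at hpar
        have h4 := ih (A := insert e A₀) hV' (Set.insert_subset he.edge_mem h0) (hA₀f.insert e) (by
          rintro g (rfl | hg) k (rfl | hk) a b hga hka
          · rfl
          · exfalso
            refine hpar k hk ?_
            rcases hga.eq_and_eq_or_eq_and_eq he with ⟨rfl, rfl⟩ | ⟨rfl, rfl⟩
            · exact hka
            · exact hka.symm
          · exfalso
            refine hpar g hg ?_
            rcases hka.eq_and_eq_or_eq_and_eq he with ⟨rfl, rfl⟩ | ⟨rfl, rfl⟩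
            · exact hga
            · exact hga.symm
          · exact hs' g hg k hk a b hga hka)
        rw [Set.ncard_insert_of_notMem heA₀ hA₀f] at h4
        omega
    · refine hone e hve' heA₀ ?_
      rw [hA₀, Set.sdiff_singleton_eq_self (fun h ↦ hfA h.1), Set.insert_sdiff_singleton,
        Set.insert_eq_of_mem heA]
    · refine hone f hvf' hfA₀ ?_
      rw [hA₀, Set.sdiff_singleton_eq_self heA, Set.insert_sdiff_singleton,
        Set.insert_eq_of_mem hfA]
    · have : A₀ = A := by
        rw [hA₀, Set.sdiff_singleton_eq_self heA, Set.sdiff_singleton_eq_self hfA]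
      rw [← this, hspan]
      exact h1

lemma SeriesParallel.isSparse (h : SeriesParallel G) (hs : G.Simple) (hV : V(G).Finite)
    (hE : E(G).Finite) : IsSparse G := by
  intro A hA
  rw [rank_eq_finrank hV]
  exact h.ncard_le hV hA (hE.subset hA) fun e _ f _ x y he hf ↦ he.eq hf

end SeriesParallel

open Filter Topology

/-! ### Ray crossings mod 2 in the plane -/

section Plane

lemma zmod_two_eq (c : ZMod 2) : c = 0 ∨ c = 1 := by
  revert c
  decide

/-- A function whose germs along the set `D` are constant at all points of a preconnected set has
the same germ everywhere. -/
lemma exists_germ_of_isPreconnected {X : Type*} [TopologicalSpace X] {U D : Set X}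
    (hU : IsPreconnected U) (hD : U ⊆ closure D) (g : X → ZMod 2)
    (h : ∀ p ∈ U, ∃ c, ∀ᶠ q in 𝓝 p, q ∈ D → g q = c) :
    ∃ c, ∀ p ∈ U, ∀ᶠ q in 𝓝 p, q ∈ D → g q = c := by
  -- The points with germ `0` and those with germ `1` form open sets that cover `U`. They do not
  -- meet in `U`, since `D` accumulates at each of its points.
  have hopen : ∀ c, IsOpen {p | ∀ᶠ q in 𝓝 p, q ∈ D → g q = c} := by
    intro c
    rw [isOpen_iff_mem_nhds]
    intro p hp
    exact eventually_eventually_nhds.2 hp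
  rw [isPreconnected_iff_subset_of_disjoint] at hU
  rcases hU _ _ (hopen 0) (hopen 1) (fun p hp ↦ by
    obtain ⟨c, hc⟩ := h p hp
    rcases zmod_two_eq c with rfl | rfl
    · exact Or.inl hc
    · exact Or.inr hc) (by
    rw [Set.eq_empty_iff_forall_notMem]
    rintro p ⟨hp, h0, h1⟩
    have h2 := mem_closure_iff_frequently.1 (hD hp)
    obtain ⟨q, hq, h0, h1⟩ := (h2.and_eventually (Filter.Eventually.and h0 h1)).exists
    have := (h0 hq).symm.trans (h1 hq)
    exact absurd this (by decide)) with h0 | h1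
  · exact ⟨0, h0⟩
  · exact ⟨1, h1⟩

/-- The position of `q` relative to the line through `a` and `b`. -/
def side (a b q : ℝ × ℝ) : ℝ := (b.1 - a.1) * (q.2 - a.2) - (b.2 - a.2) * (q.1 - a.1)

lemma continuous_side (a b : ℝ × ℝ) : Continuous (side a b) := by
  unfold side
  fun_prop

lemma side_swap (a b q : ℝ × ℝ) : side b a q = -side a b q := by
  unfold side
  ring

lemma side_add_smul (a b q : ℝ × ℝ) (t : ℝ) : side a b (q + t • (-(b.2 - a.2), b.1 - a.1)) =
    side a b q + t * ((b.1 - a.1) ^ 2 + (b.2 - a.2) ^ 2) := by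
  simp only [side, Prod.fst_add, Prod.snd_add, Prod.smul_fst, Prod.smul_snd, smul_eq_mul]
  ring

lemma side_eq_zero_of_mem_segment {a b p : ℝ × ℝ} (h : p ∈ segment ℝ a b) : side a b p = 0 := by
  rw [segment_eq_image'] at h
  obtain ⟨t, -, rfl⟩ := h
  simp only [side, Prod.fst_add, Prod.snd_add, Prod.smul_fst, Prod.smul_snd, smul_eq_mul,
    Prod.fst_sub, Prod.snd_sub]
  ring

lemma sq_add_sq_pos {a b : ℝ × ℝ} (h : a ≠ b) : 0 < (b.1 - a.1) ^ 2 + (b.2 - a.2) ^ 2 := by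
  by_contra hle
  refine h (Prod.ext ?_ ?_) <;> nlinarith [sq_nonneg (b.1 - a.1), sq_nonneg (b.2 - a.2)]

/-- A small shift along the normal vector moves `p` to the positive side. -/
lemma mem_closure_side_pos {a b p : ℝ × ℝ} (hab : a ≠ b) (hp : side a b p = 0) :
    p ∈ closure {q | 0 < side a b q} := by
  have h : Tendsto (fun t : ℝ ↦ p + t • ((-(b.2 - a.2), b.1 - a.1) : ℝ × ℝ)) (𝓝[>] 0) (𝓝 p) := by
    have : Continuous (fun t : ℝ ↦ p + t • ((-(b.2 - a.2), b.1 - a.1) : ℝ × ℝ)) := by fun_prop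
    have := this.tendsto 0
    rw [zero_smul, add_zero] at this
    exact this.mono_left nhdsWithin_le_nhds
  refine mem_closure_of_tendsto h ?_
  filter_upwards [self_mem_nhdsWithin] with t ht
  rw [side_add_smul, hp, zero_add]
  exact mul_pos ht (sq_add_sq_pos hab)

lemma convex_side_pos (a b : ℝ × ℝ) : Convex ℝ {q | 0 < side a b q} := by
  intro p hp q hq s t hs ht hst
  simp only [Set.mem_ofPred_eq, side] at *
  have h : side a b (s • p + t • q) = s * side a b p + t * side a b q := by
    simp only [side, Prod.fst_add, Prod.snd_add, Prod.smul_fst, Prod.smul_snd, smul_eq_mul]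
    linear_combination ((b.1 - a.1) * a.2 - (b.2 - a.2) * a.1) * hst
  change 0 < side a b (s • p + t • q)
  rw [h]
  change 0 < side a b p at hp
  change 0 < side a b q at hq
  rcases hs.eq_or_lt with rfl | hs
  · rw [zero_add] at hst
    rw [hst]
    linarith
  · have := mul_pos hs hp
    have := mul_nonneg ht hq.le
    linarith

open Classical in
/-- Whether the horizontal ray from `q` to the right crosses the segment from `a` to `b`, with the
upper end of the segment left out. -/
noncomputable def rayCross (a b q : ℝ × ℝ) : ZMod 2 :=
  if (a.2 ≤ q.2 ∧ q.2 < b.2 ∧ 0 < side a b q) ∨ (b.2 ≤ q.2 ∧ q.2 < a.2 ∧ side a b q < 0) then 1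
  else 0

lemma rayCross_swap (a b q : ℝ × ℝ) : rayCross b a q = rayCross a b q := by
  unfold rayCross
  congr 1
  rw [side_swap a b, neg_lt_zero, neg_pos, or_comm]

open Classical in
/-- Whether `a` lies on the open horizontal ray from `p` to the right. -/
noncomputable def onRay (a p : ℝ × ℝ) : ZMod 2 := if a.2 = p.2 ∧ p.1 < a.1 then 1 else 0

-- Only two things can change near `p`: the side of the line, if `p` lies on the open segment, and
-- the height condition at an end, if `p` has the height of that end. The latter matters only for an
-- end to the right of `p`.
open Classical in
lemma eventually_rayCross_of_lt {a b p : ℝ × ℝ} (hab : a.2 < b.2) (ha : p ≠ a) (hb : p ≠ b) :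
    ∃ c, ∀ᶠ q in 𝓝 p, side a b q ≠ 0 → rayCross a b q =
      c + (if p ∈ openSegment ℝ a b ∧ 0 < side a b q then 1 else 0) +
        (if q.2 < p.2 then onRay a p + onRay b p else 0) := by
  have hsnd : Continuous (fun q : ℝ × ℝ ↦ q.2) := continuous_snd
  have hopen : p ∈ openSegment ℝ a b → a.2 < p.2 ∧ p.2 < b.2 := by
    rw [openSegment_eq_image']
    rintro ⟨t, ⟨h0, h1⟩, rfl⟩
    simp only [Prod.snd_add, Prod.smul_snd, Prod.snd_sub, smul_eq_mul]
    constructor <;> nlinarith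
  rcases lt_trichotomy p.2 a.2 with h | h | h
  · refine ⟨0, ?_⟩
    filter_upwards [hsnd.continuousAt.eventually_lt continuousAt_const h] with q hq _
    have h1 : p ∉ openSegment ℝ a b := fun h' ↦ by linarith [(hopen h').1]
    have h2 : ¬ a.2 ≤ q.2 := not_le.2 hq
    have h3 : ¬ b.2 ≤ q.2 := by intro h; linarith
    simp [rayCross, onRay, h1, h2, h3, h.ne', (h.trans hab).ne']
  · have hpb : p.2 < b.2 := h ▸ hab
    have h1 : p ∉ openSegment ℝ a b := fun h' ↦ by linarith [(hopen h').1]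
    have hs : side a b p = (b.2 - a.2) * (a.1 - p.1) := by rw [side, h]; ring
    rcases lt_trichotomy p.1 a.1 with h' | h' | h'
    · refine ⟨1, ?_⟩
      have hs' : 0 < side a b p := hs ▸ mul_pos (by linarith) (by linarith)
      filter_upwards [hsnd.continuousAt.eventually_lt continuousAt_const hpb,
        continuousAt_const.eventually_lt (continuous_side a b).continuousAt hs'] with q hq hq' _
      have h2 : ¬ b.2 ≤ q.2 := not_le.2 hq
      rcases lt_or_ge q.2 p.2 with h3 | h3
      · have : ¬ a.2 ≤ q.2 := by rw [← h]; exact not_le.2 h3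
        have h3' : q.2 < a.2 := h ▸ h3
        simp [rayCross, onRay, h1, h2, h', h, h3', hab.ne', not_le.2 h3']
        decide
      · have h4 : a.2 ≤ q.2 := h ▸ h3
        have h5 := not_lt.2 h3
        simp [rayCross, h1, h4, hq, hq', h5]
    · exact absurd (Prod.ext h' h) ha
    · refine ⟨0, ?_⟩
      have hs' : side a b p < 0 := by rw [hs]; nlinarith
      filter_upwards [hsnd.continuousAt.eventually_lt continuousAt_const hpb,
        (continuous_side a b).continuousAt.eventually_lt continuousAt_const hs'] with q hq hq' _
      have h2 : ¬ b.2 ≤ q.2 := not_le.2 hq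
      simp [rayCross, onRay, h1, h2, not_lt.2 h'.le, not_lt.2 hq'.le, hpb.ne']
  rcases lt_trichotomy p.2 b.2 with h' | h' | h'
  · rcases lt_trichotomy (side a b p) 0 with hs | hs | hs
    · refine ⟨0, ?_⟩
      have h1 : p ∉ openSegment ℝ a b := fun h' ↦ hs.ne
        (side_eq_zero_of_mem_segment (openSegment_subset_segment ℝ a b h'))
      filter_upwards [continuousAt_const.eventually_lt hsnd.continuousAt h,
        (continuous_side a b).continuousAt.eventually_lt continuousAt_const hs] with q hq hq' _
      simp [rayCross, onRay, h1, not_lt.2 hq.le, not_lt.2 hq'.le, h'.ne', h.ne]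
    · refine ⟨0, ?_⟩
      have h1 : p ∈ openSegment ℝ a b := by
        have hba : b.2 - a.2 ≠ 0 := by linarith
        rw [openSegment_eq_image']
        refine ⟨(p.2 - a.2) / (b.2 - a.2), ⟨div_pos (by linarith) (by linarith),
          (div_lt_one (by linarith)).2 (by linarith)⟩, Prod.ext ?_ ?_⟩
        · simp only [Prod.fst_add, Prod.smul_fst, Prod.fst_sub, smul_eq_mul]
          rw [side] at hs
          field_simp
          linarith
        · simp only [Prod.snd_add, Prod.smul_snd, Prod.snd_sub, smul_eq_mul]
          field_simp
          ring
      filter_upwards [continuousAt_const.eventually_lt hsnd.continuousAt h,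
        hsnd.continuousAt.eventually_lt continuousAt_const h'] with q hq hq' _
      simp [rayCross, onRay, h1, hq.le, not_lt.2 hq.le, hq', h'.ne', h.ne]
    · refine ⟨1, ?_⟩
      have h1 : p ∉ openSegment ℝ a b := fun h' ↦ hs.ne'
        (side_eq_zero_of_mem_segment (openSegment_subset_segment ℝ a b h'))
      filter_upwards [continuousAt_const.eventually_lt hsnd.continuousAt h,
        hsnd.continuousAt.eventually_lt continuousAt_const h',
        continuousAt_const.eventually_lt (continuous_side a b).continuousAt hs] with q hq hq2 hq' _
      simp [rayCross, onRay, h1, hq.le, hq2, hq', h'.ne', h.ne]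
  · have h1 : p ∉ openSegment ℝ a b := fun h'' ↦ by linarith [(hopen h'').2]
    have hs : side a b p = (b.2 - a.2) * (b.1 - p.1) := by rw [side, h']; ring
    refine ⟨0, ?_⟩
    rcases lt_trichotomy p.1 b.1 with h2 | h2 | h2
    · have hs' : 0 < side a b p := hs ▸ mul_pos (by linarith) (by linarith)
      filter_upwards [continuousAt_const.eventually_lt hsnd.continuousAt h,
        continuousAt_const.eventually_lt (continuous_side a b).continuousAt hs'] with q hq hq' _
      simp [rayCross, onRay, h1, hq.le, not_lt.2 hq.le, hq', h', hab.ne, h2]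
    · exact absurd (Prod.ext h2 h') hb
    · have hs' : side a b p < 0 := by rw [hs]; nlinarith
      filter_upwards [continuousAt_const.eventually_lt hsnd.continuousAt h,
        (continuous_side a b).continuousAt.eventually_lt continuousAt_const hs'] with q hq hq' _
      simp [rayCross, onRay, h1, not_lt.2 hq.le, not_lt.2 hq'.le, h', hab.ne, not_lt.2 h2.le]
  · refine ⟨0, ?_⟩
    have h1 : p ∉ openSegment ℝ a b := fun h'' ↦ by linarith [(hopen h'').2]
    filter_upwards [continuousAt_const.eventually_lt hsnd.continuousAt h'] with q hq _
    simp [rayCross, onRay, h1, not_lt.2 hq.le, not_lt.2 (hab.trans hq).le, h.ne, h'.ne]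

-- A horizontal segment is never crossed, so the jumps on the right must cancel. Along the open
-- segment exactly one end lies on the ray and its jump offsets that of the side, up to a constant;
-- to the left of the segment both ends lie on the ray and cancel mod 2.
open Classical in
lemma rayCross_of_eq {a b p : ℝ × ℝ} (hne : a ≠ b) (hab : a.2 = b.2) (ha : p ≠ a) (hb : p ≠ b) :
    ∃ c, ∀ q, side a b q ≠ 0 → rayCross a b q =
      c + (if p ∈ openSegment ℝ a b ∧ 0 < side a b q then 1 else 0) +
        (if q.2 < p.2 then onRay a p + onRay b p else 0) := by
  have h0 : ∀ q, rayCross a b q = 0 := by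
    intro q
    rw [rayCross, if_neg]
    rintro (⟨h1, h2, -⟩ | ⟨h1, h2, -⟩) <;> linarith
  have hs : ∀ q, side a b q = (b.1 - a.1) * (q.2 - a.2) := fun q ↦ by rw [side, hab]; ring
  have hopen : p ∈ openSegment ℝ a b ↔
      p.2 = a.2 ∧ ((a.1 < p.1 ∧ p.1 < b.1) ∨ (b.1 < p.1 ∧ p.1 < a.1)) := by
    rw [openSegment_eq_image']
    constructor
    · rintro ⟨t, ⟨h0, h1⟩, rfl⟩
      simp only [Prod.snd_add, Prod.smul_snd, Prod.snd_sub, smul_eq_mul, hab, sub_self, mul_zero,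
        add_zero, Prod.fst_add, Prod.smul_fst, Prod.fst_sub, true_and]
      have h2 : a.1 ≠ b.1 := fun h ↦ hne (Prod.ext h hab)
      rcases h2.lt_or_gt with h2 | h2
      · left; constructor <;> nlinarith
      · right; constructor <;> nlinarith
    · rintro ⟨h1, h2⟩
      have hba : b.1 - a.1 ≠ 0 := by rcases h2 with h2 | h2 <;> intro h <;> linarith
      refine ⟨(p.1 - a.1) / (b.1 - a.1), ?_, Prod.ext ?_ ?_⟩
      · rcases h2 with h2 | h2
        · exact ⟨div_pos (by linarith) (by linarith), (div_lt_one (by linarith)).2 (by linarith)⟩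
        · exact ⟨div_pos_of_neg_of_neg (by linarith) (by linarith),
            (div_lt_one_of_neg (by linarith)).2 (by linarith)⟩
      · simp only [Prod.fst_add, Prod.smul_fst, Prod.fst_sub, smul_eq_mul]
        field_simp
        ring
      · simp [← hab, h1]
  simp only [h0, hs, hopen, onRay]
  by_cases hp : p.2 = a.2
  swap
  · exact ⟨0, fun q _ ↦ by simp [hp, ← hab, Ne.symm hp]⟩
  have hpa : p.1 ≠ a.1 := fun h ↦ ha (Prod.ext h hp)
  have hpb : p.1 ≠ b.1 := fun h ↦ hb (Prod.ext h (hp.trans hab))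
  rw [← hab, ← hp]
  rcases hpa.lt_or_gt with h1 | h1 <;> rcases hpb.lt_or_gt with h2 | h2
  · refine ⟨0, fun q _ ↦ ?_⟩
    simp only [h1, h2, not_lt.2 h1.le, not_lt.2 h2.le]
    split_ifs <;> simp_all
    decide
  · refine ⟨0, fun q hq ↦ ?_⟩
    have : 0 < (b.1 - a.1) * (q.2 - p.2) ↔ q.2 < p.2 := by
      constructor <;> intro h <;> nlinarith
    simp only [h1, h2, not_lt.2 h1.le, not_lt.2 h2.le, this]
    rcases lt_or_ge q.2 p.2 with h3 | h3
    · simp [h3]; decide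
    · simp [not_lt.2 h3]
  · refine ⟨1, fun q hq ↦ ?_⟩
    have : 0 < (b.1 - a.1) * (q.2 - p.2) ↔ p.2 < q.2 := by
      rw [mul_pos_iff_of_pos_left (by linarith), sub_pos]
    have h3 : q.2 ≠ p.2 := fun h ↦ hq (by rw [h]; ring)
    simp only [h1, h2, not_lt.2 h1.le, not_lt.2 h2.le, this]
    rcases h3.lt_or_gt with h3 | h3
    · simp [h3, not_lt.2 h3.le]; decide
    · simp [h3, not_lt.2 h3.le]; decide
  · refine ⟨0, fun q _ ↦ ?_⟩
    simp [not_lt.2 h1.le, not_lt.2 h2.le]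

open Classical in
/-- The jumps of the ray crossing indicator of a segment: it jumps across the segment and across
the horizontal rays to the left of its ends. -/
lemma eventually_rayCross {a b p : ℝ × ℝ} (hne : a ≠ b) (ha : p ≠ a) (hb : p ≠ b) :
    ∃ c, ∀ᶠ q in 𝓝 p, side a b q ≠ 0 → rayCross a b q =
      c + (if p ∈ openSegment ℝ a b ∧ 0 < side a b q then 1 else 0) +
        (if q.2 < p.2 then onRay a p + onRay b p else 0) := by
  rcases lt_trichotomy a.2 b.2 with h | h | h
  · exact eventually_rayCross_of_lt h ha hb
  · obtain ⟨c, hc⟩ := rayCross_of_eq hne h ha hb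
    exact ⟨c, Eventually.of_forall hc⟩
  · obtain ⟨c, hc⟩ := eventually_rayCross_of_lt h hb ha
    by_cases hp : p ∈ openSegment ℝ a b
    · refine ⟨c + 1, hc.mono fun q hq hs ↦ ?_⟩
      rw [rayCross_swap, openSegment_symm, side_swap, add_comm (onRay b p)] at hq
      rw [hq (by simpa using hs)]
      simp only [hp, true_and]
      have h2 : (2 : ZMod 2) = 0 := rfl
      rcases hs.lt_or_gt with h1 | h1
      · simp [h1, not_lt.2 h1.le]
      · simp only [Left.neg_pos_iff, not_lt.2 h1.le, h1, if_true, if_false]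
        linear_combination -h2
    · refine ⟨c, hc.mono fun q hq hs ↦ ?_⟩
      rw [rayCross_swap, openSegment_symm, side_swap, add_comm (onRay b p)] at hq
      rw [hq (by simpa using hs)]
      simp [hp]

end Plane

/-- A family of nondegenerate segments in the plane that meet only in common ends. -/
structure SegmentFamily (ι : Type*) where
  /-- The first end. -/
  a : ι → ℝ × ℝ
  /-- The second end. -/
  b : ι → ℝ × ℝ
  ne : ∀ i, a i ≠ b i
  inter : ∀ i j, i ≠ j → ∀ p ∈ segment ℝ (a i) (b i), p ∈ segment ℝ (a j) (b j) → p = a i ∨ p = b i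

/-! ### Duality between locally constant functions and even sets of segments -/

namespace SegmentFamily

variable {ι : Type*} (S : SegmentFamily ι)

/-- The union of the segments. -/
def support : Set (ℝ × ℝ) := ⋃ i, segment ℝ (S.a i) (S.b i)

/-- The points that lie on none of the lines spanned by the segments. -/
def generic : Set (ℝ × ℝ) := {q | ∀ i, side (S.a i) (S.b i) q ≠ 0}

/-- Functions that are locally constant on the complement of the segments. -/
def IsLocConst (g : ℝ × ℝ → ZMod 2) : Prop := ∀ p ∉ S.support, ∀ᶠ q in 𝓝 p, g q = g p

variable {S}

lemma mem_support {p : ℝ × ℝ} : p ∈ S.support ↔ ∃ i, p ∈ segment ℝ (S.a i) (S.b i) := by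
  simp [support]

lemma isClosed_segment (a b : ℝ × ℝ) : IsClosed (segment ℝ a b) := by
  rw [segment_eq_image']
  exact (isCompact_Icc.image (by fun_prop)).isClosed

/-- A finite intersection of dense open complements of lines. At generic points the jump formulas of
all segments apply at once. -/
lemma dense_generic [Finite ι] : Dense S.generic := by
  have h : S.generic = ⋂ i, {q | side (S.a i) (S.b i) q ≠ 0} := by
    ext q
    simp [generic]
  rw [h]
  refine dense_iInter_of_isOpen (fun i ↦ ?_) (fun i ↦ ?_)
  · exact isOpen_ne_fun (continuous_side _ _) continuous_const
  · intro p
    by_cases hp : side (S.a i) (S.b i) p = 0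
    · exact closure_mono (fun q hq ↦ ne_of_gt hq) (mem_closure_side_pos (S.ne i) hp)
    · exact subset_closure hp

lemma exists_generic [Finite ι] {p : ℝ × ℝ} {U V : Set (ℝ × ℝ)} (hU : U ∈ 𝓝 p) (hV : IsOpen V)
    (hp : p ∈ closure V) : ∃ q ∈ U, q ∈ V ∧ q ∈ S.generic := by
  obtain ⟨W, hWU, hW, hpW⟩ := mem_nhds_iff.1 hU
  obtain ⟨q, hq1, hq2⟩ := (dense_generic (S := S)).exists_mem_open (hW.inter hV)
    (mem_closure_iff.1 hp W hW hpW)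
  exact ⟨q, hWU hq2.1, hq2.2, hq1⟩

lemma notMem_segment_of_mem_openSegment {i j : ι} (hij : i ≠ j) {p : ℝ × ℝ}
    (hp : p ∈ openSegment ℝ (S.a i) (S.b i)) : p ∉ segment ℝ (S.a j) (S.b j) := by
  intro h
  rcases S.inter i j hij p (openSegment_subset_segment _ _ _ hp) h with rfl | rfl
  · exact S.ne i ((left_mem_openSegment_iff).1 hp)
  · exact S.ne i ((right_mem_openSegment_iff).1 hp)

/-- The other segments are closed and miss the interior point `p`, so near `p` only the segment `i`
is seen. -/
lemma exists_ball [Finite ι] {i : ι} {p : ℝ × ℝ} (hp : p ∈ openSegment ℝ (S.a i) (S.b i)) :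
    ∃ ε > 0, ∀ q ∈ Metric.ball p ε, side (S.a i) (S.b i) q ≠ 0 → q ∉ S.support := by
  have h : ∀ᶠ q in 𝓝 p, ∀ j, j ≠ i → q ∉ segment ℝ (S.a j) (S.b j) := by
    rw [eventually_all]
    intro j
    by_cases hij : j = i
    · simp [hij]
    · filter_upwards [(isClosed_segment (S.a j) (S.b j)).isOpen_compl.mem_nhds
        (notMem_segment_of_mem_openSegment (Ne.symm hij) hp)] with q hq _ using hq
  obtain ⟨ε, hε, h⟩ := Metric.eventually_nhds_iff_ball.1 h
  refine ⟨ε, hε, fun q hq hs hX ↦ ?_⟩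
  obtain ⟨j, hj⟩ := mem_support.1 hX
  by_cases hij : j = i
  · subst hij
    exact hs (side_eq_zero_of_mem_segment hj)
  · exact h q hq j hij hj

lemma convex_side_neg (a b : ℝ × ℝ) : Convex ℝ {q | side a b q < 0} := by
  have := convex_side_pos b a
  simpa only [side_swap a b, Left.neg_pos_iff] using this

lemma mem_closure_side_neg {a b p : ℝ × ℝ} (hab : a ≠ b) (hp : side a b p = 0) :
    p ∈ closure {q | side a b q < 0} := by
  have := mem_closure_side_pos hab.symm (p := p) (by rw [side_swap, hp, neg_zero])
  simpa only [side_swap a b, Left.neg_pos_iff] using this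

lemma IsLocConst.eq_of_isPreconnected {g : ℝ × ℝ → ZMod 2} (hg : S.IsLocConst g)
    {U : Set (ℝ × ℝ)} (hU : IsPreconnected U) (hS : ∀ p ∈ U, p ∉ S.support) {p q : ℝ × ℝ}
    (hp : p ∈ U) (hq : q ∈ U) : g p = g q := by
  obtain ⟨c, hc⟩ := exists_germ_of_isPreconnected hU (D := Set.univ) (by simp) g
    fun p hp ↦ ⟨g p, (hg p (hS p hp)).mono fun q hq _ ↦ hq⟩
  exact ((hc p hp).self_of_nhds trivial).trans ((hc q hq).self_of_nhds trivial).symm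

lemma exists_mem_openSegment (a b : ℝ × ℝ) : (openSegment ℝ a b).Nonempty :=
  ⟨_, 1 / 2, 1 / 2, by norm_num, by norm_num, by norm_num, rfl⟩

/-- Common part of the two sides: `V` is one of the open half planes bounded by the segment. -/
lemma exists_side_point [Finite ι] (i : ι) (V : Set (ℝ × ℝ)) (hVc : Convex ℝ V)
    (hV : ∀ q ∈ V, side (S.a i) (S.b i) q ≠ 0)
    (hcl : ∀ p, side (S.a i) (S.b i) p = 0 → p ∈ closure V) :
    ∃ P ∉ S.support, (∀ g, S.IsLocConst g → ∀ p ∈ openSegment ℝ (S.a i) (S.b i),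
      ∀ᶠ q in 𝓝 p, q ∈ V → g q = g P) := by
  have h1 : ∀ p ∈ openSegment ℝ (S.a i) (S.b i), ∃ ε > 0, IsPreconnected (Metric.ball p ε ∩ V) ∧
      (∀ q ∈ Metric.ball p ε ∩ V, q ∉ S.support) ∧ (Metric.ball p ε ∩ V).Nonempty := by
    intro p hp
    obtain ⟨ε, hε, h⟩ := exists_ball hp
    refine ⟨ε, hε, ((convex_ball p ε).inter hVc).isPreconnected,
      fun q hq ↦ h q hq.1 (hV q hq.2), ?_⟩
    exact mem_closure_iff.1 (hcl p (side_eq_zero_of_mem_segment (openSegment_subset_segment _ _ _ hp)))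
      _ Metric.isOpen_ball (Metric.mem_ball_self hε)
  obtain ⟨p₀, hp₀⟩ := exists_mem_openSegment (S.a i) (S.b i)
  obtain ⟨ε, hε, hpre, hsup, P, hP⟩ := h1 p₀ hp₀
  refine ⟨P, hsup P hP, fun g hg ↦ ?_⟩
  -- Near each point of the open segment `g` is constant on the `V` side, and the open segment is
  -- connected; one value therefore serves along all of it.
  obtain ⟨c, hc⟩ := exists_germ_of_isPreconnected (convex_openSegment (S.a i) (S.b i)).isPreconnected
    (fun p hp ↦ hcl p (side_eq_zero_of_mem_segment (openSegment_subset_segment _ _ _ hp))) g (by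
      intro p hp
      obtain ⟨δ, hδ, hpre, hsup, Q, hQ⟩ := h1 p hp
      refine ⟨g Q, ?_⟩
      filter_upwards [Metric.ball_mem_nhds p hδ] with q hq hqV
      exact hg.eq_of_isPreconnected hpre hsup ⟨hq, hqV⟩ hQ)
  have hcP : g P = c := by
    have h2 := hc p₀ hp₀
    have h3 := hcl p₀ (side_eq_zero_of_mem_segment (openSegment_subset_segment _ _ _ hp₀))
    obtain ⟨q, hqV, h4, h5⟩ := ((mem_closure_iff_frequently.1 h3).and_eventually
      (h2.and (Metric.ball_mem_nhds p₀ hε))).exists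
    rw [← h4 hqV]
    exact hg.eq_of_isPreconnected hpre hsup hP ⟨h5, hqV⟩
  rw [hcP]
  exact hc

lemma exists_posPoint [Finite ι] (S : SegmentFamily ι) (i : ι) : ∃ P ∉ S.support,
    (∀ g, S.IsLocConst g → ∀ p ∈ openSegment ℝ (S.a i) (S.b i),
      ∀ᶠ q in 𝓝 p, 0 < side (S.a i) (S.b i) q → g q = g P) :=
  exists_side_point i {q | 0 < side (S.a i) (S.b i) q}
    (convex_side_pos _ _) (fun _ hq ↦ ne_of_gt hq)
    (fun _ hp ↦ mem_closure_side_pos (S.ne i) hp)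

lemma exists_negPoint [Finite ι] (S : SegmentFamily ι) (i : ι) : ∃ P ∉ S.support,
    (∀ g, S.IsLocConst g → ∀ p ∈ openSegment ℝ (S.a i) (S.b i),
      ∀ᶠ q in 𝓝 p, side (S.a i) (S.b i) q < 0 → g q = g P) :=
  exists_side_point i {q | side (S.a i) (S.b i) q < 0}
    (convex_side_neg _ _) (fun _ hq ↦ ne_of_lt hq)
    (fun _ hp ↦ mem_closure_side_neg (S.ne i) hp)

/-- A point in the face on the positive side of the segment `i`. -/
noncomputable def posPoint [Finite ι] (S : SegmentFamily ι) (i : ι) : ℝ × ℝ :=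
  (S.exists_posPoint i).choose

/-- A point in the face on the negative side of the segment `i`. -/
noncomputable def negPoint [Finite ι] (S : SegmentFamily ι) (i : ι) : ℝ × ℝ :=
  (S.exists_negPoint i).choose

lemma posPoint_notMem [Finite ι] (i : ι) : S.posPoint i ∉ S.support :=
  (S.exists_posPoint i).choose_spec.1

lemma negPoint_notMem [Finite ι] (i : ι) : S.negPoint i ∉ S.support :=
  (S.exists_negPoint i).choose_spec.1

lemma IsLocConst.eventually_pos [Finite ι] {g : ℝ × ℝ → ZMod 2} (hg : S.IsLocConst g) {i : ι}
    {p : ℝ × ℝ} (hp : p ∈ openSegment ℝ (S.a i) (S.b i)) :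
    ∀ᶠ q in 𝓝 p, 0 < side (S.a i) (S.b i) q → g q = g (S.posPoint i) :=
  (S.exists_posPoint i).choose_spec.2 g hg p hp

lemma IsLocConst.eventually_neg [Finite ι] {g : ℝ × ℝ → ZMod 2} (hg : S.IsLocConst g) {i : ι}
    {p : ℝ × ℝ} (hp : p ∈ openSegment ℝ (S.a i) (S.b i)) :
    ∀ᶠ q in 𝓝 p, side (S.a i) (S.b i) q < 0 → g q = g (S.negPoint i) :=
  (S.exists_negPoint i).choose_spec.2 g hg p hp

/-- The jump of a locally constant function across the segment `i`. -/
noncomputable def jump [Finite ι] (S : SegmentFamily ι) (g : ℝ × ℝ → ZMod 2) (i : ι) : ZMod 2 :=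
  g (S.posPoint i) + g (S.negPoint i)

open Classical in
lemma IsLocConst.eventually_eq [Finite ι] {g : ℝ × ℝ → ZMod 2} (hg : S.IsLocConst g) {i : ι}
    {p : ℝ × ℝ} (hp : p ∈ openSegment ℝ (S.a i) (S.b i)) :
    ∀ᶠ q in 𝓝 p, q ∈ S.generic →
      g q = g (S.negPoint i) + if 0 < side (S.a i) (S.b i) q then S.jump g i else 0 := by
  filter_upwards [hg.eventually_pos hp, hg.eventually_neg hp] with q h1 h2 hq
  rcases (hq i).lt_or_gt with h | h
  · rw [h2 h, if_neg (not_lt.2 h.le), add_zero]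
  · rw [h1 h, if_pos h, jump, add_comm (g (S.posPoint i)), ← add_assoc, zmod_two_add_self, zero_add]

/-- `p` is an end of one of the segments. -/
def IsEnd (S : SegmentFamily ι) (p : ℝ × ℝ) : Prop := ∃ i, p = S.a i ∨ p = S.b i

lemma finite_isEnd [Finite ι] : {p | S.IsEnd p}.Finite := by
  have : {p | S.IsEnd p} = Set.range S.a ∪ Set.range S.b := by
    ext p
    constructor
    · rintro ⟨i, rfl | rfl⟩
      · exact Or.inl ⟨i, rfl⟩
      · exact Or.inr ⟨i, rfl⟩
    · rintro (⟨i, rfl⟩ | ⟨i, rfl⟩)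
      · exact ⟨i, Or.inl rfl⟩
      · exact ⟨i, Or.inr rfl⟩
  rw [this]
  exact (Set.finite_range _).union (Set.finite_range _)

lemma notMem_support_or_mem_openSegment {p : ℝ × ℝ} (hp : ¬ S.IsEnd p) :
    p ∉ S.support ∨ ∃ i, p ∈ openSegment ℝ (S.a i) (S.b i) := by
  rw [or_iff_not_imp_left, not_not, mem_support]
  rintro ⟨i, hi⟩
  refine ⟨i, ?_⟩
  rw [← insert_endpoints_openSegment] at hi
  rcases hi with rfl | rfl | hi
  · exact absurd ⟨i, Or.inl rfl⟩ hp
  · exact absurd ⟨i, Or.inr rfl⟩ hp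
  · exact hi

/-- A locally constant function without jumps is constant. -/
lemma IsLocConst.eq_of_jump_eq_zero [Finite ι] {g : ℝ × ℝ → ZMod 2} (hg : S.IsLocConst g)
    (h : ∀ i, S.jump g i = 0) {p q : ℝ × ℝ} (hp : p ∉ S.support) (hq : q ∉ S.support) :
    g p = g q := by
  -- Removing finitely many points does not disconnect the plane, and without jumps `g` has a
  -- constant generic germ at every point that is not an end.
  have hU : IsPreconnected {p | S.IsEnd p}ᶜ := by
    refine ((S.finite_isEnd).countable.isPathConnected_compl_of_one_lt_rank ?_).isConnected.isPreconnected
    rw [rank_prod', Module.rank_self]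
    norm_num
  obtain ⟨c, hc⟩ := exists_germ_of_isPreconnected hU (D := S.generic)
    (by rw [dense_generic.closure_eq]; exact Set.subset_univ _) g (by
      intro p hp
      rcases notMem_support_or_mem_openSegment hp with hp | ⟨i, hi⟩
      · exact ⟨g p, (hg p hp).mono fun q hq _ ↦ hq⟩
      · refine ⟨g (S.negPoint i), (hg.eventually_eq hi).mono fun q hq hqD ↦ ?_⟩
        rw [hq hqD, h i, ite_self, add_zero])
  have key : ∀ p ∉ S.support, g p = c := by
    intro p hp
    have hp' : ¬ S.IsEnd p := by
      rintro ⟨i, rfl | rfl⟩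
      · exact hp (mem_support.2 ⟨i, left_mem_segment _ _ _⟩)
      · exact hp (mem_support.2 ⟨i, right_mem_segment _ _ _⟩)
    obtain ⟨q, ⟨h1, h2⟩, -, hq⟩ := exists_generic (S := S) ((hc p hp').and (hg p hp)) isOpen_univ
      (by simp)
    rw [← h2, h1 hq]
  rw [key p hp, key q hq]

variable [Fintype ι]

/-- The number of crossings, weighted by `J`, of the horizontal ray from `q` to the right. -/
noncomputable def crossings (S : SegmentFamily ι) (J : ι → ZMod 2) (q : ℝ × ℝ) : ZMod 2 :=
  ∑ i, J i * rayCross (S.a i) (S.b i) q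

/-- The number of segment ends, weighted by `J`, on the horizontal ray from `p` to the right. -/
noncomputable def endsOnRay (S : SegmentFamily ι) (J : ι → ZMod 2) (p : ℝ × ℝ) : ZMod 2 :=
  ∑ i, J i * (onRay (S.a i) p + onRay (S.b i) p)

open Classical in
lemma eventually_crossings (J : ι → ZMod 2) {p : ℝ × ℝ} (hp : ¬ S.IsEnd p) :
    ∃ c, ∀ᶠ q in 𝓝 p, q ∈ S.generic → S.crossings J q =
      c + (∑ i, if p ∈ openSegment ℝ (S.a i) (S.b i) ∧ 0 < side (S.a i) (S.b i) q then J i else 0) +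
        (if q.2 < p.2 then S.endsOnRay J p else 0) := by
  choose c hc using fun i ↦ eventually_rayCross (S.ne i) (p := p) (fun h ↦ hp ⟨i, Or.inl h⟩)
    (fun h ↦ hp ⟨i, Or.inr h⟩)
  refine ⟨∑ i, J i * c i, ?_⟩
  filter_upwards [eventually_all.2 hc] with q hq hqD
  rw [crossings, endsOnRay, ← Finset.sum_add_distrib]
  have : (if q.2 < p.2 then ∑ i, J i * (onRay (S.a i) p + onRay (S.b i) p) else 0) =
      ∑ i, J i * (if q.2 < p.2 then onRay (S.a i) p + onRay (S.b i) p else 0) := by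
    split_ifs <;> simp
  rw [this, ← Finset.sum_add_distrib]
  refine Finset.sum_congr rfl fun i _ ↦ ?_
  rw [hq i (hqD i), mul_add, mul_add, mul_ite, mul_one, mul_zero]

open Classical in
lemma eventually_crossings_of_notMem (J : ι → ZMod 2) {p : ℝ × ℝ} (hp : p ∉ S.support) :
    ∃ c, ∀ᶠ q in 𝓝 p, q ∈ S.generic →
      S.crossings J q = c + if q.2 < p.2 then S.endsOnRay J p else 0 := by
  have hp' : ¬ S.IsEnd p := by
    rintro ⟨i, rfl | rfl⟩
    · exact hp (mem_support.2 ⟨i, left_mem_segment _ _ _⟩)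
    · exact hp (mem_support.2 ⟨i, right_mem_segment _ _ _⟩)
  obtain ⟨c, hc⟩ := eventually_crossings J hp'
  refine ⟨c, hc.mono fun q hq hqD ↦ ?_⟩
  rw [hq hqD, Finset.sum_eq_zero, add_zero]
  intro i _
  rw [if_neg]
  exact fun h ↦ hp (mem_support.2 ⟨i, openSegment_subset_segment _ _ _ h.1⟩)

open Classical in
lemma eventually_crossings_of_mem (J : ι → ZMod 2) {p : ℝ × ℝ} {i : ι}
    (hp : p ∈ openSegment ℝ (S.a i) (S.b i)) :
    ∃ c, ∀ᶠ q in 𝓝 p, q ∈ S.generic → S.crossings J q =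
      c + (if 0 < side (S.a i) (S.b i) q then J i else 0) +
        if q.2 < p.2 then S.endsOnRay J p else 0 := by
  have hp' : ¬ S.IsEnd p := by
    rintro ⟨j, h⟩
    have hj : p ∈ segment ℝ (S.a j) (S.b j) := by
      rcases h with rfl | rfl
      · exact left_mem_segment _ _ _
      · exact right_mem_segment _ _ _
    by_cases hij : i = j
    · subst hij
      rcases h with rfl | rfl
      · exact S.ne i ((left_mem_openSegment_iff).1 hp)
      · exact S.ne i ((right_mem_openSegment_iff).1 hp)
    · exact notMem_segment_of_mem_openSegment hij hp hj
  obtain ⟨c, hc⟩ := eventually_crossings J hp'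
  refine ⟨c, hc.mono fun q hq hqD ↦ ?_⟩
  rw [hq hqD, Finset.sum_eq_single i]
  · simp [hp]
  · intro j _ hji
    rw [if_neg]
    exact fun h ↦ notMem_segment_of_mem_openSegment (Ne.symm hji) hp
      (openSegment_subset_segment _ _ _ h.1)
  · simp

open Classical in
/-- The sum of `J` over the segments with end `x`. -/
noncomputable def endSum (S : SegmentFamily ι) (J : ι → ZMod 2) (x : ℝ × ℝ) : ZMod 2 :=
  ∑ i, J i * ((if S.a i = x then 1 else 0) + if S.b i = x then 1 else 0)

/-- Grouped by their position, the ends at `y` enter with total weight `endSum J y`. -/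
lemma endsOnRay_eq_zero {J : ι → ZMod 2} (hJ : ∀ x, S.endSum J x = 0) (p : ℝ × ℝ) :
    S.endsOnRay J p = 0 := by
  classical
  have h : ∀ x : ℝ × ℝ, S.IsEnd x →
      onRay x p = ∑ y ∈ S.finite_isEnd.toFinset, (if x = y then 1 else 0) * onRay y p := by
    intro x hx
    rw [Finset.sum_eq_single x]
    · simp
    · intro y _ hy
      rw [if_neg hy.symm, zero_mul]
    · intro h
      exact absurd (by simpa using hx) h
  have h' : S.endsOnRay J p = ∑ y ∈ S.finite_isEnd.toFinset, S.endSum J y * onRay y p := by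
    rw [endsOnRay]
    simp only [endSum, Finset.sum_mul]
    rw [Finset.sum_comm]
    refine Finset.sum_congr rfl fun i _ ↦ ?_
    rw [h _ ⟨i, Or.inl rfl⟩, h _ ⟨i, Or.inr rfl⟩, ← Finset.sum_add_distrib, Finset.mul_sum]
    refine Finset.sum_congr rfl fun y _ ↦ ?_
    ring
  rw [h']
  exact Finset.sum_eq_zero fun y _ ↦ by rw [hJ, zero_mul]

/-- Every even set of segments is the set of jumps of a locally constant function. -/
lemma exists_isLocConst_jump_eq {J : ι → ZMod 2} (hJ : ∀ x, S.endSum J x = 0) :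
    ∃ g, S.IsLocConst g ∧ ∀ i, S.jump g i = J i := by
  classical
  -- The jump formulas control `crossings` only at generic points, so `g` takes the value of its
  -- germ along these. Since `endsOnRay` vanishes, that germ is constant off the segments, and the
  -- default `0` is harmless.
  let g : ℝ × ℝ → ZMod 2 := fun q ↦
    if ∀ᶠ q' in 𝓝 q, q' ∈ S.generic → S.crossings J q' = 1 then 1 else 0
  have hg : ∀ q c, (∀ᶠ q' in 𝓝 q, q' ∈ S.generic → S.crossings J q' = c) → g q = c := by
    intro q c hc
    rcases zmod_two_eq c with rfl | rfl
    · refine if_neg fun h1 ↦ ?_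
      obtain ⟨q', ⟨h2, h3⟩, -, hq'⟩ := exists_generic (S := S) (hc.and h1) isOpen_univ (by simp)
      have := (h2 hq').symm.trans (h3 hq')
      exact absurd this (by decide)
    · exact if_pos hc
  have hloc : S.IsLocConst g := by
    intro p hp
    obtain ⟨c, hc⟩ := eventually_crossings_of_notMem J hp
    simp only [endsOnRay_eq_zero hJ, ite_self, add_zero] at hc
    filter_upwards [eventually_eventually_nhds.2 hc] with q hq
    rw [hg p c hc, hg q c hq]
  refine ⟨g, hloc, fun i ↦ ?_⟩
  obtain ⟨p, hp⟩ := exists_mem_openSegment (S.a i) (S.b i)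
  have hs := side_eq_zero_of_mem_segment (openSegment_subset_segment _ _ _ hp)
  obtain ⟨c, hc⟩ := eventually_crossings_of_mem J hp
  simp only [endsOnRay_eq_zero hJ, ite_self, add_zero] at hc
  have hc' := eventually_eventually_nhds.2 hc
  have ho1 : IsOpen {q | 0 < side (S.a i) (S.b i) q} :=
    isOpen_lt continuous_const (continuous_side _ _)
  have ho2 : IsOpen {q | side (S.a i) (S.b i) q < 0} :=
    isOpen_lt (continuous_side _ _) continuous_const
  obtain ⟨q, ⟨h1, h2⟩, h3, -⟩ := exists_generic (S := S) (hc'.and (hloc.eventually_pos hp)) ho1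
    (mem_closure_side_pos (S.ne i) hs)
  obtain ⟨r, ⟨h4, h5⟩, h6, -⟩ := exists_generic (S := S) (hc'.and (hloc.eventually_neg hp)) ho2
    (mem_closure_side_neg (S.ne i) hs)
  have e1 : g q = c + J i := by
    refine hg q _ ?_
    filter_upwards [h1, ho1.mem_nhds h3] with q' hq' h hD
    rw [hq' hD, if_pos h]
  have e2 : g r = c := by
    refine hg r _ ?_
    filter_upwards [h4, ho2.mem_nhds h6] with q' hq' h hD
    rw [hq' hD, if_neg (not_lt.2 (le_of_lt h)), add_zero]
  rw [jump, ← h2 h3, ← h5 h6, e1, e2, add_right_comm, zmod_two_add_self, zero_add]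

/-- The jumps of a locally constant function form an even set of segments. -/
lemma IsLocConst.endSum_jump {g : ℝ × ℝ → ZMod 2} (hg : S.IsLocConst g) (x : ℝ × ℝ) :
    S.endSum (S.jump g) x = 0 := by
  classical
  set N := S.endsOnRay (S.jump g) with hN
  -- In `h` the jumps across the segments cancel. What remains are jumps by `N p` across horizontal
  -- lines, caused by ends to the right of `p`.
  let h : ℝ × ℝ → ZMod 2 := fun q ↦ g q + S.crossings (S.jump g) q
  have hgerm : ∀ p, ¬ S.IsEnd p → ∃ c, ∀ᶠ q in 𝓝 p, q ∈ S.generic →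
      h q = c + if q.2 < p.2 then N p else 0 := by
    intro p hp
    rcases notMem_support_or_mem_openSegment hp with hp | ⟨i, hi⟩
    · obtain ⟨c, hc⟩ := eventually_crossings_of_notMem (S.jump g) hp
      refine ⟨g p + c, ?_⟩
      filter_upwards [hc, hg p hp] with q h1 h2 hD
      simp only [h]
      rw [h1 hD, h2, add_assoc]
    · obtain ⟨c, hc⟩ := eventually_crossings_of_mem (S.jump g) hi
      refine ⟨g (S.negPoint i) + c, ?_⟩
      filter_upwards [hc, hg.eventually_eq hi] with q h1 h2 hD
      simp only [h]
      rw [h1 hD, h2 hD]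
      have h3 := zmod_two_add_self (if 0 < side (S.a i) (S.b i) q then S.jump g i else 0)
      linear_combination h3
  -- a strip around the height of `x` that contains no ends at other heights
  obtain ⟨ε, hε, hstrip⟩ : ∃ ε > 0, ∀ p, S.IsEnd p → p.2 ≠ x.2 → ε ≤ |p.2 - x.2| := by
    have hf : ((fun p : ℝ × ℝ ↦ |p.2 - x.2|) '' {p | S.IsEnd p ∧ p.2 ≠ x.2}).Finite :=
      (S.finite_isEnd.subset fun p hp ↦ hp.1).image _
    rcases Set.eq_empty_or_nonempty
      ((fun p : ℝ × ℝ ↦ |p.2 - x.2|) '' {p | S.IsEnd p ∧ p.2 ≠ x.2}) with he | hne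
    · refine ⟨1, one_pos, fun p hp hp' ↦ ?_⟩
      have : |p.2 - x.2| ∈ ((fun p : ℝ × ℝ ↦ |p.2 - x.2|) '' {p | S.IsEnd p ∧ p.2 ≠ x.2}) :=
        ⟨p, ⟨hp, hp'⟩, rfl⟩
      rw [he] at this
      exact absurd this (Set.notMem_empty _)
    · obtain ⟨m, ⟨p, hp, rfl⟩, hm⟩ := Set.exists_min_image _ id hf hne
      exact ⟨|p.2 - x.2|, abs_pos.2 (sub_ne_zero.2 hp.2), fun p' h1 h2 ↦
        hm _ ⟨p', ⟨h1, h2⟩, rfl⟩⟩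
  -- Strictly above or below the height of `x` inside the strip there are no ends, hence no jumps of
  -- `h`.
  have hhalf : ∀ U : Set (ℝ × ℝ), Convex ℝ U → (∀ p ∈ U, p.2 ≠ x.2 ∧ |p.2 - x.2| < ε) →
      ∃ c, ∀ p ∈ U, p ∈ S.generic → h p = c := by
    intro U hU hU'
    obtain ⟨c, hc⟩ := exists_germ_of_isPreconnected hU.isPreconnected (D := S.generic)
      (by rw [dense_generic.closure_eq]; exact Set.subset_univ _) h (by
        intro p hp
        have hp' : ∀ y, S.IsEnd y → y.2 ≠ p.2 := by
          intro y hy hyp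
          have := hstrip y hy (hyp ▸ (hU' p hp).1)
          rw [hyp] at this
          exact absurd (hU' p hp).2 (not_lt.2 this)
        obtain ⟨c, hc⟩ := hgerm p fun h ↦ hp' p h rfl
        have hNp : N p = 0 := Finset.sum_eq_zero fun i _ ↦ by
          rw [onRay, onRay, if_neg fun h ↦ hp' _ ⟨i, Or.inl rfl⟩ h.1,
            if_neg fun h ↦ hp' _ ⟨i, Or.inr rfl⟩ h.1, add_zero, mul_zero]
        simp only [hNp, ite_self, add_zero] at hc
        exact ⟨c, hc⟩)
    exact ⟨c, fun p hp hD ↦ (hc p hp).self_of_nhds hD⟩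
  obtain ⟨c₁, hc₁⟩ := hhalf {q | q.2 ∈ Set.Ioo x.2 (x.2 + ε)}
    ((convex_Ioo _ _).linear_preimage (LinearMap.snd ℝ ℝ ℝ)) (by
      rintro p ⟨h1, h2⟩
      exact ⟨h1.ne', by rw [abs_of_pos (by linarith)]; linarith⟩)
  obtain ⟨c₂, hc₂⟩ := hhalf {q | q.2 ∈ Set.Ioo (x.2 - ε) x.2}
    ((convex_Ioo _ _).linear_preimage (LinearMap.snd ℝ ℝ ℝ)) (by
      rintro p ⟨h1, h2⟩
      exact ⟨h2.ne, by rw [abs_of_neg (by linarith)]; linarith⟩)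
  have ho : ∀ s t : ℝ, IsOpen {q : ℝ × ℝ | q.2 ∈ Set.Ioo s t} := fun s t ↦
    isOpen_Ioo.preimage continuous_snd
  have hclo : ∀ p : ℝ × ℝ, ∀ t, t ≠ p.2 → p ∈ closure ({p.1} ×ˢ Set.uIoo p.2 t) := by
    intro p t ht
    rw [closure_prod_eq, closure_uIoo ht.symm]
    exact ⟨subset_closure rfl, Set.left_mem_uIcc⟩
  -- `N p` is the difference between the values of `h` just above and just below, so it is the same
  -- at all non-ends at the height of `x`.
  have hNconst : ∀ p, p.2 = x.2 → ¬ S.IsEnd p → N p = c₁ + c₂ := by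
    intro p hp hpe
    obtain ⟨c, hc⟩ := hgerm p hpe
    obtain ⟨q, h1, h2, h3⟩ := exists_generic (S := S) hc (ho x.2 (x.2 + ε)) (by
      refine closure_mono ?_ (hclo p (x.2 + ε) (by linarith))
      rintro q ⟨-, h⟩
      rwa [hp, Set.uIoo_of_lt (by linarith)] at h)
    obtain ⟨r, h4, h5, h6⟩ := exists_generic (S := S) hc (ho (x.2 - ε) x.2) (by
      refine closure_mono ?_ (hclo p (x.2 - ε) (by linarith))
      rintro q ⟨-, h⟩
      rwa [hp, Set.uIoo_of_gt (by linarith)] at h)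
    have e1 := h1 h3
    have e2 := h4 h6
    rw [hc₁ q h2 h3, if_neg (by rw [hp]; exact not_lt.2 (le_of_lt h2.1)), add_zero] at e1
    rw [hc₂ r h5 h6, if_pos (by rw [hp]; exact h5.2)] at e2
    rw [e1, e2, ← add_assoc, zmod_two_add_self, zero_add]
  -- To the right of all ends the ray contains none of them.
  have hNzero : c₁ + c₂ = 0 := by
    obtain ⟨M, hM⟩ := (S.finite_isEnd.image (fun p ↦ p.1)).bddAbove
    have hM' : ∀ y, S.IsEnd y → y.1 < M + 1 := fun y hy ↦ by
      have := hM ⟨y, hy, rfl⟩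
      simp only at this
      linarith
    rw [← hNconst (M + 1, x.2) rfl fun h ↦ (hM' _ h).ne rfl]
    refine Finset.sum_eq_zero fun i _ ↦ ?_
    rw [onRay, onRay, if_neg fun h ↦ lt_asymm h.2 (hM' _ ⟨i, Or.inl rfl⟩),
      if_neg fun h ↦ lt_asymm h.2 (hM' _ ⟨i, Or.inr rfl⟩), add_zero, mul_zero]
  rw [hNzero] at hNconst
  obtain ⟨η, hη, hnear⟩ : ∃ η > 0, ∀ y, S.IsEnd y → y.2 = x.2 → |y.1 - x.1| ≤ η → y = x := by
    have hf := S.finite_isEnd.subset (Set.inter_subset_left : {p | S.IsEnd p} ∩ {x}ᶜ ⊆ _)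
    obtain ⟨δ, hδ, hb⟩ := Metric.mem_nhds_iff.1 (hf.isClosed.isOpen_compl.mem_nhds
      (show x ∈ ({p | S.IsEnd p} ∩ {x}ᶜ)ᶜ from fun h ↦ h.2 rfl))
    refine ⟨δ / 2, by linarith, fun y hy h2 h1 ↦ ?_⟩
    by_contra hne
    refine hb (a := y) ?_ ⟨hy, hne⟩
    rw [Metric.mem_ball, Prod.dist_eq, h2, dist_self, Real.dist_eq]
    exact max_lt (by linarith) hδ
  have hl := hNconst (x.1 - η, x.2) rfl fun h ↦ by
    have := hnear _ h rfl (by simp [abs_of_pos hη])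
    have := congr_arg Prod.fst this
    simp only at this
    linarith
  have hr := hNconst (x.1 + η, x.2) rfl fun h ↦ by
    have := hnear _ h rfl (by simp [abs_of_pos hη])
    have := congr_arg Prod.fst this
    simp only at this
    linarith
  -- The rays that start at distance `η` to the left and to the right of `x` differ, among the ends,
  -- only in `x`. The weights on both rays vanish, so the weight at `x` does.
  have hray : ∀ y, S.IsEnd y →
      (if y = x then 1 else 0) = onRay y (x.1 - η, x.2) + onRay y (x.1 + η, x.2) := by
    intro y hy
    simp only [onRay]
    by_cases h2 : y.2 = x.2
    · by_cases hyx : y = x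
      · subst hyx
        simp [hη, hη.le]
      · have : ¬ |y.1 - x.1| ≤ η := fun h ↦ hyx (hnear y hy h2 h)
        rw [abs_le, not_and_or, not_le, not_le] at this
        rcases this with h | h
        · rw [if_neg hyx, if_neg (fun h' ↦ by linarith [h'.2]), if_neg (fun h' ↦ by linarith [h'.2]),
            add_zero]
        · rw [if_neg hyx, if_pos ⟨h2, by linarith⟩, if_pos ⟨h2, by linarith⟩]
          rfl
    · simp [h2, show y ≠ x from fun h ↦ h2 (by rw [h])]
  have := congr_arg₂ (· + ·) hl hr
  simp only [hN, endsOnRay, ← Finset.sum_add_distrib, add_zero] at this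
  rw [← this, endSum]
  refine Finset.sum_congr rfl fun i _ ↦ ?_
  rw [hray _ ⟨i, Or.inl rfl⟩, hray _ ⟨i, Or.inr rfl⟩]
  ring

end SegmentFamily

/-! ### Simple polygonal chains -/

section Chain

variable {k : ℕ} {p : ℕ → ℝ × ℝ}

/-- The conditions on a simple polygonal chain. -/
structure IsSimpleChain (k : ℕ) (p : ℕ → ℝ × ℝ) : Prop where
  ne : ∀ i < k, p i ≠ p (i + 1)
  inter_succ : ∀ i, i + 1 < k →
    segment ℝ (p i) (p (i + 1)) ∩ segment ℝ (p (i + 1)) (p (i + 2)) = {p (i + 1)}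
  disjoint : ∀ i j, i + 1 < j → j < k →
    Disjoint (segment ℝ (p i) (p (i + 1))) (segment ℝ (p j) (p (j + 1)))

lemma IsSimpleChain.eq_succ (h : IsSimpleChain k p) {i j : ℕ} (hij : i < j) (hj : j < k)
    {q : ℝ × ℝ} (hi : q ∈ segment ℝ (p i) (p (i + 1))) (hj' : q ∈ segment ℝ (p j) (p (j + 1))) :
    j = i + 1 ∧ q = p (i + 1) := by
  rcases (Nat.succ_le_of_lt hij).eq_or_lt with rfl | hlt
  · exact ⟨rfl, (h.inter_succ i hj).subset ⟨hi, hj'⟩⟩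
  · exact absurd hj' (Set.disjoint_left.1 (h.disjoint i j hlt hj) hi)

lemma IsSimpleChain.start (h : IsSimpleChain k p) {i : ℕ} (hi : i < k)
    (hp : p 0 ∈ segment ℝ (p i) (p (i + 1))) : i = 0 := by
  by_contra hne
  exact h.ne 0 (by omega) (h.eq_succ (Nat.pos_of_ne_zero hne) hi (left_mem_segment _ _ _) hp).2

lemma IsSimpleChain.finish (h : IsSimpleChain k p) {i : ℕ} (hi : i < k)
    (hp : p k ∈ segment ℝ (p i) (p (i + 1))) : i + 1 = k := by
  by_contra hne
  obtain ⟨m, rfl⟩ : ∃ m, k = m + 1 := ⟨k - 1, by omega⟩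
  obtain ⟨h1, h2⟩ := h.eq_succ (i := i) (j := m) (by omega) (by omega) hp (right_mem_segment _ _ _)
  subst h1
  exact h.ne (i + 1) (by omega) h2.symm

lemma IsSimpleChain.injective (h : IsSimpleChain k p) {i j : ℕ} (hij : i < j) (hj : j ≤ k) :
    p i ≠ p j := by
  obtain ⟨m, rfl⟩ : ∃ m, j = m + 1 := ⟨j - 1, by omega⟩
  intro he
  rcases (Nat.le_of_lt_succ hij).eq_or_lt with rfl | hlt
  · exact h.ne i (by omega) he
  · have h1 := h.eq_succ hlt (by omega) (left_mem_segment _ _ _) (he ▸ right_mem_segment _ _ _)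
    exact h.ne i (by omega) h1.2

/-- Inner points of a chain are counted twice and cancel mod 2; only the two ends survive. -/
lemma sum_telescope {M : Type*} [AddCommGroup M] [Module (ZMod 2) M] (f : ℕ → M) (k : ℕ) :
    ∑ i : Fin k, (f i + f (i + 1)) = f 0 + f k := by
  rw [Fin.sum_univ_eq_sum_range (fun i ↦ f i + f (i + 1))]
  induction k with
  | zero => simp [zmod_two_add_self]
  | succ k ih =>
    rw [Finset.sum_range_succ, ih, add_assoc, ← add_assoc (f k), zmod_two_add_self, zero_add]

end Chain

/-! ### Cycles of a drawn graph as jump sets -/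

section Drawing

variable {α β : Type*} {G : Graph α β}

/-- The union of the arcs of a drawing. -/
def PlaneDrawing.arcs (D : PlaneDrawing G) : Set (ℝ × ℝ) := ⋃ e ∈ E(G), D.arc e

/-- Functions that are locally constant away from the arcs of the drawing. -/
def PlaneDrawing.IsLocConst (D : PlaneDrawing G) (g : ℝ × ℝ → ZMod 2) : Prop :=
  ∀ p ∉ D.arcs, ∀ᶠ q in 𝓝 p, g q = g p

/-- `P` and `N` choose points in the faces on the two sides of every edge. -/
structure PlaneDrawing.IsSides (D : PlaneDrawing G) [Fintype E(G)] (P N : E(G) → ℝ × ℝ) : Prop where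
  notMem : ∀ e, P e ∉ D.arcs ∧ N e ∉ D.arcs
  sum_eq_zero : ∀ g, D.IsLocConst g → ∑ e, (g (P e) + g (N e)) • edgeVec G e = 0
  exists_eq : ∀ J : E(G) → ZMod 2, ∑ e, J e • edgeVec G e = 0 →
    ∃ g, D.IsLocConst g ∧ ∀ e, g (P e) + g (N e) = J e
  eq_of_zero : ∀ g, D.IsLocConst g → (∀ e, g (P e) + g (N e) = 0) →
    ∀ p ∉ D.arcs, ∀ q ∉ D.arcs, g p = g q
  mem_closure : ∀ e : E(G), ∃ m ∈ D.arc e, m ∉ D.pos '' V(G) ∧ ∀ g, D.IsLocConst g →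
    (g (P e) = 1 → m ∈ closure {q | g q = 1}) ∧ (g (N e) = 1 → m ∈ closure {q | g q = 1})

/-- The arcs are cut into their segments, so that the duality for segment families applies. At a
bend only two segments meet, so jumps are constant along an arc, and even sets of segments that are
constant on arcs correspond to even sets of edges. -/
lemma PlaneDrawing.exists_isSides (D : PlaneDrawing G) [Fintype E(G)] :
    ∃ P N, D.IsSides P N := by
  classical
  have hlink : ∀ e : E(G), ∃ x y, G.IsLink e x y := fun e ↦ G.exists_isLink_of_mem_edgeSet e.2
  choose x y hxy using hlink
  choose k p hk hp0 hpk harc hne hsucc hdis using fun e : E(G) ↦ D.isArc e _ _ (hxy e)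
  have hc : ∀ e, IsSimpleChain (k e) (p e) := fun e ↦ ⟨hne e, hsucc e, hdis e⟩
  have hsub : ∀ e i, i < k e → segment ℝ (p e i) (p e (i + 1)) ⊆ D.arc e := by
    intro e i hi
    rw [harc e]
    exact Set.subset_biUnion_of_mem (u := fun i ↦ segment ℝ (p e i) (p e (i + 1))) hi
  have hend : ∀ (e : E(G)) v, v ∈ V(G) → D.pos v ∈ D.arc e → D.pos v = p e 0 ∨ D.pos v = p e (k e) := by
    intro e v hv h
    rcases D.eq_end e _ _ v (hxy e) hv h with h | h
    · exact Or.inl (by rw [h, hp0])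
    · exact Or.inr (by rw [h, hpk])
  have hcross : ∀ e f : E(G), e ≠ f → ∀ q, q ∈ D.arc e → q ∈ D.arc f →
      q = p e 0 ∨ q = p e (k e) := by
    intro e f hef q h1 h2
    obtain ⟨v, hv, rfl⟩ := D.inter_subset e e.2 f f.2 (fun h ↦ hef (Subtype.ext h)) ⟨h1, h2⟩
    exact hend e v hv h1
  let S : SegmentFamily (Σ e : E(G), Fin (k e)) :=
    { a := fun s ↦ p s.1 s.2
      b := fun s ↦ p s.1 (s.2 + 1)
      ne := fun s ↦ hne s.1 s.2 s.2.2
      inter := by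
        rintro ⟨e, i⟩ ⟨f, j⟩ hij q hi hj
        simp only at hi hj ⊢
        by_cases hef : e = f
        · subst hef
          have : (i : ℕ) ≠ j := fun h ↦ hij (by rw [Fin.ext h])
          rcases this.lt_or_gt with h | h
          · exact Or.inr ((hc e).eq_succ h j.2 hi hj).2
          · obtain ⟨h1, h2⟩ := (hc e).eq_succ h i.2 hj hi
            exact Or.inl (by rw [h1, h2])
        · rcases hcross e f hef q (hsub e i i.2 hi) (hsub f j j.2 hj) with rfl | rfl
          · exact Or.inl (by rw [(hc e).start i.2 hi])
          · exact Or.inr (by rw [(hc e).finish i.2 hi]) }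
  have hS : S.support = D.arcs := by
    ext q
    rw [SegmentFamily.mem_support, PlaneDrawing.arcs]
    simp only [Set.mem_iUnion]
    constructor
    · rintro ⟨⟨e, i⟩, h⟩
      exact ⟨e, e.2, hsub e i i.2 h⟩
    · rintro ⟨e, he, h⟩
      rw [harc ⟨e, he⟩] at h
      simp only [Set.mem_iUnion] at h
      obtain ⟨i, hi, h⟩ := h
      exact ⟨⟨⟨e, he⟩, ⟨i, hi⟩⟩, h⟩
  have hLC : ∀ g, D.IsLocConst g ↔ S.IsLocConst g := fun g ↦ by
    rw [PlaneDrawing.IsLocConst, SegmentFamily.IsLocConst, hS]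
  have hend_sum : ∀ (J : E(G) → ZMod 2) q, S.endSum (fun s ↦ J s.1) q =
      ∑ e, J e * ((if D.pos (x e) = q then 1 else 0) + if D.pos (y e) = q then 1 else 0) := by
    intro J q
    rw [SegmentFamily.endSum, Fintype.sum_sigma]
    refine Finset.sum_congr rfl fun e _ ↦ ?_
    have h := sum_telescope (fun i ↦ if p e i = q then (1 : ZMod 2) else 0) (k e)
    rw [← hp0, ← hpk, ← h, Finset.mul_sum]
  have hvec : ∀ (J : E(G) → ZMod 2) v, (∑ e, J e • edgeVec G e) v =
      ∑ e, J e * ((if x e = v then 1 else 0) + if y e = v then 1 else 0) := by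
    intro J v
    rw [Finsupp.finsetSum_apply]
    refine Finset.sum_congr rfl fun e _ ↦ ?_
    rw [edgeVec_eq (hxy e), Finsupp.smul_apply, Finsupp.add_apply, Finsupp.single_apply,
      Finsupp.single_apply, smul_eq_mul]
  -- Bends cancel, so the parity condition only concerns the points of vertices, where it is the
  -- vanishing of a coordinate of the sum of columns.
  have heven : ∀ J : E(G) → ZMod 2,
      (∑ e, J e • edgeVec G e = 0) ↔ ∀ q, S.endSum (fun s ↦ J s.1) q = 0 := by
    intro J
    have hpos : ∀ v ∈ V(G), S.endSum (fun s ↦ J s.1) (D.pos v) = (∑ e, J e • edgeVec G e) v := by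
      intro v hv
      rw [hend_sum, hvec]
      refine Finset.sum_congr rfl fun e _ ↦ ?_
      simp only [D.pos_injOn.eq_iff (hxy e).left_mem hv, D.pos_injOn.eq_iff (hxy e).right_mem hv]
    constructor
    · intro h q
      by_cases hq : q ∈ D.pos '' V(G)
      · obtain ⟨v, hv, rfl⟩ := hq
        rw [hpos v hv, h, Finsupp.zero_apply]
      · rw [hend_sum]
        refine Finset.sum_eq_zero fun e _ ↦ ?_
        rw [if_neg fun h ↦ hq ⟨_, (hxy e).left_mem, h⟩,
          if_neg fun h ↦ hq ⟨_, (hxy e).right_mem, h⟩, add_zero, mul_zero]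
    · intro h
      ext v
      by_cases hv : v ∈ V(G)
      · rw [← hpos v hv, h, Finsupp.zero_apply]
      · rw [hvec, Finsupp.zero_apply]
        refine Finset.sum_eq_zero fun e _ ↦ ?_
        have h1 : x e ≠ v := fun h ↦ hv (h ▸ (hxy e).left_mem)
        have h2 : y e ≠ v := fun h ↦ hv (h ▸ (hxy e).right_mem)
        rw [if_neg h1, if_neg h2, add_zero, mul_zero]
  -- The parity condition at the bend `p e (i + 1)` involves only the segments `i` and `i + 1` of
  -- the arc, which therefore have equal jumps.
  have hjump : ∀ g, S.IsLocConst g → ∀ e (i : Fin (k e)),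
      S.jump g ⟨e, i⟩ = S.jump g ⟨e, ⟨0, hk e⟩⟩ := by
    rintro g hg e ⟨i, hi⟩
    induction i with
    | zero => rfl
    | succ i ih =>
      rw [← ih (by omega)]
      have h1 := hg.endSum_jump (p e (i + 1))
      rw [SegmentFamily.endSum, Fintype.sum_sigma, Finset.sum_eq_single e] at h1
      · have h2 : ∀ j : Fin (k e), (if S.a ⟨e, j⟩ = p e (i + 1) then (1 : ZMod 2) else 0) =
            if j = ⟨i + 1, hi⟩ then 1 else 0 := by
          intro j
          congr 1
          rw [Fin.ext_iff, eq_iff_iff]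
          constructor
          · intro h
            by_contra hne
            rcases lt_or_gt_of_ne hne with hlt | hlt
            · exact (hc e).injective hlt hi.le h
            · exact (hc e).injective hlt j.2.le h.symm
          · intro h
            simp only [S, h]
        have h3 : ∀ j : Fin (k e), (if S.b ⟨e, j⟩ = p e (i + 1) then (1 : ZMod 2) else 0) =
            if j = ⟨i, by omega⟩ then 1 else 0 := by
          intro j
          congr 1
          rw [Fin.ext_iff, eq_iff_iff]
          constructor
          · intro h
            by_contra hne
            rcases lt_or_gt_of_ne hne with hlt | hlt
            · exact (hc e).injective (Nat.succ_lt_succ hlt) hi.le h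
            · exact (hc e).injective (Nat.succ_lt_succ hlt) j.2 h.symm
          · intro h
            simp only [S, h]
        simp only [h2, h3, mul_add, mul_ite, mul_one, mul_zero, Finset.sum_add_distrib,
          Finset.sum_ite_eq', Finset.mem_univ, if_true] at h1
        rw [← add_zero (S.jump g ⟨e, ⟨i, _⟩⟩), ← h1, add_left_comm, zmod_two_add_self, add_zero]
      · intro f _ hfe
        refine Finset.sum_eq_zero fun j _ ↦ ?_
        have h2 : p e (i + 1) ∈ D.arc e := hsub e i (by omega) (right_mem_segment _ _ _)
        have h3 : p e (i + 1) ∉ D.arc f := by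
          intro h3
          rcases hcross e f (Ne.symm hfe) _ h2 h3 with h | h
          · exact (hc e).injective (Nat.succ_pos i) hi.le h.symm
          · exact (hc e).injective hi le_rfl h
        rw [if_neg, if_neg, add_zero, mul_zero]
        · intro h
          exact h3 (h ▸ hsub f j j.2 (right_mem_segment _ _ _))
        · intro h
          exact h3 (h ▸ hsub f j j.2 (left_mem_segment _ _ _))
      · simp
  refine ⟨fun e ↦ S.posPoint ⟨e, ⟨0, hk e⟩⟩, fun e ↦ S.negPoint ⟨e, ⟨0, hk e⟩⟩, ?_⟩
  constructor
  · intro e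
    rw [← hS]
    exact ⟨SegmentFamily.posPoint_notMem _, SegmentFamily.negPoint_notMem _⟩
  · intro g hg
    rw [hLC] at hg
    rw [heven]
    intro q
    have := hg.endSum_jump q
    rw [← this]
    congr 1
    ext ⟨e, i⟩
    exact (hjump g hg e i).symm
  · intro J hJ
    obtain ⟨g, hg, h⟩ := SegmentFamily.exists_isLocConst_jump_eq ((heven J).1 hJ)
    exact ⟨g, (hLC g).2 hg, fun e ↦ h ⟨e, ⟨0, hk e⟩⟩⟩
  · intro g hg h p hp q hq
    rw [← hS] at hp hq
    rw [hLC] at hg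
    exact hg.eq_of_jump_eq_zero (fun ⟨e, i⟩ ↦ by rw [hjump g hg]; exact h e) hp hq
  · intro e
    -- An interior point of the first segment serves as `m`; both sides of that segment accumulate
    -- at it.
    set s : Σ e : E(G), Fin (k e) := ⟨e, ⟨0, hk e⟩⟩
    obtain ⟨m, hm⟩ := SegmentFamily.exists_mem_openSegment (S.a s) (S.b s)
    have hms := openSegment_subset_segment _ _ _ hm
    have hm0 := side_eq_zero_of_mem_segment hms
    refine ⟨m, hsub e 0 (hk e) hms, ?_, fun g hg ↦ ⟨fun h ↦ ?_, fun h ↦ ?_⟩⟩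
    · rintro ⟨v, hv, hvm⟩
      rcases hend e v hv (hvm ▸ hsub e 0 (hk e) hms) with h | h
      · rw [hvm] at h
        rw [h] at hm
        exact S.ne s (left_mem_openSegment_iff.1 hm)
      · rw [hvm] at h
        rw [h] at hm hms
        have := (hc e).finish (hk e) hms
        rw [← this] at hm
        exact S.ne s (right_mem_openSegment_iff.1 hm)
    · rw [hLC] at hg
      have h1 := mem_closure_iff_frequently.1 (mem_closure_side_pos (S.ne s) hm0)
      refine mem_closure_iff_frequently.2 ((h1.and_eventually (hg.eventually_pos hm)).mono ?_)
      rintro q ⟨hq, hq'⟩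
      exact (hq' hq).trans h
    · rw [hLC] at hg
      have h1 := mem_closure_iff_frequently.1 (SegmentFamily.mem_closure_side_neg (S.ne s) hm0)
      refine mem_closure_iff_frequently.2 ((h1.and_eventually (hg.eventually_neg hm)).mono ?_)
      rintro q ⟨hq, hq'⟩
      exact (hq' hq).trans h

end Drawing

/-! ### Even sets of edges -/

section Even

variable {α β : Type*} {G : Graph α β}

lemma exists_isLink_of_edgeVec_apply_ne_zero {e : β} {v : α} (h : edgeVec G e v ≠ 0) :
    ∃ w, G.IsLink e v w := by
  by_cases he : e ∈ E(G)
  · obtain ⟨x, y, hxy⟩ := G.exists_isLink_of_mem_edgeSet he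
    by_cases hx : x = v
    · exact ⟨y, hx ▸ hxy⟩
    by_cases hy : y = v
    · exact ⟨x, hy ▸ hxy.symm⟩
    · rw [edgeVec_eq hxy, Finsupp.add_apply, Finsupp.single_eq_of_ne (Ne.symm hx),
        Finsupp.single_eq_of_ne (Ne.symm hy), add_zero] at h
      exact absurd rfl h
  · rw [edgeVec_of_notMem he] at h
    exact absurd rfl h

lemma edgeVec_apply_right [G.Loopless] {e : β} {x y : α} (h : G.IsLink e x y) :
    edgeVec G e y = 1 := by
  rw [edgeVec_eq h, Finsupp.add_apply, Finsupp.single_eq_of_ne h.ne.symm, Finsupp.single_eq_same,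
    zero_add]

variable [Fintype E(G)]

/-- An even set of edges has no end vertices. -/
lemma exists_isLink_of_even [G.Loopless] {J : E(G) → ZMod 2} (hJ : ∑ e, J e • edgeVec G e = 0)
    {e : E(G)} (he : J e ≠ 0) {x y : α} (h : G.IsLink e x y) :
    ∃ f : E(G), f ≠ e ∧ J f ≠ 0 ∧ ∃ z, G.IsLink f y z := by
  by_contra! hcon
  have h1 := DFunLike.congr_fun hJ y
  rw [Finsupp.finsetSum_apply, Finset.sum_eq_single e] at h1
  · rw [Finsupp.smul_apply, edgeVec_apply_right h, smul_eq_mul, mul_one] at h1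
    exact he h1
  · intro f _ hf
    rw [Finsupp.smul_apply, smul_eq_mul]
    by_cases h2 : J f = 0
    · rw [h2, zero_mul]
    · rw [mul_eq_zero]
      by_contra! h3
      obtain ⟨z, hz⟩ := exists_isLink_of_edgeVec_apply_ne_zero h3.2
      exact hcon f hf h2 z hz
  · simp

/-- A simple bipartite graph has no nonempty even set of fewer than four edges. -/
lemma four_le_card_of_even (hs : G.Simple) (hb : G.toSimpleGraph.IsBipartite)
    {J : E(G) → ZMod 2} (hJ : ∑ e, J e • edgeVec G e = 0) (h0 : J ≠ 0) :
    4 ≤ (Finset.univ.filter fun e ↦ J e ≠ 0).card := by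
  classical
  obtain ⟨e, he⟩ := Function.ne_iff.1 h0
  obtain ⟨x, y, hxy⟩ := G.exists_isLink_of_mem_edgeSet e.2
  -- Since no edge of the set may end freely, `e = xy` continues by `f = yz` and `g = xw`, and `f`
  -- continues at `z` by `h`. These four edges are distinct.
  obtain ⟨f, hfe, hf, z, hyz⟩ := exists_isLink_of_even hJ he hxy
  obtain ⟨g, hge, hg, w, hxw⟩ := exists_isLink_of_even hJ he hxy.symm
  obtain ⟨h, hhf, hh, u, hzu⟩ := exists_isLink_of_even hJ hf hyz
  have hzx : z ≠ x := by
    rintro rfl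
    exact hfe (Subtype.ext (hs.eq_of_isLink hyz.symm hxy))
  have hgf : g ≠ f := by
    rintro rfl
    rcases hxw.left_eq_or_eq hyz with h | h
    · exact hxy.ne h
    · exact hzx h.symm
  have hhe : h ≠ e := by
    rintro rfl
    rcases hzu.left_eq_or_eq hxy with h | h
    · exact hzx h
    · exact hyz.ne h.symm
  have hhg : h ≠ g := by
    rintro rfl
    rcases hzu.left_eq_or_eq hxw with h' | rfl
    · exact hzx h'
    -- If `h = g`, then `w = z` and `x, y, z` form a triangle, which has no 2-colouring.
    · obtain ⟨c⟩ := hb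
      have hc : ∀ {k : β} {a b : α} (hk : G.IsLink k a b),
          c ⟨a, hk.left_mem⟩ ≠ c ⟨b, hk.right_mem⟩ := fun hk ↦
        c.valid ((G.toSimpleGraph_adj_iff _ _).2 ⟨_, hk⟩)
      have h1 := hc hxy
      have h2 := hc hyz
      have h3 := hc hxw
      omega
  calc 4 = ({e, f, g, h} : Finset E(G)).card := by
        rw [Finset.card_insert_of_notMem, Finset.card_insert_of_notMem,
          Finset.card_insert_of_notMem, Finset.card_singleton]
        · simpa using hhg.symm
        · simpa using ⟨hgf.symm, hhf.symm⟩
        · simpa using ⟨hfe.symm, hge.symm, hhe.symm⟩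
    _ ≤ _ := by
        refine Finset.card_le_card fun i hi ↦ ?_
        simp only [Finset.mem_insert, Finset.mem_singleton] at hi
        rcases hi with rfl | rfl | rfl | rfl <;> simpa

end Even

/-! ### Faces and bipartite planar graphs -/

section Faces

variable {α β : Type*} {G : Graph α β} (D : PlaneDrawing G)

lemma IsPolygonalArc.isClosed {a b : ℝ × ℝ} {S : Set (ℝ × ℝ)} (h : IsPolygonalArc a b S) :
    IsClosed S := by
  obtain ⟨k, p, -, -, -, rfl, -⟩ := h
  exact (Set.finite_Iio k).isClosed_biUnion fun i _ ↦ SegmentFamily.isClosed_segment _ _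

lemma PlaneDrawing.isClosed_arcs (hE : E(G).Finite) : IsClosed D.arcs :=
  hE.isClosed_biUnion fun e he ↦ by
    obtain ⟨x, y, h⟩ := G.exists_isLink_of_mem_edgeSet he
    exact (D.isArc e x y h).isClosed

/-- The component of the complement of the arcs that contains the point `p`. -/
def PlaneDrawing.comp (p : ℝ × ℝ) : Set (ℝ × ℝ) := connectedComponentIn D.arcsᶜ p

variable {D}

lemma PlaneDrawing.mem_comp {p : ℝ × ℝ} (hp : p ∉ D.arcs) : p ∈ D.comp p :=
  mem_connectedComponentIn hp

lemma PlaneDrawing.isOpen_comp (hE : E(G).Finite) (p : ℝ × ℝ) : IsOpen (D.comp p) :=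
  (D.isClosed_arcs hE).isOpen_compl.connectedComponentIn

lemma PlaneDrawing.notMem_arcs {p q : ℝ × ℝ} (h : q ∈ D.comp p) : q ∉ D.arcs :=
  connectedComponentIn_subset _ _ h

lemma PlaneDrawing.comp_eq {p q : ℝ × ℝ} (h : q ∈ D.comp p) : D.comp p = D.comp q :=
  connectedComponentIn_eq h

lemma PlaneDrawing.IsLocConst.eq_of_mem_comp {g : ℝ × ℝ → ZMod 2}
    (hg : D.IsLocConst g) {p q : ℝ × ℝ} (hp : p ∉ D.arcs) (h : q ∈ D.comp p) : g q = g p := by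
  have hsub : D.comp p ⊆ {r | ∀ᶠ r' in 𝓝 r, g r' = g p} := by
    refine isPreconnected_connectedComponentIn.subset_left_of_subset_union
      (v := {r | ∀ᶠ r' in 𝓝 r, g r' ≠ g p}) isOpen_setOfPred_eventually_nhds
      isOpen_setOfPred_eventually_nhds ?_ ?_ ⟨p, D.mem_comp hp, hg p hp⟩
    · rw [Set.disjoint_left]
      intro r h1 h2
      exact h2.self_of_nhds h1.self_of_nhds
    · intro r hr
      have h1 := hg r (D.notMem_arcs hr)
      by_cases h2 : g r = g p
      · exact Or.inl (h1.mono fun r' h ↦ h.trans h2)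
      · exact Or.inr (h1.mono fun r' h h3 ↦ h2 (h.symm.trans h3))
  exact (hsub h).self_of_nhds

open Classical in
/-- The indicator function of a set of points. -/
noncomputable def indic (F : Set (ℝ × ℝ)) (q : ℝ × ℝ) : ZMod 2 := if q ∈ F then 1 else 0

lemma indic_of_mem {F : Set (ℝ × ℝ)} {q : ℝ × ℝ} (h : q ∈ F) : indic F q = 1 := if_pos h

lemma indic_of_notMem {F : Set (ℝ × ℝ)} {q : ℝ × ℝ} (h : q ∉ F) : indic F q = 0 := if_neg h

lemma indic_eq_one {F : Set (ℝ × ℝ)} {q : ℝ × ℝ} : indic F q = 1 ↔ q ∈ F := by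
  rw [indic]
  split_ifs with h <;> simp [h]

lemma PlaneDrawing.isLocConst_indic (hE : E(G).Finite) (p : ℝ × ℝ) :
    D.IsLocConst (indic (D.comp p)) := by
  intro q hq
  filter_upwards [(D.isOpen_comp hE q).mem_nhds (D.mem_comp hq)] with r hr
  have h : r ∈ D.comp p ↔ q ∈ D.comp p := by
    constructor
    · intro h
      rw [D.comp_eq h, ← D.comp_eq hr]
      exact D.mem_comp hq
    · intro h
      rwa [D.comp_eq h]
  by_cases h' : q ∈ D.comp p
  · rw [indic_of_mem h', indic_of_mem (h.2 h')]
  · rw [indic_of_notMem h', indic_of_notMem (mt h.1 h')]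

/-- A drawn simple bipartite graph has at most twice as many edges as its rank. -/
lemma PlaneDrawing.ncard_edgeSet_le (D : PlaneDrawing G) (hE : E(G).Finite)
    (hs : G.Simple) (hb : G.toSimpleGraph.IsBipartite) :
    E(G).ncard ≤ 2 * Module.finrank (ZMod 2) (edgeSpan G E(G)) := by
  classical
  have : Fintype E(G) := hE.fintype
  obtain ⟨P, N, hPN⟩ := D.exists_isSides
  -- The faces on the sides of edges form a finite set and are all that is needed.
  let faces : Finset (Set (ℝ × ℝ)) :=
    Finset.univ.image (fun e ↦ D.comp (P e)) ∪ Finset.univ.image fun e ↦ D.comp (N e)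
  have hP : ∀ e, D.comp (P e) ∈ faces := fun e ↦ by simp [faces]
  have hN : ∀ e, D.comp (N e) ∈ faces := fun e ↦ by simp [faces]
  have hfaces : ∀ F ∈ faces, ∃ p ∉ D.arcs, F = D.comp p := by
    intro F hF
    simp only [faces, Finset.mem_union, Finset.mem_image, Finset.mem_univ, true_and] at hF
    rcases hF with ⟨e, rfl⟩ | ⟨e, rfl⟩
    · exact ⟨_, (hPN.notMem e).1, rfl⟩
    · exact ⟨_, (hPN.notMem e).2, rfl⟩
  have huniq : ∀ F ∈ faces, ∀ q, q ∈ F ↔ q ∉ D.arcs ∧ D.comp q = F := by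
    intro F hF q
    obtain ⟨p, -, rfl⟩ := hfaces F hF
    exact ⟨fun h ↦ ⟨D.notMem_arcs h, (D.comp_eq h).symm⟩, fun h ↦ h.2 ▸ D.mem_comp h.1⟩
  let B : Set (ℝ × ℝ) → E(G) → ZMod 2 := fun F e ↦ indic F (P e) + indic F (N e)
  have hB : ∀ F ∈ faces, ∑ e, B F e • edgeVec G e = 0 := by
    intro F hF
    obtain ⟨p, -, rfl⟩ := hfaces F hF
    exact hPN.sum_eq_zero _ (D.isLocConst_indic hE p)
  let ne := faces.filter fun F ↦ B F ≠ 0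
  -- counting
  have hcount : ne.card * 4 ≤ Fintype.card E(G) * 2 := by
    refine Finset.card_mul_le_card_mul (t := Finset.univ) (fun F e ↦ B F e ≠ 0) ?_ ?_
    · intro F hF
      obtain ⟨hF, h0⟩ := Finset.mem_filter.1 hF
      exact four_le_card_of_even hs hb (hB F hF) h0
    · intro e _
      refine (Finset.card_le_card (t := {D.comp (P e), D.comp (N e)}) ?_).trans Finset.card_le_two
      intro F hF
      obtain ⟨hF, h0⟩ := Finset.mem_filter.1 hF
      have hF := (Finset.mem_filter.1 hF).1
      rw [Finset.mem_insert, Finset.mem_singleton]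
      by_contra! hcon
      refine h0 ?_
      have h1 : P e ∉ F := fun h ↦ hcon.1 ((huniq F hF _).1 h).2.symm
      have h2 : N e ∉ F := fun h ↦ hcon.2 ((huniq F hF _).1 h).2.symm
      simp only [B]
      rw [indic_of_notMem h1, indic_of_notMem h2, add_zero]
  let φ : (E(G) → ZMod 2) →ₗ[ZMod 2] (α →₀ ZMod 2) :=
    Fintype.linearCombination (ZMod 2) fun e : E(G) ↦ edgeVec G e
  have hrange : LinearMap.range φ = edgeSpan G E(G) := by
    rw [Fintype.range_linearCombination, edgeSpan, Set.image_eq_range]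
  -- A cycle is the jump set of some `g`. At the points `P e` and `N e` this `g` is a combination of
  -- indicators of faces, so the cycle is the same combination of their boundaries `B F`.
  have hker : LinearMap.ker φ ≤ Submodule.span (ZMod 2) (ne.image B : Set (E(G) → ZMod 2)) := by
    intro J hJ
    rw [LinearMap.mem_ker, Fintype.linearCombination_apply] at hJ
    obtain ⟨g, hg, hgJ⟩ := hPN.exists_eq J hJ
    have hval : ∀ q ∉ D.arcs, D.comp q ∈ faces →
        g q = ∑ F ∈ faces, (if h : ∃ p ∉ D.arcs, F = D.comp p then g h.choose else 0) *
          indic F q := by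
      intro q hq hqF
      rw [Finset.sum_eq_single_of_mem _ hqF]
      · have h : ∃ p ∉ D.arcs, D.comp q = D.comp p := ⟨q, hq, rfl⟩
        rw [dif_pos h, indic_of_mem (D.mem_comp hq), mul_one]
        refine hg.eq_of_mem_comp h.choose_spec.1 ?_
        rw [← h.choose_spec.2]
        exact D.mem_comp hq
      · intro F hF hne
        rw [indic_of_notMem fun h ↦ hne ((huniq F hF _).1 h).2.symm, mul_zero]
    have hsum : J = ∑ F ∈ faces,
        (if h : ∃ p ∉ D.arcs, F = D.comp p then g h.choose else 0) • B F := by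
      ext e
      rw [← hgJ e, hval _ (hPN.notMem e).1 (hP e), hval _ (hPN.notMem e).2 (hN e),
        ← Finset.sum_add_distrib, Finset.sum_apply]
      refine Finset.sum_congr rfl fun F _ ↦ ?_
      rw [Pi.smul_apply, smul_eq_mul, mul_add]
    rw [hsum]
    refine Submodule.sum_mem _ fun F hF ↦ Submodule.smul_mem _ _ ?_
    by_cases h0 : B F = 0
    · rw [h0]
      exact Submodule.zero_mem _
    · refine Submodule.subset_span ?_
      rw [Finset.coe_image]
      exact ⟨F, Finset.mem_filter.2 ⟨hF, h0⟩, rfl⟩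
  -- The cycle space has dimension `|E|` minus the rank, and it is spanned by the nonempty
  -- boundaries, at most `|E| / 2` in number.
  have h1 := (Submodule.finrank_mono hker).trans
    ((finrank_span_finset_le_card _).trans Finset.card_image_le)
  have h2 := LinearMap.finrank_range_add_finrank_ker φ
  rw [hrange, Module.finrank_fintype_fun_eq_card] at h2
  rw [← Nat.card_coe_set_eq, Nat.card_eq_fintype_card]
  omega

/-- The drawing of a spanning subgraph. -/
def PlaneDrawing.restrict (D : PlaneDrawing G) (A : Set β) : PlaneDrawing (G.restrict A) where
  pos := D.pos
  arc := D.arc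
  pos_injOn := D.pos_injOn
  isArc e x y h := D.isArc e x y ((G.restrict_isLink A e x y).mp h).2
  eq_end e x y z h := D.eq_end e x y z ((G.restrict_isLink A e x y).mp h).2
  inter_subset e he f hf := D.inter_subset e he.1 f hf.1

lemma edgeVec_restrict {A : Set β} {e : β} (he : e ∈ A) : edgeVec (G.restrict A) e = edgeVec G e := by
  by_cases h : e ∈ E(G)
  · obtain ⟨x, y, hxy⟩ := G.exists_isLink_of_mem_edgeSet h
    rw [edgeVec_eq hxy, edgeVec_eq ((G.restrict_isLink A e x y).mpr ⟨he, hxy⟩)]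
  · rw [edgeVec_of_notMem h, edgeVec_of_notMem fun h' : e ∈ E(G) ∩ A ↦ h h'.1]

/-- Spanning subgraphs inherit the drawing, simplicity and the 2-colouring, so the bound for all
edges applies to every `A`. -/
lemma IsBipartitePlanar.isSparse (h : IsBipartitePlanar G) (hV : V(G).Finite)
    (hE : E(G).Finite) : IsSparse G := by
  obtain ⟨hs, ⟨c⟩, ⟨D⟩⟩ := h
  intro A hA
  have hAE : E(G.restrict A) = A := by
    change E(G) ∩ A = A
    exact Set.inter_eq_right.2 hA
  have hs' : (G.restrict A).Simple := hs.anti G.restrict_le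
  have hb : (G.restrict A).toSimpleGraph.IsBipartite := ⟨c.comp
    { toFun := fun v ↦ ⟨v.1, v.2⟩
      map_rel' := fun {u v} h ↦ by
        rw [Graph.toSimpleGraph_adj_iff] at h ⊢
        obtain ⟨e, he⟩ := h
        exact ⟨e, ((G.restrict_isLink A e u v).mp he).2⟩ }⟩
  have h1 := (D.restrict A).ncard_edgeSet_le (by rw [hAE]; exact hE.subset hA) hs' hb
  have h2 : edgeSpan (G.restrict A) A = edgeSpan G A := by
    rw [edgeSpan, edgeSpan, Set.image_congr fun e he ↦ edgeVec_restrict he]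
  rwa [hAE, h2, ← rank_eq_finrank hV] at h1

end Faces

/-! ### Density of graphs in which every edge lies in two triangles -/

section TriangleTower

variable {α β : Type*} {G : Graph α β} {A S : Set β} {w x z u : α} {e f h : β}

lemma rank_insert_le (hV : V(G).Finite) : rank G (insert e A) ≤ rank G A + 1 := by
  by_cases h : edgeVec G e ∈ edgeSpan G A
  · rw [rank_insert_of_mem hV h]
    omega
  · rw [rank_insert_of_notMem hV h]

/-- Every set of edges that properly contains `A` has large rank. -/
def IsFlatBelow (G : Graph α β) (A : Set β) : Prop :=
  ∀ S, A ⊆ S → S ⊆ E(G) → A ≠ S → 2 * rank G A + (S \ A).ncard + 1 ≤ 2 * rank G S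

lemma ncard_insert_sdiff (hS : S.Finite) (hAS : A ⊆ S) (he : e ∉ S) :
    (insert e S \ A).ncard = (S \ A).ncard + 1 := by
  rw [Set.insert_sdiff_of_notMem _ fun h ↦ he (hAS h),
    Set.ncard_insert_of_notMem (fun h ↦ he h.1) hS.sdiff]

/-- The bound `hr` leaves no slack: a missing edge between joined vertices would enlarge `S` without
raising its rank, against `IsFlatBelow`. So `S` is a flat. -/
lemma IsFlatBelow.mem_of_joined (hA : IsFlatBelow G A) (hV : V(G).Finite) (hE : E(G).Finite)
    (hAS : A ⊆ S) (hS : S ⊆ E(G)) (hr : 2 * rank G S ≤ 2 * rank G A + (S \ A).ncard + 1)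
    (he : G.IsLink e x z) (h : Joined G S x z) : e ∈ S := by
  by_contra hne
  have h1 := hA (insert e S) (hAS.trans (Set.subset_insert _ _))
    (Set.insert_subset he.edge_mem hS) fun h' ↦ hne (hAS (h' ▸ Set.mem_insert e S))
  rw [rank_insert_of_joined hV he h, ncard_insert_sdiff (hE.subset hS) hAS hne] at h1
  omega

/-- `S` arises from `A` by adding the edges of a sequence of triangles, the last of which has the
apex `w` and the edges `f = wx` and `h = wz` at it. -/
structure IsTriangleTower (G : Graph α β) (A S : Set β) (w x z : α) (f h : β) : Prop where
  subset : A ⊆ S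
  subset_edgeSet : S ⊆ E(G)
  left : G.IsLink f w x
  right : G.IsLink h w z
  left_mem : f ∈ S \ A
  joined : ∀ e ∈ S \ A, ∀ a b, G.IsLink e a b → Joined G S a w
  eq_or_eq : ∀ e ∈ S \ A, ∀ a b, G.IsLink e a b → Joined G A a w → e = f ∨ e = h
  rank_le : 2 * rank G S ≤ 2 * rank G A + (S \ A).ncard + 1

/-- The triangle on `f = wx` with new apex `u` contributes the edges `p = wu` and `q = xu`. Two
edges for at most one unit of rank preserve `rank_le`. As `S` is a flat, `u` cannot be joined to `w`
by `S`, so `p` and `q` are the only new-tower edges meeting the `A`-component of `u`. -/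
lemma IsTriangleTower.extend [G.Simple] (ht : IsTriangleTower G A S w x z f h)
    (hA : IsFlatBelow G A) (hV : V(G).Finite) (hE : E(G).Finite)
    (hu : u ≠ z) (hwu : G.Adj w u) (hxu : G.Adj x u) :
    ∃ S' f' h', IsTriangleTower G A S' u w x f' h' ∧ S.ncard < S'.ncard := by
  obtain ⟨p, hp⟩ := hwu
  obtain ⟨q, hq⟩ := hxu
  have hux : u ≠ x := hq.ne.symm
  have huw : u ≠ w := hp.ne.symm
  have hpf : p ≠ f := by
    rintro rfl
    exact hux (hp.right_unique ht.left)
  have hph : p ≠ h := by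
    rintro rfl
    exact hu (hp.right_unique ht.right)
  have hSf := hE.subset ht.subset_edgeSet
  have hxw : Joined G S x w := .of_isLink ht.left.symm ht.left_mem.1
  have hclosed : ∀ {e a b}, G.IsLink e a b → Joined G A a b → e ∈ A := fun h h' ↦
    hA.mem_of_joined hV hE subset_rfl (ht.subset.trans ht.subset_edgeSet) (by omega) h h'
  have hflat : ∀ {e a b}, G.IsLink e a b → Joined G S a b → e ∈ S := fun h h' ↦
    hA.mem_of_joined hV hE ht.subset ht.subset_edgeSet ht.rank_le h h'
  -- If `p ∈ A`, then `q` would be an edge of `S \ A` with an end joined to `w` by `A`, hence `f` or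
  -- `h`; neither has the right ends.
  have hpA : p ∉ A := by
    intro hpA
    have h1 : Joined G A u w := .of_isLink hp.symm hpA
    have hqA : q ∉ A := fun hqA ↦ ht.left_mem.2
      (hclosed ht.left (h1.symm.trans (.of_isLink hq.symm hqA)))
    have hqS : q ∈ S := hflat hq (hxw.trans (h1.symm.mono ht.subset))
    rcases ht.eq_or_eq q ⟨hqS, hqA⟩ _ _ hq.symm h1 with rfl | rfl
    · rcases hq.left_eq_or_eq ht.left.symm with h' | h'
      · exact huw (hq.right_unique ht.left.symm)
      · exact ht.left.ne h'.symm
    · rcases ht.right.left_eq_or_eq hq with h' | h'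
      · exact ht.left.ne h'
      · exact huw h'.symm
  have hpS : p ∉ S := by
    intro hpS
    rcases ht.eq_or_eq p ⟨hpS, hpA⟩ _ _ hp (.refl G A w) with h' | h'
    · exact hpf h'
    · exact hph h'
  have hwu : ¬ Joined G S u w := fun h' ↦ hpS (hflat hp h'.symm)
  have hqS : q ∉ S := fun hqS ↦ hwu ((Joined.of_isLink hq.symm hqS).trans hxw)
  have hpq : p ≠ q := by
    rintro rfl
    exact ht.left.ne (hp.left_unique hq)
  have hpqS : p ∉ insert q S := by
    rw [Set.mem_insert_iff]
    tauto
  have hsub : S ⊆ insert p (insert q S) := (Set.subset_insert _ _).trans (Set.subset_insert _ _)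
  have huw' : Joined G (insert p (insert q S)) w u := .of_isLink hp (Set.mem_insert _ _)
  have hux' : Joined G (insert p (insert q S)) x u :=
    .of_isLink hq (Set.mem_insert_of_mem _ (Set.mem_insert _ _))
  have hAS := ht.subset.trans (Set.subset_insert q S)
  have hold : ∀ e ∈ S, ∀ a b, G.IsLink e a b → e ∉ A → Joined G S a w := fun e he a b hab hA ↦
    ht.joined e ⟨he, hA⟩ a b hab
  have hcard : (insert p (insert q S)).ncard = S.ncard + 2 := by
    rw [Set.ncard_insert_of_notMem hpqS (hSf.insert q), Set.ncard_insert_of_notMem hqS hSf]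
  refine ⟨insert p (insert q S), p, q, ⟨ht.subset.trans hsub, ?_, hp.symm, hq.symm,
    ⟨Set.mem_insert _ _, hpA⟩, ?_, ?_, ?_⟩, by omega⟩
  · exact Set.insert_subset hp.edge_mem (Set.insert_subset hq.edge_mem ht.subset_edgeSet)
  · rintro e ⟨he, heA⟩ a b hab
    rcases he with rfl | rfl | he
    · rcases hab.left_eq_or_eq hp with rfl | rfl
      · exact huw'
      · exact .refl _ _ _
    · rcases hab.left_eq_or_eq hq with rfl | rfl
      · exact hux'
      · exact .refl _ _ _
    · exact ((hold e he a b hab heA).mono hsub).trans huw'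
  · rintro e ⟨he, heA⟩ a b hab hj
    rcases he with rfl | rfl | he
    · exact Or.inl rfl
    · exact Or.inr rfl
    · exact absurd ((hj.mono ht.subset).symm.trans (hold e he a b hab heA)) hwu
  · have h1 : rank G (insert p (insert q S)) ≤ rank G S + 1 := by
      rw [rank_insert_of_joined hV hp]
      · exact rank_insert_le hV
      · exact (hxw.mono (Set.subset_insert _ _)).symm.trans (.of_isLink hq (Set.mem_insert _ _))
    have h2 : (insert p (insert q S) \ A).ncard = (S \ A).ncard + 2 := by
      rw [ncard_insert_sdiff (hSf.insert q) hAS hpqS, ncard_insert_sdiff hSf ht.subset hqS]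
    have := ht.rank_le
    omega

/-- A triangle with two edges outside `A` starts a tower. If the third edge is in `A`, two edges are
added for at most one unit of rank; otherwise three edges for at most two, which is just allowed by
`rank_le`. -/
lemma IsFlatBelow.exists_isTriangleTower [G.Simple] (hA : IsFlatBelow G A) (hV : V(G).Finite)
    (hE : E(G).Finite) (hAE : A ⊆ E(G)) (hf : G.IsLink f w x) (hh : G.IsLink h w z)
    (he : G.IsLink e x z) (hfA : f ∉ A) (hhA : h ∉ A) :
    ∃ S, IsTriangleTower G A S w x z f h := by
  have hclosed : ∀ {e a b}, G.IsLink e a b → Joined G A a b → e ∈ A := fun h h' ↦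
    hA.mem_of_joined hV hE subset_rfl hAE (by omega) h h'
  have hAf := hE.subset hAE
  have hfh : f ≠ h := by
    rintro rfl
    exact he.ne (hf.right_unique hh)
  have hfe : f ≠ e := by
    rintro rfl
    exact hh.ne (hf.symm.right_unique he)
  have hhe : h ≠ e := by
    rintro rfl
    exact hf.ne (hh.symm.right_unique he.symm)
  have hfhA : f ∉ insert h A := by
    rw [Set.mem_insert_iff]
    tauto
  by_cases heA : e ∈ A
  · have hsub : A ⊆ insert f (insert h A) := (Set.subset_insert _ _).trans (Set.subset_insert _ _)
    have hxw : Joined G (insert f (insert h A)) x w := .of_isLink hf.symm (Set.mem_insert _ _)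
    have hzw : Joined G (insert f (insert h A)) z w :=
      .of_isLink hh.symm (Set.mem_insert_of_mem _ (Set.mem_insert _ _))
    refine ⟨insert f (insert h A), hsub, ?_, hf, hh, ⟨Set.mem_insert _ _, hfA⟩, ?_, ?_, ?_⟩
    · exact Set.insert_subset hf.edge_mem (Set.insert_subset hh.edge_mem hAE)
    · rintro k ⟨hk, hkA⟩ a b hab
      rcases hk with rfl | rfl | hk
      · rcases hab.left_eq_or_eq hf with rfl | rfl
        · exact .refl _ _ _
        · exact hxw
      · rcases hab.left_eq_or_eq hh with rfl | rfl
        · exact .refl _ _ _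
        · exact hzw
      · exact absurd hk hkA
    · rintro k ⟨hk, hkA⟩ a b hab hj
      rcases hk with rfl | rfl | hk
      · exact Or.inl rfl
      · exact Or.inr rfl
      · exact absurd hk hkA
    · rw [ncard_insert_sdiff (hAf.insert h) (Set.subset_insert _ _) hfhA,
        ncard_insert_sdiff hAf subset_rfl hhA, rank_insert_of_joined hV hf]
      · have : rank G (insert h A) ≤ rank G A + 1 := rank_insert_le hV
        omega
      · exact (Joined.of_isLink hh (Set.mem_insert _ _)).trans
          (.of_isLink he.symm (Set.mem_insert_of_mem _ heA))
  · have hehA : e ∉ insert f (insert h A) := by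
      simp only [Set.mem_insert_iff]
      tauto
    have hsub : A ⊆ insert e (insert f (insert h A)) := (Set.subset_insert _ _).trans
      ((Set.subset_insert _ _).trans (Set.subset_insert _ _))
    have hfS : f ∈ insert e (insert f (insert h A)) := by simp
    have hhS : h ∈ insert e (insert f (insert h A)) := by simp
    have hxw : Joined G (insert e (insert f (insert h A))) x w := .of_isLink hf.symm hfS
    have hzw : Joined G (insert e (insert f (insert h A))) z w := .of_isLink hh.symm hhS
    refine ⟨insert e (insert f (insert h A)), hsub, ?_, hf, hh, ⟨hfS, hfA⟩, ?_, ?_, ?_⟩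
    · exact Set.insert_subset he.edge_mem
        (Set.insert_subset hf.edge_mem (Set.insert_subset hh.edge_mem hAE))
    · rintro k ⟨hk, hkA⟩ a b hab
      rcases hk with rfl | rfl | rfl | hk
      · rcases hab.left_eq_or_eq he with rfl | rfl
        · exact hxw
        · exact hzw
      · rcases hab.left_eq_or_eq hf with rfl | rfl
        · exact .refl _ _ _
        · exact hxw
      · rcases hab.left_eq_or_eq hh with rfl | rfl
        · exact .refl _ _ _
        · exact hzw
      · exact absurd hk hkA
    · rintro k ⟨hk, hkA⟩ a b hab hj
      rcases hk with rfl | rfl | rfl | hk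
      · rcases hab.left_eq_or_eq he with rfl | rfl
        · exact absurd (hclosed hf hj.symm) hfA
        · exact absurd (hclosed hh hj.symm) hhA
      · exact Or.inl rfl
      · exact Or.inr rfl
      · exact absurd hk hkA
    · have hs : A ⊆ insert h A := Set.subset_insert _ _
      rw [ncard_insert_sdiff ((hAf.insert h).insert f) (hs.trans (Set.subset_insert _ _)) hehA,
        ncard_insert_sdiff (hAf.insert h) hs hfhA,
        ncard_insert_sdiff hAf subset_rfl hhA, rank_insert_of_joined hV he]
      · have h1 : rank G (insert h A) ≤ rank G A + 1 := rank_insert_le hV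
        have h2 : rank G (insert f (insert h A)) ≤ rank G (insert h A) + 1 := rank_insert_le hV
        rw [Set.sdiff_self, Set.ncard_empty]
        omega
      · exact (Joined.of_isLink hf.symm (Set.mem_insert _ _)).trans
          (.of_isLink hh (Set.mem_insert_of_mem _ (Set.mem_insert _ _)))

/-- A simple graph in which every edge lies in two triangles is dense. -/
lemma isDense_of_two_triangles [G.Simple] (hV : V(G).Finite) (hE : E(G).Finite)
    (hG : ∀ x y, G.Adj x y → ∃ u v, u ≠ v ∧ G.Adj x u ∧ G.Adj y u ∧ G.Adj x v ∧ G.Adj y v) :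
    IsDense G := by
  have hG' : ∀ x y z, G.Adj x y → ∃ u, u ≠ z ∧ G.Adj x u ∧ G.Adj y u := by
    intro x y z h
    obtain ⟨u, v, huv, h1, h2, h3, h4⟩ := hG x y h
    by_cases hu : u = z
    · exact ⟨v, fun hv ↦ huv (hu.trans hv.symm), h3, h4⟩
    · exact ⟨u, hu, h1, h2⟩
  suffices H : ∀ n A, A ⊆ E(G) → (E(G) \ A).ncard = n →
      2 * rank G E(G) ≤ 2 * rank G A + (E(G) \ A).ncard from fun A hA ↦ H _ A hA rfl
  intro n
  induction n using Nat.strong_induction_on with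
  | _ n ih =>
  intro A hAE hn
  by_contra hcon
  -- A counterexample `A` with the fewest edges outside it: all larger sets satisfy the inequality
  -- that `A` violates.
  have hA : IsFlatBelow G A := by
    intro S hAS hS hne
    have h1 : (E(G) \ A).ncard = (S \ A).ncard + (E(G) \ S).ncard := by
      rw [← Set.ncard_union_eq _ (hE.subset (Set.sdiff_subset.trans hS)) hE.sdiff]
      · congr 1
        ext e
        have := @hAS e
        have := @hS e
        simp only [Set.mem_sdiff, Set.mem_union]
        tauto
      · rw [Set.disjoint_left]
        exact fun e h1 h2 ↦ h2.2 h1.1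
    have h2 : 0 < (S \ A).ncard := by
      rw [Set.ncard_pos (hE.subset (Set.sdiff_subset.trans hS)), Set.sdiff_nonempty]
      exact fun h ↦ hne (hAS.antisymm h)
    have h3 := ih _ (by omega) S hS rfl
    omega
  have hclosed : ∀ {e a b}, G.IsLink e a b → Joined G A a b → e ∈ A := fun h h' ↦
    hA.mem_of_joined hV hE subset_rfl hAE (by omega) h h'
  -- The edge `f = wx` of the last triangle lies in a triangle whose apex is not `z`, so the tower
  -- can always grow, which is absurd in a finite graph.
  have hgrow : ∀ k : ℕ, ∃ S w x z f h, IsTriangleTower G A S w x z f h ∧ k ≤ S.ncard := by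
    intro k
    induction k with
    | zero =>
      obtain ⟨e, heE, heA⟩ : ∃ e ∈ E(G), e ∉ A := by
        by_contra! h
        rw [hAE.antisymm h] at hcon
        omega
      obtain ⟨x, y, hxy⟩ := G.exists_isLink_of_mem_edgeSet heE
      obtain ⟨z, -, ⟨f, hf⟩, ⟨h, hh⟩⟩ := hG' x y x ⟨e, hxy⟩
      -- As `A` is a flat missing `e`, it misses a second edge of the triangle.
      by_cases hfA : f ∈ A
      · have hhA : h ∉ A := fun hhA ↦ heA
          (hclosed hxy ((Joined.of_isLink hf hfA).trans (.of_isLink hh.symm hhA)))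
        obtain ⟨S, hS⟩ := hA.exists_isTriangleTower hV hE hAE hxy.symm hh hf heA hhA
        exact ⟨S, _, _, _, _, _, hS, Nat.zero_le _⟩
      · obtain ⟨S, hS⟩ := hA.exists_isTriangleTower hV hE hAE hxy hf hh heA hfA
        exact ⟨S, _, _, _, _, _, hS, Nat.zero_le _⟩
    | succ k ih =>
      obtain ⟨S, w, x, z, f, h, ht, hk⟩ := ih
      obtain ⟨u, hu, hwu, hxu⟩ := hG' w x z ⟨f, ht.left⟩
      obtain ⟨S', f', h', ht', hlt⟩ := ht.extend hA hV hE hu hwu hxu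
      exact ⟨S', _, _, _, _, _, ht', by omega⟩
  obtain ⟨S, w, x, z, f, h, ht, hk⟩ := hgrow (E(G).ncard + 1)
  have := Set.ncard_le_ncard ht.subset_edgeSet hE
  omega

end TriangleTower

/-! ### Triangulations -/

section Triangulation

variable {α β : Type*} {G : Graph α β} {D : PlaneDrawing G}

/-- Every face of the drawing is bounded by a triangle. -/
def PlaneDrawing.IsTriangulated (D : PlaneDrawing G) : Prop :=
  ∀ F, D.IsFace F → ∃ (x y z : α) (e f g : β),
    G.IsLink e x y ∧ G.IsLink f y z ∧ G.IsLink g z x ∧ frontier F = D.arc e ∪ D.arc f ∪ D.arc g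

lemma PlaneDrawing.arc_subset_arcs {e : β} (he : e ∈ E(G)) : D.arc e ⊆ D.arcs :=
  Set.subset_biUnion_of_mem he

lemma PlaneDrawing.IsTriangulated.frontier_subset (hD : D.IsTriangulated) {F : Set (ℝ × ℝ)}
    (hF : D.IsFace F) : frontier F ⊆ D.arcs := by
  obtain ⟨x, y, z, e, f, g, he, hf, hg, h⟩ := hD F hF
  rw [h]
  exact Set.union_subset (Set.union_subset (D.arc_subset_arcs he.edge_mem)
    (D.arc_subset_arcs hf.edge_mem)) (D.arc_subset_arcs hg.edge_mem)

/-- An isolated vertex would be a frontier point of a face, but the frontier consists of arcs. -/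
lemma PlaneDrawing.IsTriangulated.pos_mem_arcs (hD : D.IsTriangulated) (hV : V(G).Finite)
    (hE : E(G).Finite) {v : α} (hv : v ∈ V(G)) : D.pos v ∈ D.arcs := by
  by_contra hcon
  have hopen : IsOpen (D.arcs ∪ D.pos '' (V(G) \ {v}))ᶜ :=
    ((D.isClosed_arcs hE).union ((hV.sdiff.image _).isClosed)).isOpen_compl
  have hmem : D.pos v ∈ (D.arcs ∪ D.pos '' (V(G) \ {v}))ᶜ := by
    rintro (h | ⟨u, hu, h⟩)
    · exact hcon h
    · exact hu.2 (D.pos_injOn hu.1 hv h)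
  obtain ⟨r, hr, hball⟩ := Metric.isOpen_iff.1 hopen _ hmem
  -- A half ball beside the vertex is convex, so it lies in a single face, and it has the vertex in
  -- its closure.
  set H : Set (ℝ × ℝ) := Metric.ball (D.pos v) r ∩ Set.Ioi (D.pos v).1 ×ˢ Set.univ
  have hconv : Convex ℝ H := (convex_ball _ _).inter ((convex_Ioi _).prod convex_univ)
  have hcl : D.pos v ∈ closure H := by
    refine Metric.isOpen_ball.inter_closure ⟨Metric.mem_ball_self hr, ?_⟩
    rw [closure_prod_eq, closure_Ioi, closure_univ]
    exact ⟨le_refl (D.pos v).1, trivial⟩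
  have hH : H ⊆ D.supportᶜ := by
    rintro q ⟨hq, hq1⟩ (⟨u, hu, rfl⟩ | h)
    · refine hball hq (Or.inr ⟨u, ⟨hu, ?_⟩, rfl⟩)
      rintro rfl
      exact lt_irrefl _ (Set.mem_Ioi.1 hq1.1)
    · exact hball hq (Or.inl h)
  obtain ⟨q, hq⟩ := closure_nonempty_iff.1 ⟨_, hcl⟩
  have hF : D.IsFace (connectedComponentIn D.supportᶜ q) := ⟨q, hH hq, rfl⟩
  have hHF := hconv.isPreconnected.subset_connectedComponentIn hq hH
  refine hcon (hD.frontier_subset hF ⟨closure_mono hHF hcl, fun h ↦ ?_⟩)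
  exact connectedComponentIn_subset _ _ (interior_subset h) (Or.inl ⟨v, hv, rfl⟩)

lemma PlaneDrawing.IsTriangulated.isFace_comp (hD : D.IsTriangulated) (hV : V(G).Finite)
    (hE : E(G).Finite) {p : ℝ × ℝ} (hp : p ∉ D.arcs) : D.IsFace (D.comp p) := by
  have h : D.support = D.arcs := by
    refine Set.union_eq_self_of_subset_left ?_
    rintro _ ⟨v, hv, rfl⟩
    exact hD.pos_mem_arcs hV hE hv
  exact ⟨p, by rwa [h], by rw [h, PlaneDrawing.comp]⟩

lemma PlaneDrawing.mem_frontier_comp (hE : E(G).Finite) {p m : ℝ × ℝ} (hm : m ∈ D.arcs)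
    (h : m ∈ closure {q | indic (D.comp p) q = 1}) : m ∈ frontier (D.comp p) := by
  rw [(D.isOpen_comp hE p).frontier_eq]
  refine ⟨?_, fun h' ↦ D.notMem_arcs h' hm⟩
  convert h using 2
  ext q
  exact indic_eq_one.symm

lemma PlaneDrawing.eq_of_mem_arc {e f : β} (he : e ∈ E(G)) (hf : f ∈ E(G)) {m : ℝ × ℝ}
    (hme : m ∈ D.arc e) (hm : m ∉ D.pos '' V(G)) (hmf : m ∈ D.arc f) : e = f := by
  by_contra hne
  exact hm (D.inter_subset e he f hf hne ⟨hme, hmf⟩)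

/-- A point of `e` that is not a vertex lies on no other arc, so `e` is one of the three bounding
edges and can be listed first. -/
lemma PlaneDrawing.IsTriangulated.exists_triangle (hD : D.IsTriangulated) {F : Set (ℝ × ℝ)}
    (hF : D.IsFace F) {e : β} {x y : α} (he : G.IsLink e x y) {m : ℝ × ℝ} (hme : m ∈ D.arc e)
    (hm : m ∉ D.pos '' V(G)) (hmF : m ∈ frontier F) :
    ∃ z f g, G.IsLink f y z ∧ G.IsLink g z x ∧ frontier F = D.arc e ∪ D.arc f ∪ D.arc g := by
  obtain ⟨a, b, c, i, j, k, hi, hj, hk, h⟩ := hD F hF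
  have key : ∀ {a b c i j k}, G.IsLink i a b → G.IsLink j b c → G.IsLink k c a →
      frontier F = D.arc i ∪ D.arc j ∪ D.arc k → m ∈ D.arc i →
      ∃ z f g, G.IsLink f y z ∧ G.IsLink g z x ∧ frontier F = D.arc e ∪ D.arc f ∪ D.arc g := by
    intro a b c i j k hi hj hk h hmi
    obtain rfl := D.eq_of_mem_arc he.edge_mem hi.edge_mem hme hm hmi
    rcases he.eq_and_eq_or_eq_and_eq hi with ⟨rfl, rfl⟩ | ⟨rfl, rfl⟩
    · exact ⟨c, j, k, hj, hk, h⟩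
    · exact ⟨c, k, j, hk.symm, hj.symm, by rw [h, Set.union_right_comm]⟩
  have hm' := hmF
  rw [h] at hm'
  rcases hm' with (h' | h') | h'
  · exact key hi hj hk h h'
  · exact key hj hk hi (by rw [h, Set.union_assoc, Set.union_comm]) h'
  · exact key hk hi hj (by rw [h, Set.union_comm, Set.union_assoc]) h'

lemma edgeVec_triangle {e f g : β} {x y z : α} (he : G.IsLink e x y) (hf : G.IsLink f y z)
    (hg : G.IsLink g z x) : edgeVec G e + edgeVec G f + edgeVec G g = 0 := by
  rw [edgeVec_eq he, edgeVec_eq hf, edgeVec_eq hg]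
  have h : ∀ a b c : α →₀ ZMod 2, a + b + (b + c) + (c + a) = (a + a) + (b + b) + (c + c) := by
    intro a b c
    abel
  rw [h, zmod_two_add_self, zmod_two_add_self, zero_add, zero_add, zmod_two_add_self]

/-- A nonempty even set of edges of a triangle is the whole triangle. -/
lemma apply_ne_zero_of_even_triangle [G.Simple] [Fintype E(G)] {J : E(G) → ZMod 2}
    (hJ : ∑ e, J e • edgeVec G e = 0) {e f g : E(G)} {x y z : α} (he : G.IsLink e x y)
    (hf : G.IsLink f y z) (hg : G.IsLink g z x) (hsupp : ∀ k, J k ≠ 0 → k = e ∨ k = f ∨ k = g)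
    (h : J e ≠ 0) : J f ≠ 0 ∧ J g ≠ 0 := by
  constructor
  · obtain ⟨k, hke, hk, w, hw⟩ := exists_isLink_of_even hJ h he
    rcases hsupp k hk with rfl | rfl | rfl
    · exact absurd rfl hke
    · exact hk
    · rcases hw.left_eq_or_eq hg with h' | h'
      · exact absurd h' hf.ne
      · exact absurd h'.symm he.ne
  · obtain ⟨k, hke, hk, w, hw⟩ := exists_isLink_of_even hJ h he.symm
    rcases hsupp k hk with rfl | rfl | rfl
    · exact absurd rfl hke
    · rcases hw.left_eq_or_eq hf with h' | h'
      · exact absurd h' he.ne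
      · exact absurd h'.symm hg.ne
    · exact hk

/-- Two vertices of a simple graph span at most one edge, and from three vertices on the allowed
number is at least four. -/
lemma isSparse_of_ncard_edgeSet_le_three [G.Simple] (hV : V(G).Finite) (hE : E(G).Finite)
    (h : E(G).ncard ≤ 3) : IsSparse G := by
  refine isSparse_of_induce hV hE fun X hX hne ↦ ?_
  have hXf := hV.subset hX
  have hpos := (Set.ncard_pos hXf).2 hne
  have hsub : E(G.induce X) ⊆ E(G) := by
    rintro e ⟨x, y, hxy, -⟩
    exact hxy.edge_mem
  have h3 := Set.ncard_le_ncard hsub hE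
  rcases Nat.lt_or_ge X.ncard 2 with h1 | h1
  · rw [ncard_edgeSet_induce_of_ncard_le_one hXf (by omega), Set.ncard_empty]
    omega
  rcases Nat.lt_or_ge X.ncard 3 with h2 | h2
  · have : E(G.induce X).ncard ≤ 1 := by
      rw [Set.ncard_le_one (hE.subset hsub)]
      rintro e ⟨x, y, hxy, hx, hy⟩ f ⟨u, v, huv, hu, hv⟩
      obtain ⟨a, b, -, rfl⟩ := Set.ncard_eq_two.1 (by omega : X.ncard = 2)
      simp only [Set.mem_insert_iff, Set.mem_singleton_iff] at hx hy hu hv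
      have hne₁ := hxy.ne
      have hne₂ := huv.ne
      rcases hx with rfl | rfl <;> rcases hy with rfl | rfl <;> rcases hu with rfl | rfl <;>
        rcases hv with rfl | rfl <;> first
        | exact (hne₁ rfl).elim
        | exact (hne₂ rfl).elim
        | exact hxy.eq huv
        | exact hxy.eq huv.symm
    omega
  · omega

/-- If some edge does not lie in two triangles, the faces on its two sides are bounded by the same
triangle. The sum of their indicators then has no jumps and is constant, so every edge has one of
these faces at its side and belongs to the triangle. -/
lemma PlaneDrawing.IsTriangulated.isSparse_or_isDense [G.Simple] (hD : D.IsTriangulated)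
    (hV : V(G).Finite) (hE : E(G).Finite) : IsSparse G ∨ IsDense G := by
  classical
  by_cases hG : ∀ x y, G.Adj x y →
      ∃ u v, u ≠ v ∧ G.Adj x u ∧ G.Adj y u ∧ G.Adj x v ∧ G.Adj y v
  · exact Or.inr (isDense_of_two_triangles hV hE hG)
  left
  push Not at hG
  obtain ⟨x, y, ⟨e, he⟩, hG⟩ := hG
  have : Fintype E(G) := hE.fintype
  obtain ⟨P, N, hPN⟩ := D.exists_isSides
  -- a point of every edge on the boundary of the faces on its sides
  have hbd : ∀ k : E(G), ∃ m ∈ D.arc k, m ∉ D.pos '' V(G) ∧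
      ∀ p, D.comp (P k) = D.comp p ∨ D.comp (N k) = D.comp p → m ∈ frontier (D.comp p) := by
    intro k
    obtain ⟨m, hmk, hm, hcl⟩ := hPN.mem_closure k
    refine ⟨m, hmk, hm, fun p hp ↦ ?_⟩
    refine D.mem_frontier_comp hE (D.arc_subset_arcs k.2 hmk) ?_
    rcases hp with hp | hp
    · exact (hcl _ (D.isLocConst_indic hE p)).1
        (indic_of_mem (hp ▸ D.mem_comp (hPN.notMem k).1))
    · exact (hcl _ (D.isLocConst_indic hE p)).2
        (indic_of_mem (hp ▸ D.mem_comp (hPN.notMem k).2))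
  let e' : E(G) := ⟨e, he.edge_mem⟩
  obtain ⟨m, hme, hm, hme'⟩ := hbd e'
  obtain ⟨z, f, g, hf, hg, hT⟩ := hD.exists_triangle
    (hD.isFace_comp hV hE (hPN.notMem e').1) he hme hm (hme' _ (Or.inl rfl))
  obtain ⟨z', f', g', hf', hg', hT'⟩ := hD.exists_triangle
    (hD.isFace_comp hV hE (hPN.notMem e').2) he hme hm (hme' _ (Or.inr rfl))
  obtain rfl : z = z' := by
    by_contra hne
    exact hG z z' hne ⟨g, hg.symm⟩ ⟨f, hf⟩ ⟨g', hg'.symm⟩ ⟨f', hf'⟩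
  obtain rfl := hf.eq hf'
  obtain rfl := hg.eq hg'
  clear hf' hg'
  let f₁ : E(G) := ⟨f, hf.edge_mem⟩
  let g₁ : E(G) := ⟨g, hg.edge_mem⟩
  -- the edges on the boundary of the two faces
  have hside : ∀ p, frontier (D.comp p) = D.arc e ∪ D.arc f ∪ D.arc g → ∀ k : E(G),
      D.comp (P k) = D.comp p ∨ D.comp (N k) = D.comp p → k = e' ∨ k = f₁ ∨ k = g₁ := by
    intro p hp k hk
    obtain ⟨m, hmk, hm, h⟩ := hbd k
    have h := h p hk
    rw [hp] at h
    rcases h with (h | h) | h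
    · exact Or.inl (Subtype.ext (D.eq_of_mem_arc k.2 he.edge_mem hmk hm h))
    · exact Or.inr (Or.inl (Subtype.ext (D.eq_of_mem_arc k.2 hf.edge_mem hmk hm h)))
    · exact Or.inr (Or.inr (Subtype.ext (D.eq_of_mem_arc k.2 hg.edge_mem hmk hm h)))
  have hef : e' ≠ f₁ := fun h ↦ by
    have h : e = f := congrArg Subtype.val h
    subst h
    exact hg.ne (hf.right_unique he.symm)
  have heg : e' ≠ g₁ := fun h ↦ by
    have h : e = g := congrArg Subtype.val h
    subst h
    exact hf.ne (he.right_unique hg.symm)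
  have hfg : f₁ ≠ g₁ := fun h ↦ by
    have h : f = g := congrArg Subtype.val h
    subst h
    exact he.ne (hg.right_unique hf.symm)
  -- the two sides of `e` lie in different faces
  have hne : D.comp (P e') ≠ D.comp (N e') := by
    intro heq
    -- The triangle is an even set, hence the jump set of a locally constant `φ`. As `φ` jumps
    -- across `e`, the two sides cannot lie in one component.
    obtain ⟨φ, hφ, h⟩ := hPN.exists_eq
      (fun k ↦ if k ∈ ({e', f₁, g₁} : Finset E(G)) then 1 else 0) (by
        simp only [ite_smul, one_smul, zero_smul]
        rw [← Finset.sum_filter, Finset.filter_mem_eq_inter, Finset.univ_inter,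
          Finset.sum_insert (by simp [hef, heg]), Finset.sum_insert (by simp [hfg]),
          Finset.sum_singleton, ← add_assoc]
        exact edgeVec_triangle he hf hg)
    have h1 := h e'
    have h2 : N e' ∈ D.comp (P e') := heq.symm ▸ D.mem_comp (hPN.notMem e').2
    rw [hφ.eq_of_mem_comp (hPN.notMem e').1 h2,
      CharTwo.add_self_eq_zero, if_pos (by simp)] at h1
    exact zero_ne_one h1
  have hcase : ∀ c d : ZMod 2, c + d ≠ 0 → c = 1 ∨ d = 1 := by decide
  have hmem : ∀ q ∉ D.arcs, ∀ p, indic (D.comp p) q = 1 → D.comp q = D.comp p :=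
    fun q _ p h ↦ (D.comp_eq (indic_eq_one.1 h)).symm
  -- the boundary of each of the two faces is the triangle
  have hbdry : ∀ p, frontier (D.comp p) = D.arc e ∪ D.arc f ∪ D.arc g →
      indic (D.comp p) (P e') + indic (D.comp p) (N e') ≠ 0 → ∀ k : E(G),
      (k = e' ∨ k = f₁ ∨ k = g₁) ↔ indic (D.comp p) (P k) + indic (D.comp p) (N k) ≠ 0 := by
    intro p hp h k
    have hsupp : ∀ k : E(G), indic (D.comp p) (P k) + indic (D.comp p) (N k) ≠ 0 →
        k = e' ∨ k = f₁ ∨ k = g₁ := by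
      intro k hk
      refine hside p hp k ?_
      rcases hcase _ _ hk with h | h
      · exact Or.inl (hmem _ (hPN.notMem k).1 p h)
      · exact Or.inr (hmem _ (hPN.notMem k).2 p h)
    have h2 := apply_ne_zero_of_even_triangle
      (hPN.sum_eq_zero _ (D.isLocConst_indic hE p)) (e := e') (f := f₁) (g := g₁) he hf hg hsupp h
    refine ⟨?_, hsupp k⟩
    rintro (rfl | rfl | rfl)
    · exact h
    · exact h2.1
    · exact h2.2
  have hP1 : indic (D.comp (P e')) (P e') = 1 := indic_of_mem (D.mem_comp (hPN.notMem e').1)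
  have hN1 : indic (D.comp (N e')) (N e') = 1 := indic_of_mem (D.mem_comp (hPN.notMem e').2)
  have hP0 : indic (D.comp (P e')) (N e') = 0 :=
    indic_of_notMem fun h ↦ hne (D.comp_eq h)
  have hN0 : indic (D.comp (N e')) (P e') = 0 :=
    indic_of_notMem fun h ↦ hne (D.comp_eq h).symm
  have hb1 := hbdry _ hT (by rw [hP1, hP0, add_zero]; exact one_ne_zero)
  have hb2 := hbdry _ hT' (by rw [hN1, hN0, zero_add]; exact one_ne_zero)
  -- Both indicators jump exactly at the edges of the triangle, so their sum has no jumps.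
  have hconst := hPN.eq_of_zero (fun q ↦ indic (D.comp (P e')) q + indic (D.comp (N e')) q)
    (fun q hq ↦ by
      filter_upwards [D.isLocConst_indic hE (P e') q hq, D.isLocConst_indic hE (N e') q hq]
        with r h1 h2
      rw [h1, h2])
    (fun k ↦ by
      have h1 : ∀ c d : ZMod 2, (c ≠ 0 ↔ d ≠ 0) → c + d = 0 := by decide
      have h2 := h1 _ _ ((hb1 k).symm.trans (hb2 k))
      rw [← h2]
      ring)
  -- The constant is `1`, its value at `P e'`; hence `P k` lies in one of the two faces, whose
  -- boundary contains only edges of the triangle.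
  have hall : ∀ k : E(G), k ∈ ({e', f₁, g₁} : Finset E(G)) := by
    intro k
    have h1 := hconst _ (hPN.notMem k).1 _ (hPN.notMem e').1
    simp only [hP1, hN0, add_zero] at h1
    simp only [Finset.mem_insert, Finset.mem_singleton]
    rcases hcase _ _ (h1.trans_ne one_ne_zero) with h | h
    · exact hside _ hT k (Or.inl (hmem _ (hPN.notMem k).1 _ h))
    · exact hside _ hT' k (Or.inl (hmem _ (hPN.notMem k).1 _ h))
  refine isSparse_of_ncard_edgeSet_le_three hV hE ?_
  rw [← Nat.card_coe_set_eq, Nat.card_eq_fintype_card, ← Finset.card_univ,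
    ← Finset.eq_univ_of_forall hall]
  exact Finset.card_le_three

lemma IsTriangulation.isSparse_or_isDense (h : IsTriangulation G) (hV : V(G).Finite)
    (hE : E(G).Finite) : IsSparse G ∨ IsDense G := by
  obtain ⟨hs, D, hD⟩ := h
  exact PlaneDrawing.IsTriangulated.isSparse_or_isDense (D := D) hD hV hE

end Triangulation

end MerinoWelsh

theorem mainTheorem11 {α β : Type*} (G : Graph α β) (hV : V(G).Finite) (hE : E(G).Finite)
    (hG : MerinoWelsh.IsEdgeConnected G 4 ∨
      (MerinoWelsh.IsVertexConnected G 2 ∧ MerinoWelsh.IsThreshold G) ∨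
      MerinoWelsh.IsCompleteBipartite G ∨
      (G.Simple ∧ MerinoWelsh.SeriesParallel G) ∨
      MerinoWelsh.IsCubic G ∨
      MerinoWelsh.IsBipartitePlanar G ∨
      MerinoWelsh.IsLaman G ∨
      MerinoWelsh.IsTriangulation G ∨
      (∃ n : ℕ, 2 ≤ n ∧ MerinoWelsh.IsWheel G n) ∨
      (∃ n : ℕ, 2 ≤ n ∧ MerinoWelsh.IsSquareLattice G n) ∨
      (∃ n : ℕ, 2 ≤ n ∧ MerinoWelsh.IsCycle G n) ∨
      (∃ n : ℕ, 1 ≤ n ∧ MerinoWelsh.IsTree G n))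
    (a : ℝ) (ha : 2 ≤ a) :
    MerinoWelsh.tutte G a a ≤
      max (MerinoWelsh.tutte G (2 * a) 0) (MerinoWelsh.tutte G 0 (2 * a)) := by
  have sparse (h : MerinoWelsh.IsSparse G) :
      MerinoWelsh.tutte G a a ≤ max (MerinoWelsh.tutte G (2 * a) 0) (MerinoWelsh.tutte G 0 (2 * a)) :=
    le_max_of_le_left (h.tutte_le hV hE ha)
  have dense (h : MerinoWelsh.IsDense G) :
      MerinoWelsh.tutte G a a ≤ max (MerinoWelsh.tutte G (2 * a) 0) (MerinoWelsh.tutte G 0 (2 * a)) :=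
    le_max_of_le_right (h.tutte_le hV hE ha)
  rcases hG with h | ⟨hc, h⟩ | h | ⟨hs, h⟩ | h | h | h | h | ⟨n, hn, h⟩ | ⟨n, -, h⟩ | ⟨n, hn, h⟩ |
    ⟨n, -, h⟩
  · exact dense (h.isDense hV hE)
  · exact (h.isSparse_or_isDense hc hV hE).elim sparse dense
  · exact (h.isSparse_or_isDense hV hE).elim sparse dense
  · exact sparse (h.isSparse hs hV hE)
  · exact sparse (h.isSparse hV hE)
  · exact sparse (h.isSparse hV hE)
  · exact sparse (h.isSparse hV hE)
  · exact (h.isSparse_or_isDense hV hE).elim sparse dense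
  · exact sparse (h.isSparse hn hV hE)
  · exact sparse (h.isSparse hV hE)
  · exact sparse (h.isSparse hn hV hE)
  · exact sparse (h.isSparse hV hE)
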